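/- **Lemma (Momentum-entropy estimate).** Let $p\in(1,2)\cup(2,3)$ and $\frac1p+\frac1q=1$. Let $(X,d)$ be a proper metric space with a finite Borel measure $\mu$. *Setting.* For $f:X\to\mathbb R$ let $|Df|(x)=\limsup_{y\to x,\,y\ne x}\frac{|f(y)-f(x)|}{d(x,y)}$ ($0$ at isolated points). A function $g\in L^q(\mu)$ is a $q$-relaxed slope of $f\in L^2(\mu)$ if there are Lipschitz functions $f_n\to f$ strongly in $L^2(\mu)$ such that $|Df_n|$ converges weakly in $L^q(\mu)$ to some $\tilde g$ with $\tilde g\le g$ $\mu$-a.e.; $|\nabla f|_*$ denotes the $q$-relaxed slope of minimal $L^q$-norm, and $\operatorname{Ch}_q(f)=\frac1q\int|\nabla f|_*^q\,d\mu$ ($=\infty$ if $f$ has no relaxed slope). The gradient flow of $\operatorname{Ch}_q$ from $f_0\in L^2(\mu)$ is the curve $t\mapsto f_t\in L^2(\mu)$, locally Lipschitz on $(0,\infty)$, with $f_t\to f_0$ in $L^2(\mu)$ as $t\downarrow0$ and $\frac{d}{dt}f_t\in-\partial^-\operatorname{Ch}_q(f_t)$ for a.e. $t>0$, where $\partial^-\operatorname{Ch}_q$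 is the subdifferential in $L^2(\mu)$. Write $\exp_p(t)=(1+(2-p)t)^{1/(2-p)}$, and let $\operatorname{Lip}(V)$ be the least Lipschitz constant of $V$. *Assumptions.* Let $V:X\to[0,\infty)$ be Lipschitz with $V\ge\epsilon$ for some $\epsilon>0$. If $p\in(2,3)$, assume $\int V^p\exp_p(-V^p)\,d\mu<\infty$ and $\int\exp_p(-V^p)\,d\mu\le1$. Let $f_0\in L^2(\mu)$ be non-negative with $\int V^pf_0\,d\mu<\infty$, and let $f_t$ be the gradient flow of $\operatorname{Ch}_q$ from $f_0$. Let $z>0$ satisfy $z\int\exp_p(-V^p)\,d\mu\le\int f_0\,d\mu$ if $p\in(2,3)$, and $z\le1$ if $p\in(1,2)$. *Conclusion.* $V^pf_t$ is $\mu$-integrable for every $t\ge0$, the function $t\mapsto\int V^pf_t\,d\mu$ is locally absolutely continuous in $[0,\infty)$, and for every $t\ge0$ $$\int V^pf_t\,d\mu\le S_t,\qquad \int_0^t\int_{\{f_s>0\}}\frac{|\nabla f_s|_*^q}{f_s^{p-1}}\,d\mu\,ds\le\frac4{3-p}S_t$$ (the inner integral being a measurable function of $s$ up to a null set), where $$S_t=e^{C_p\operatorname{Lip}(V)^qt}\Big(I_p+\int\tfrac1{2-p}\big(f_0^{3-p}-f_0\big)+\big(pV^p+z^{-1}l_p\big)f_0\,d\mu\Big),$$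 $l_p=\max\{\frac1{2-p},1\}$; $I_p=0$ if $p\in(1,2)$ and $I_p=\frac{p-2}{3-p}\int V^p\exp_p(-V^p)\,d\mu$ if $p\in(2,3)$; and $$C_p=\frac{1}{q}\Big(\frac p{3-p}\Big)^q\ \text{ if }p\in(1,2),\qquad C_p=\max\Big\{1,\frac{p(3-p)}{2p-3}\Big\}\cdot\frac1q\Big(\frac p{3-p}\Big)^q\ \text{ if }p\in(2,3).$$ -/

import Mathlib

open MeasureTheory Filter Topology Set
open scoped ENNReal NNReal

noncomputable section

namespace QHeat

variable {X : Type*} [MetricSpace X] [MeasurableSpace X]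

/-- The local Lipschitz constant `|Df|(x) = limsup_{y → x, y ≠ x} |f y - f x| / d(y, x)`
(it is `0` at isolated points). -/
def localLip (f : X → ℝ) (x : X) : ℝ≥0∞ :=
  limsup (fun y => ENNReal.ofReal (|f y - f x| / dist y x)) (𝓝[≠] x)

/-- The global Lipschitz constant `Lip(V)`: the least `K` such that `V` is `K`-Lipschitz. -/
def lipConst (V : X → ℝ) : ℝ :=
  ((sInf {K : ℝ≥0 | LipschitzWith K V} : ℝ≥0) : ℝ)

/-- `g ∈ L^q` is a `q`-relaxed slope of `f ∈ L²`: there are Lipschitz functions `u n → f`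
strongly in `L²` such that `|D(u n)|` converges weakly in `L^q` to some `g' ∈ L^q`
with `g' ≤ g` almost everywhere. Weak convergence is tested against the functions
in the dual space `L^{q/(q-1)}`. -/
def IsRelaxedSlope (q : ℝ) {μ : Measure X} (f : Lp ℝ 2 μ) (g : Lp ℝ (ENNReal.ofReal q) μ) :
    Prop :=
  ∃ (u : ℕ → X → ℝ) (g' : Lp ℝ (ENNReal.ofReal q) μ),
    (∀ n, ∃ K : ℝ≥0, LipschitzWith K (u n)) ∧
    Tendsto (fun n => eLpNorm (fun x => u n x - f x) 2 μ) atTop (𝓝 0) ∧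
    (∀ n, MemLp (fun x => (localLip (u n) x).toReal) (ENNReal.ofReal q) μ) ∧
    (∀ h : X → ℝ, MemLp h (ENNReal.ofReal (Real.conjExponent q)) μ →
      Tendsto (fun n => ∫ x, (localLip (u n) x).toReal * h x ∂μ) atTop
        (𝓝 (∫ x, g' x * h x ∂μ))) ∧
    ∀ᵐ x ∂μ, g' x ≤ g x

/-- `g` is a relaxed slope of `f` of least `L^q`-norm. -/
def IsMinimalRelaxedSlope (q : ℝ) {μ : Measure X} (f : Lp ℝ 2 μ)
    (g : Lp ℝ (ENNReal.ofReal q) μ) : Prop :=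
  IsRelaxedSlope q f g ∧ ∀ g' : Lp ℝ (ENNReal.ofReal q) μ, IsRelaxedSlope q f g' →
    eLpNorm g (ENNReal.ofReal q) μ ≤ eLpNorm g' (ENNReal.ofReal q) μ

open Classical in
/-- `|∇f|_*`: the relaxed slope of least `L^q`-norm; `∞` if there is none. -/
def minRelaxedSlope (q : ℝ) {μ : Measure X} (f : Lp ℝ 2 μ) : X → ℝ≥0∞ :=
  if h : ∃ g : Lp ℝ (ENNReal.ofReal q) μ, IsMinimalRelaxedSlope q f g then
    fun x => ENNReal.ofReal (h.choose x)
  else fun _ => ⊤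

open Classical in
/-- The `q`-Cheeger energy `Ch_q(f) = (1/q) ∫ |∇f|_*^q dμ`; it is `∞` if `f` has no
relaxed slope. -/
def cheeger (q : ℝ) {μ : Measure X} (f : Lp ℝ 2 μ) : ℝ≥0∞ :=
  if ∃ g : Lp ℝ (ENNReal.ofReal q) μ, IsRelaxedSlope q f g then
    ENNReal.ofReal (1 / q) * ∫⁻ x, minRelaxedSlope q f x ^ q ∂μ
  else ⊤

/-- The subdifferential `∂⁻Ch_q(f)` in `L²` (empty where `Ch_q(f) = ∞`). -/
def subdiffCheeger (q : ℝ) {μ : Measure X} (f : Lp ℝ 2 μ) : Set (Lp ℝ 2 μ) :=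
  {l | cheeger q f ≠ ⊤ ∧ ∀ g : Lp ℝ 2 μ, cheeger q g ≠ ⊤ →
    ∫ x, l x * (g x - f x) ∂μ ≤ (cheeger q g).toReal - (cheeger q f).toReal}

/-- `t ↦ f t`, `t ≥ 0`, is the gradient flow of `Ch_q` in `L²` (the `q`-heat flow) starting
at `f 0`. -/
structure IsHeatFlow (q : ℝ) {μ : Measure X} (f : ℝ → Lp ℝ 2 μ) : Prop where
  tendsto_zero : Tendsto f (𝓝[>] 0) (𝓝 (f 0))
  locallyLipschitz : LocallyLipschitzOn (Ioi 0) f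
  deriv_mem : ∀ᵐ t ∂(volume.restrict (Ioi (0 : ℝ))),
    ∃ l ∈ subdiffCheeger q (f t), HasDerivAt f (-l) t

/-- `∫_{f > 0} |∇f|_*^q / f^(p-1) dμ`. -/
def fisher (p q : ℝ) {μ : Measure X} (f : Lp ℝ 2 μ) : ℝ≥0∞ :=
  ∫⁻ x in {x | 0 < f x}, minRelaxedSlope q f x ^ q / ENNReal.ofReal (f x ^ (p - 1)) ∂μ

/-- The generalized exponential `exp_p(t) = (1 + (2 - p) t)^(1/(2-p))`, used only where the
base is positive. -/
def expP (p t : ℝ) : ℝ := (1 + (2 - p) * t) ^ (1 / (2 - p))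

/-- `I_p`. -/
def entropyConst (p : ℝ) (μ : Measure X) (V : X → ℝ) : ℝ :=
  if p < 2 then 0 else (p - 2) / (3 - p) * ∫ x, V x ^ p * expP p (-(V x ^ p)) ∂μ

/-- `C_p`. -/
def growthConst (p q : ℝ) : ℝ :=
  (if p < 2 then 1 else max 1 (p * (3 - p) / (2 * p - 3))) * ((p / (3 - p)) ^ q / q)

/-- `S_t`. -/
def momentBound (p q : ℝ) (μ : Measure X) (V : X → ℝ) (z : ℝ) (f₀ : X → ℝ) (t : ℝ) : ℝ :=
  Real.exp (growthConst p q * lipConst V ^ q * t) *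
    (entropyConst p μ V +
      ∫ x, (1 / (2 - p) * (f₀ x ^ (3 - p) - f₀ x) +
        (p * V x ^ p + z⁻¹ * max (1 / (2 - p)) 1) * f₀ x) ∂μ)

end QHeat

end

/-! The estimate is a Grönwall argument for H(t) = E(f_t) + a + k M(t), where E is `entropy`, M(t) =
∫ V^p f_t dμ, a = I_p + z⁻¹ l_p ∫ f_0 dμ, and F is `fisher`. Two facts drive it. Dissipation
(`IsHeatFlow.lintegral_fisher`): E(f_0) - E(f_t) = (3-p) ∫_0^t F(f_s) ds. Moment growth
(`IsHeatFlow.moment`): formally |M'| ≤ p Lip(V) ∫ V^(p-1) |∇f|_*^(q-1) dμ, and Young's inequality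
with a parameter γ bounds this by γ^p F + (p-1) Lip(V)^q γ^(-q) M. With γ^p = (3-p)/k the Fisher
term is exactly paid for by the entropy, which leaves H(t) ≤ H(0) + b ∫_0^t M.

To close the argument, M must be controlled by H, that is, the entropy needs a lower bound. For p <
2 it is bounded below by a multiple of the conserved mass, and k = 1 works. For p > 2 the tangent
line inequality at exp_p(-V^p) gives E + a ≥ -(3-p) M, so k = p leaves (2p-3) M ≤ H. The same lower
bounds show that a quarter of the dissipated entropy is controlled by H(0) + b ∫ M, whence the
factor 4/(3-p).

The analytic groundwork starts from weak limits. Uniform convexity of L^q shows that |∇f|_* is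
unique and is a strong L^q-limit of slopes of Lipschitz functions (`exists_isOptimalSlope`).
Competitors f + tΘ(f) and f + tW built from these functions, inserted in the subdifferential
inequality, give the chain rule `integral_mul_comp_eq` and the bound `abs_integral_mul_le`. Both
require bounded data, so r^(1-p) is regularized to (r+δ)^(1-p) and V is truncated to min(V,N). The
bounds are uniform, and locality (|∇f|_* = 0 on {f = 0}) controls the singular set in the limit. -/

set_option linter.unusedSectionVars false

noncomputable section

namespace QHeat

/-! ### Calculus of the pointwise Lipschitz constant. -/

section LocalLipschitz

variable {X : Type*} [MetricSpace X]

/-- The local Lipschitz constant as a real number. -/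
def realLip (u : X → ℝ) (x : X) : ℝ := (localLip u x).toReal

theorem realLip_nonneg (u : X → ℝ) (x : X) : 0 ≤ realLip u x := ENNReal.toReal_nonneg

theorem localLip_le {u : X → ℝ} {x : X} {c : ℝ}
    (h : ∀ᶠ y in 𝓝[≠] x, |u y - u x| ≤ c * dist y x) :
    localLip u x ≤ ENNReal.ofReal c := by
  refine limsup_le_of_le (by isBoundedDefault) ?_
  filter_upwards [h, self_mem_nhdsWithin] with y hy hne
  exact ENNReal.ofReal_le_ofReal ((div_le_iff₀ (dist_pos.2 hne)).2 hy)

theorem realLip_le {u : X → ℝ} {x : X} {c : ℝ} (hc : 0 ≤ c)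
    (h : ∀ᶠ y in 𝓝[≠] x, |u y - u x| ≤ c * dist y x) : realLip u x ≤ c :=
  ENNReal.toReal_le_of_le_ofReal hc (localLip_le h)

theorem localLip_lt_top {u : X → ℝ} {K : ℝ≥0} (hu : LipschitzWith K u) (x : X) :
    localLip u x < ⊤ := by
  refine (localLip_le (c := K) (Eventually.of_forall fun y => ?_)).trans_lt ENNReal.ofReal_lt_top
  simpa [Real.dist_eq] using hu.dist_le_mul y x

theorem realLip_le_of_lipschitz {u : X → ℝ} {K : ℝ≥0} (hu : LipschitzWith K u) (x : X) :
    realLip u x ≤ K := by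
  refine realLip_le K.2 (Eventually.of_forall fun y => ?_)
  simpa [Real.dist_eq] using hu.dist_le_mul y x

theorem eventually_le_of_realLip_lt {u : X → ℝ} {K : ℝ≥0} (hu : LipschitzWith K u) {x : X} {c : ℝ}
    (h : realLip u x < c) : ∀ᶠ y in 𝓝[≠] x, |u y - u x| ≤ c * dist y x := by
  have h' : localLip u x < ENNReal.ofReal c :=
    (ENNReal.lt_ofReal_iff_toReal_lt (localLip_lt_top hu x).ne).2 h
  filter_upwards [eventually_lt_of_limsup_lt h', self_mem_nhdsWithin] with y hy hne
  have := (ENNReal.ofReal_lt_ofReal_iff ((realLip_nonneg u x).trans_lt h)).1 hy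
  exact ((div_lt_iff₀ (dist_pos.2 hne)).1 this).le

theorem realLip_add_le {u v : X → ℝ} {K L : ℝ≥0} (hu : LipschitzWith K u) (hv : LipschitzWith L v)
    (x : X) : realLip (fun y => u y + v y) x ≤ realLip u x + realLip v x := by
  refine le_of_forall_pos_le_add fun η hη => ?_
  have h1 := eventually_le_of_realLip_lt hu (c := realLip u x + η / 2) (x := x) (by linarith)
  have h2 := eventually_le_of_realLip_lt hv (c := realLip v x + η / 2) (x := x) (by linarith)
  refine realLip_le (by linarith [realLip_nonneg u x, realLip_nonneg v x]) ?_
  filter_upwards [h1, h2] with y h1 h2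
  calc |u y + v y - (u x + v x)| = |(u y - u x) + (v y - v x)| := by ring_nf
    _ ≤ _ := (abs_add_le _ _).trans (by linarith)

/-- Differentiability of `φ` at the single value `u x` suffices: the linearization error is at most
`η * |u y - u x|` near `x`, and then `η → 0`. -/
theorem realLip_comp_le {u : X → ℝ} {K : ℝ≥0} (hu : LipschitzWith K u) {x : X} {φ : ℝ → ℝ}
    {a : ℝ} (hφ : HasDerivAt φ a (u x)) :
    realLip (fun y => φ (u y)) x ≤ |a| * realLip u x := by
  have key : ∀ η > 0, realLip (fun y => φ (u y)) x ≤ (|a| + η) * (realLip u x + η) := by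
    intro η hη
    have h1 := eventually_le_of_realLip_lt hu (c := realLip u x + η) (x := x) (by linarith)
    have h2 := (hφ.isLittleO.def hη)
    have h3 : Tendsto u (𝓝[≠] x) (𝓝 (u x)) := hu.continuous.continuousAt.mono_left inf_le_left
    have := realLip_nonneg u x
    have := abs_nonneg a
    refine realLip_le (by positivity) ?_
    filter_upwards [h1, h3.eventually h2] with y h1 h2
    simp only [smul_eq_mul, Real.norm_eq_abs] at h2
    calc |φ (u y) - φ (u x)| = |(φ (u y) - φ (u x) - (u y - u x) * a) + (u y - u x) * a| := by
          ring_nf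
      _ ≤ η * |u y - u x| + |u y - u x| * |a| := by
          refine (abs_add_le _ _).trans ?_
          rw [abs_mul]; linarith
      _ = (|a| + η) * |u y - u x| := by ring
      _ ≤ (|a| + η) * ((realLip u x + η) * dist y x) := by gcongr
      _ = _ := by ring
  have hl : Tendsto (fun η : ℝ => (|a| + η) * (realLip u x + η)) (𝓝[>] 0)
      (𝓝 ((|a| + 0) * (realLip u x + 0))) := by
    refine Tendsto.mono_left (Continuous.tendsto ?_ 0) inf_le_left
    fun_prop
  simp only [add_zero] at hl
  exact ge_of_tendsto hl (by filter_upwards [self_mem_nhdsWithin] with η hη using key η hη)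

theorem realLip_const_mul_le {u : X → ℝ} {K : ℝ≥0} (hu : LipschitzWith K u) (a : ℝ) (x : X) :
    realLip (fun y => a * u y) x ≤ |a| * realLip u x :=
  realLip_comp_le hu (φ := fun r => a * r) (by simpa using (hasDerivAt_id (u x)).const_mul a)

/-- The limsup is an infimum over radii `1/(n+1)` of suprema over punctured balls. Each supremum is
lower semicontinuous in the centre, because a fixed witness `y` stays in the open punctured ball and
its difference quotient varies continuously. -/
theorem measurable_localLip [MeasurableSpace X] [BorelSpace X] {u : X → ℝ} (hu : Continuous u) :
    Measurable (localLip u) := by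
  have h : localLip u = fun x => ⨅ n : ℕ, ⨆ y ∈ Metric.ball x (1 / (n + 1)) ∩ {x}ᶜ,
      ENNReal.ofReal (|u y - u x| / dist y x) := by
    ext x
    rw [localLip, (nhdsWithin_hasBasis Metric.nhds_basis_ball_inv_nat_succ _).limsup_eq_iInf_iSup]
    simp
  rw [h]
  refine Measurable.iInf fun n => LowerSemicontinuous.measurable ?_
  rw [lowerSemicontinuous_iff_isOpen_preimage]
  intro c
  rw [isOpen_iff_mem_nhds]
  intro x hx
  obtain ⟨y, hy, hxy⟩ : ∃ y ∈ Metric.ball x (1 / (n + 1)) ∩ {x}ᶜ,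
      c < ENNReal.ofReal (|u y - u x| / dist y x) := by
    simpa [lt_iSup_iff] using hx
  have hne : dist y x ≠ 0 := dist_ne_zero.2 hy.2
  have hc : ContinuousAt (fun x => ENNReal.ofReal (|u y - u x| / dist y x)) x :=
    ENNReal.continuous_ofReal.continuousAt.comp
      (ContinuousAt.div (by fun_prop) (by fun_prop) hne)
  have hd : ContinuousAt (fun x => dist y x) x := by fun_prop
  filter_upwards [hc.eventually (lt_mem_nhds hxy), hd.eventually (gt_mem_nhds hy.1),
    hd.eventually_ne hne] with x' h1 h2 h3
  simp only [mem_preimage, mem_Ioi, lt_iSup_iff]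
  exact ⟨y, ⟨h2, dist_ne_zero.1 h3⟩, h1⟩

theorem measurable_realLip [MeasurableSpace X] [BorelSpace X] {u : X → ℝ} (hu : Continuous u) :
    Measurable (realLip u) := (measurable_localLip hu).ennreal_toReal

/-- The admissible constants form a closed set, so the infimum is itself a Lipschitz constant. -/
theorem lipschitzWith_lipConst {V : X → ℝ} (hV : ∃ K : ℝ≥0, LipschitzWith K V) :
    LipschitzWith (sInf {K : ℝ≥0 | LipschitzWith K V}) V := by
  have hc : IsClosed {K : ℝ≥0 | LipschitzWith K V} := by
    simp only [LipschitzWith, ofPred_forall]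
    refine isClosed_iInter fun x => isClosed_iInter fun y => isClosed_le continuous_const ?_
    exact (ENNReal.continuous_mul_const (edist_ne_top x y)).comp ENNReal.continuous_coe
  exact hc.csInf_mem hV (OrderBot.bddBelow _)

end LocalLipschitz

/-! ### Uniform convexity of L^q. -/

section UniformConvexity

theorem abs_midpoint_rpow_le {q : ℝ} (hq : 1 < q) (a b : ℝ) :
    |(a + b) / 2| ^ q ≤ (|a| ^ q + |b| ^ q) / 2 := by
  have h1 : |(a + b) / 2| ≤ (1 / 2 : ℝ) * |a| + (1 / 2 : ℝ) * |b| := by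
    rw [abs_div, abs_two]; linarith [abs_add_le a b]
  have h2 := (convexOn_rpow hq.le).2 (abs_nonneg a) (abs_nonneg b)
    (by norm_num : (0 : ℝ) ≤ 1 / 2) (by norm_num : (0 : ℝ) ≤ 1 / 2) (by norm_num)
  simp only [smul_eq_mul] at h2
  calc _ ≤ _ := Real.rpow_le_rpow (abs_nonneg _) h1 (by linarith)
    _ ≤ _ := h2
    _ = _ := by ring

theorem abs_midpoint_rpow_lt {q : ℝ} (hq : 1 < q) {a b : ℝ} (hab : a ≠ b) :
    |(a + b) / 2| ^ q < (|a| ^ q + |b| ^ q) / 2 := by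
  by_cases h : |a| = |b|
  -- Strict convexity on `[0, ∞)` only separates different absolute values; when `a = -b` the
  -- midpoint is zero.
  · have hab' : a = -b := (abs_eq_abs.1 h).resolve_left hab
    have hb : b ≠ 0 := by rintro rfl; simp at hab'; exact hab hab'
    have : 0 < |b| ^ q := Real.rpow_pos_of_pos (abs_pos.2 hb) q
    rw [h, hab', neg_add_cancel, zero_div, abs_zero, Real.zero_rpow (by linarith)]
    linarith
  · have h1 : |(a + b) / 2| ≤ (1 / 2 : ℝ) * |a| + (1 / 2 : ℝ) * |b| := by
      rw [abs_div, abs_two]; linarith [abs_add_le a b]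
    have h2 := (strictConvexOn_rpow hq).2 (abs_nonneg a) (abs_nonneg b) h
      (by norm_num : (0 : ℝ) < 1 / 2) (by norm_num : (0 : ℝ) < 1 / 2) (by norm_num)
    simp only [smul_eq_mul] at h2
    calc _ ≤ _ := Real.rpow_le_rpow (abs_nonneg _) h1 (by linarith)
      _ < _ := h2
      _ = _ := by ring

/-- A quantitative form of the strict convexity of `|·|^q`, `q > 1`. -/
theorem exists_abs_sub_rpow_le {q : ℝ} (hq : 1 < q) {ε : ℝ} (hε : 0 < ε) :
    ∃ K : ℝ, 0 ≤ K ∧ ∀ a b : ℝ, |a - b| ^ q ≤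
      ε * (|a| ^ q + |b| ^ q) + K * ((|a| ^ q + |b| ^ q) / 2 - |(a + b) / 2| ^ q) := by
  have hq0 : 0 < q := by linarith
  set D : ℝ × ℝ → ℝ := fun z => (|z.1| ^ q + |z.2| ^ q) / 2 - |(z.1 + z.2) / 2| ^ q with hD
  have hDc : Continuous D := by
    have h1 : Continuous fun z : ℝ × ℝ => |z.1| ^ q :=
      Continuous.rpow_const (by fun_prop) fun _ => Or.inr hq0.le
    have h2 : Continuous fun z : ℝ × ℝ => |z.2| ^ q :=
      Continuous.rpow_const (by fun_prop) fun _ => Or.inr hq0.le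
    have h3 : Continuous fun z : ℝ × ℝ => |(z.1 + z.2) / 2| ^ q :=
      Continuous.rpow_const (by fun_prop) fun _ => Or.inr hq0.le
    exact ((h1.add h2).div_const 2).sub h3
  have hfc : Continuous fun z : ℝ × ℝ => |z.1 - z.2| ^ q :=
    Continuous.rpow_const (by fun_prop) fun _ => Or.inr hq0.le
  have hD0 : ∀ z, 0 ≤ D z := fun z => sub_nonneg.2 (abs_midpoint_rpow_le hq _ _)
  -- On the sphere, `T` is compact and misses the diagonal, so the convexity defect `D` has a
  -- positive minimum there. Outside `T` the `ε`-term suffices, since `|z.1| ^ q + |z.2| ^ q ≥ 1`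
  -- for the max norm.
  set T : Set (ℝ × ℝ) := Metric.sphere 0 1 ∩ {z | ε ≤ |z.1 - z.2| ^ q} with hT
  have hTc : IsCompact T :=
    (isCompact_sphere 0 1).inter_right (isClosed_le continuous_const hfc)
  obtain ⟨δ, hδ, hδT⟩ : ∃ δ > 0, ∀ z ∈ T, δ ≤ D z := by
    rcases T.eq_empty_or_nonempty with h | h
    · exact ⟨1, one_pos, by simp [h]⟩
    · obtain ⟨z, hz, hmin⟩ := hTc.exists_isMinOn h hDc.continuousOn
      refine ⟨D z, sub_pos.2 (abs_midpoint_rpow_lt hq ?_), fun w hw => hmin hw⟩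
      intro heq
      have : ε ≤ |z.1 - z.2| ^ q := hz.2
      rw [heq, sub_self, abs_zero, Real.zero_rpow hq0.ne'] at this
      linarith
  have hsph : ∀ z : ℝ × ℝ, ‖z‖ = 1 → |z.1 - z.2| ^ q ≤
      ε * (|z.1| ^ q + |z.2| ^ q) + 2 ^ q / δ * D z := by
    intro z hz
    have h1 : |z.1| ≤ 1 := hz ▸ norm_fst_le z
    have h2 : |z.2| ≤ 1 := hz ▸ norm_snd_le z
    by_cases hzT : ε ≤ |z.1 - z.2| ^ q
    · have h3 : δ ≤ D z := hδT z ⟨by simpa using hz, hzT⟩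
      have h4 : |z.1 - z.2| ^ q ≤ 2 ^ q :=
        Real.rpow_le_rpow (abs_nonneg _) (by linarith [abs_sub z.1 z.2]) hq0.le
      have h5 : (2 : ℝ) ^ q ≤ 2 ^ q / δ * D z := by
        rw [div_mul_eq_mul_div, le_div_iff₀ hδ]; gcongr
      have : 0 ≤ ε * (|z.1| ^ q + |z.2| ^ q) := by positivity
      linarith
    · have h3 : 1 ≤ |z.1| ^ q + |z.2| ^ q := by
        have : |z.1| = 1 ∨ |z.2| = 1 := by
          rw [Prod.norm_def] at hz
          rcases max_choice ‖z.1‖ ‖z.2‖ with h | h <;> rw [h] at hz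
          · exact Or.inl hz
          · exact Or.inr hz
        rcases this with h | h <;> rw [h, Real.one_rpow]
        · linarith [Real.rpow_nonneg (abs_nonneg z.2) q]
        · linarith [Real.rpow_nonneg (abs_nonneg z.1) q]
      have h4 : 0 ≤ 2 ^ q / δ * D z := mul_nonneg (by positivity) (hD0 z)
      nlinarith
  refine ⟨2 ^ q / δ, by positivity, fun a b => ?_⟩
  by_cases h0 : ((a, b) : ℝ × ℝ) = 0
  · obtain ⟨rfl, rfl⟩ := Prod.mk_eq_zero.1 h0
    simp [Real.zero_rpow hq0.ne']
  -- Both sides are homogeneous of degree `q`, so the sphere is enough.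
  set s : ℝ := ‖((a, b) : ℝ × ℝ)‖ with hs
  have hspos : 0 < s := norm_pos_iff.2 h0
  have hz : ‖((s⁻¹ * a, s⁻¹ * b) : ℝ × ℝ)‖ = 1 := by
    have : ((s⁻¹ * a, s⁻¹ * b) : ℝ × ℝ) = s⁻¹ • (a, b) := by simp
    rw [this, norm_smul, ← hs, norm_inv, Real.norm_of_nonneg hspos.le, inv_mul_cancel₀ hspos.ne']
  have hsc : ∀ r : ℝ, |s⁻¹ * r| ^ q = (s ^ q)⁻¹ * |r| ^ q := fun r => by
    rw [abs_mul, abs_of_pos (inv_pos.2 hspos), Real.mul_rpow (by positivity) (abs_nonneg _),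
      Real.inv_rpow hspos.le]
  have h := hsph _ hz
  simp only [hD] at h
  rw [← mul_sub, ← mul_add, mul_div_assoc, hsc, hsc, hsc, hsc] at h
  have hsq : 0 < s ^ q := by positivity
  have := mul_le_mul_of_nonneg_left h hsq.le
  calc |a - b| ^ q = s ^ q * ((s ^ q)⁻¹ * |a - b| ^ q) := by field_simp
    _ ≤ _ := this
    _ = _ := by field_simp

variable {X : Type*} [MeasurableSpace X] {μ : Measure X}

theorem fact_one_le_ofReal {q : ℝ} (hq : 1 < q) : Fact (1 ≤ ENNReal.ofReal q) :=
  ⟨by simpa using ENNReal.ofReal_le_ofReal hq.le⟩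

theorem ofReal_ne_zero_of_one_lt {q : ℝ} (hq : 1 < q) : ENNReal.ofReal q ≠ 0 := by
  simp; linarith

theorem integrable_abs_rpow {q : ℝ} (hq : 1 < q) {u : X → ℝ} (hu : MemLp u (ENNReal.ofReal q) μ) :
    Integrable (fun x => |u x| ^ q) μ := by
  have := hu.integrable_norm_rpow (ofReal_ne_zero_of_one_lt hq) ENNReal.ofReal_ne_top
  rwa [ENNReal.toReal_ofReal (by linarith)] at this

theorem toReal_eLpNorm_rpow {q : ℝ} (hq : 1 < q) {u : X → ℝ}
    (hu : MemLp u (ENNReal.ofReal q) μ) :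
    (eLpNorm u (ENNReal.ofReal q) μ).toReal ^ q = ∫ x, |u x| ^ q ∂μ := by
  have hq0 : 0 < q := by linarith
  rw [toReal_eLpNorm hu.1, lpNorm_eq_integral_norm_rpow_toReal (ofReal_ne_zero_of_one_lt hq)
    ENNReal.ofReal_ne_top hu.1, ENNReal.toReal_ofReal hq0.le, ← Real.rpow_mul
    (integral_nonneg fun x => by positivity), inv_mul_cancel₀ hq0.ne', Real.rpow_one]
  rfl

theorem Lp_norm_rpow {q : ℝ} (hq : 1 < q) (x : Lp ℝ (ENNReal.ofReal q) μ) :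
    ‖x‖ ^ q = ∫ a, |x a| ^ q ∂μ := by
  rw [Lp.norm_def, toReal_eLpNorm_rpow hq (Lp.memLp x)]

/-- Integrating the pointwise inequality gives a form of uniform convexity that covers all `q > 1`
at once, without the case split of Clarkson's inequalities. -/
theorem exists_Lp_norm_sub_rpow_le {q : ℝ} (hq : 1 < q) {ε : ℝ} (hε : 0 < ε) :
    ∃ K : ℝ, 0 ≤ K ∧ ∀ x y : Lp ℝ (ENNReal.ofReal q) μ, ‖x - y‖ ^ q ≤
      ε * (‖x‖ ^ q + ‖y‖ ^ q) +
        K * ((‖x‖ ^ q + ‖y‖ ^ q) / 2 - ‖(1 / 2 : ℝ) • (x + y)‖ ^ q) := by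
  obtain ⟨K, hK, h⟩ := exists_abs_sub_rpow_le hq hε
  refine ⟨K, hK, fun x y => ?_⟩
  simp only [Lp_norm_rpow hq]
  have ix := integrable_abs_rpow hq (Lp.memLp x)
  have iy := integrable_abs_rpow hq (Lp.memLp y)
  have im := integrable_abs_rpow hq (Lp.memLp ((1 / 2 : ℝ) • (x + y)))
  have is := integrable_abs_rpow hq (Lp.memLp (x - y))
  rw [← integral_add ix iy, ← integral_const_mul, ← integral_div, ← integral_sub _ im,
    ← integral_const_mul, ← integral_add]
  · refine integral_mono_ae is ?_ ?_
    · exact ((ix.add iy).const_mul _).add ((((ix.add iy).div_const 2).sub im).const_mul _)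
    · filter_upwards [Lp.coeFn_sub x y, Lp.coeFn_smul (1 / 2 : ℝ) (x + y), Lp.coeFn_add x y]
        with a h1 h2 h3
      rw [h1, h2, Pi.smul_apply, h3]
      have e := h (x a) (y a)
      rw [show (x a + y a) / 2 = 1 / 2 * (x a + y a) by ring] at e
      exact e
  · exact (ix.add iy).const_mul _
  · exact (((ix.add iy).div_const 2).sub im).const_mul _
  · exact (ix.add iy).div_const 2

theorem Lp_eq_of_norm_le_midpoint {q : ℝ} (hq : 1 < q) {x y : Lp ℝ (ENNReal.ofReal q) μ} {m : ℝ}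
    (hm : 0 ≤ m) (hx : ‖x‖ ≤ m) (hy : ‖y‖ ≤ m) (h : m ≤ ‖(1 / 2 : ℝ) • (x + y)‖) : x = y := by
  have hq0 : 0 < q := by linarith
  have := fact_one_le_ofReal hq
  have hx' := Real.rpow_le_rpow (norm_nonneg x) hx hq0.le
  have hy' := Real.rpow_le_rpow (norm_nonneg y) hy hq0.le
  have h' := Real.rpow_le_rpow hm h hq0.le
  have key : ∀ ε > 0, ‖x - y‖ ^ q ≤ ε * (2 * m ^ q) := by
    intro ε hε
    obtain ⟨K, hK, hle⟩ := exists_Lp_norm_sub_rpow_le (μ := μ) hq hε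
    refine (hle x y).trans ?_
    have h1 : K * ((‖x‖ ^ q + ‖y‖ ^ q) / 2 - ‖(1 / 2 : ℝ) • (x + y)‖ ^ q) ≤ 0 :=
      mul_nonpos_of_nonneg_of_nonpos hK (by linarith)
    have h2 : ε * (‖x‖ ^ q + ‖y‖ ^ q) ≤ ε * (2 * m ^ q) := by gcongr; linarith
    linarith
  have hle : ‖x - y‖ ^ q ≤ 0 := by
    refine ge_of_tendsto (f := fun ε : ℝ => ε * (2 * m ^ q)) (x := 𝓝[>] 0) ?_
      (by filter_upwards [self_mem_nhdsWithin] with ε hε using key ε hε)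
    have : Tendsto (fun ε : ℝ => ε * (2 * m ^ q)) (𝓝 0) (𝓝 (0 * (2 * m ^ q))) :=
      tendsto_id.mul_const _
    rw [zero_mul] at this
    exact this.mono_left inf_le_left
  have h0 : ‖x - y‖ = 0 := by
    by_contra hne
    have : 0 < ‖x - y‖ := lt_of_le_of_ne (norm_nonneg _) (Ne.symm hne)
    linarith [Real.rpow_pos_of_pos this q]
  exact sub_eq_zero.1 (norm_eq_zero.1 h0)

/-- Norms converging to `m`, with midpoints of norm asymptotically at least `m`, make the convexity
defect vanish. The lower bound `b` may depend on the smaller index, which suits minimizers over a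
decreasing sequence of sets. -/
theorem cauchySeq_Lp_of_midpoint {q : ℝ} (hq : 1 < q) [Fact (1 ≤ ENNReal.ofReal q)]
    {x : ℕ → Lp ℝ (ENNReal.ofReal q) μ}
    {b : ℕ → ℝ} {m : ℝ} (hb0 : ∀ n, 0 ≤ b n) (hb : Tendsto b atTop (𝓝 m))
    (hx : Tendsto (fun n => ‖x n‖) atTop (𝓝 m))
    (h : ∀ j k, j ≤ k → b j ≤ ‖(1 / 2 : ℝ) • (x j + x k)‖) : CauchySeq x := by
  have hq0 : 0 < q := by linarith
  have hm : 0 ≤ m := ge_of_tendsto' hb hb0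
  have hbq : Tendsto (fun n => b n ^ q) atTop (𝓝 (m ^ q)) := hb.rpow_const (Or.inr hq0.le)
  have hxq : Tendsto (fun n => ‖x n‖ ^ q) atTop (𝓝 (m ^ q)) := hx.rpow_const (Or.inr hq0.le)
  rw [Metric.cauchySeq_iff']
  intro η hη
  have hηq : 0 < η ^ q := Real.rpow_pos_of_pos hη q
  have hmq : 0 ≤ m ^ q := Real.rpow_nonneg hm q
  obtain ⟨K, hK, hle⟩ := exists_Lp_norm_sub_rpow_le (μ := μ) hq
    (ε := η ^ q / (4 * (m ^ q + 1))) (by positivity)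
  -- Sized so that the `ε`-term is at most `η ^ q / 2` and the defect term at most `η ^ q / 4`.
  set τ := min 1 (η ^ q / (4 * (K + 1))) with hτ
  have hτ0 : 0 < τ := lt_min one_pos (by positivity)
  obtain ⟨N, hN⟩ := eventually_atTop.1 ((hxq.eventually (gt_mem_nhds (show m ^ q < m ^ q + τ / 2 by
    linarith))).and (hbq.eventually (lt_mem_nhds (show m ^ q - τ / 2 < m ^ q by linarith))))
  refine ⟨N, fun n hn => ?_⟩
  rw [dist_comm, dist_eq_norm]
  have h1 := (hN N le_rfl).1
  have h2 := (hN n hn).1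
  have h3 := (hN N le_rfl).2
  have h4 := Real.rpow_le_rpow (hb0 N) (h N n hn) hq0.le
  have h5 := hle (x N) (x n)
  have hτ1 : τ ≤ 1 := min_le_left _ _
  have h6 : η ^ q / (4 * (m ^ q + 1)) * (‖x N‖ ^ q + ‖x n‖ ^ q) ≤ η ^ q / 2 := by
    calc _ ≤ η ^ q / (4 * (m ^ q + 1)) * (2 * (m ^ q + 1)) := by gcongr; linarith
      _ = _ := by field_simp; norm_num
  have h7 : K * ((‖x N‖ ^ q + ‖x n‖ ^ q) / 2 - ‖(1 / 2 : ℝ) • (x N + x n)‖ ^ q) ≤ η ^ q / 4 := by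
    calc _ ≤ K * (η ^ q / (4 * (K + 1))) := by
          gcongr
          exact le_trans (b := τ) (by linarith) (min_le_right _ _)
      _ ≤ (K + 1) * (η ^ q / (4 * (K + 1))) := by gcongr; linarith
      _ = _ := by field_simp
  have h8 : ‖x N - x n‖ ^ q < η ^ q := by linarith
  exact (Real.rpow_lt_rpow_iff (norm_nonneg _) hη.le hq0).1 h8

end UniformConvexity

/-! ### Elements of minimal norm in convex subsets of L^q. -/

section MinimalNorm

variable {X : Type*} [MeasurableSpace X] {μ : Measure X}

/-- The tangent line inequality for `r ↦ r ^ q`. -/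
theorem rpow_sub_rpow_le {q : ℝ} (hq : 1 < q) {a b : ℝ} (ha : 0 ≤ a) (hb : 0 ≤ b) :
    b ^ q - a ^ q ≤ q * b ^ (q - 1) * (b - a) := by
  have hd := Real.hasDerivAt_rpow_const (x := b) (p := q) (Or.inr hq.le)
  rcases lt_trichotomy a b with h | h | h
  · have := (convexOn_rpow hq.le).slope_le_of_hasDerivAt (mem_Ici.2 ha) (mem_Ici.2 hb) h hd
    rw [slope_def_field, div_le_iff₀ (by linarith)] at this
    exact this
  · simp [h]
  · have := (convexOn_rpow hq.le).le_slope_of_hasDerivAt (mem_Ici.2 hb) (mem_Ici.2 ha) h hd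
    rw [slope_def_field, le_div_iff₀ (by linarith)] at this
    linarith

theorem rpow_sub_one_mul_le {q : ℝ} (hq : 1 < q) {a b : ℝ} (ha : 0 ≤ a) (hb : 0 ≤ b) :
    q * (a ^ (q - 1) * b) ≤ (q - 1) * a ^ q + b ^ q := by
  have h := rpow_sub_rpow_le hq hb ha
  have h2 : a ^ (q - 1) * a = a ^ q := by
    rw [← Real.rpow_add_one' ha (by linarith)]; ring_nf
  nlinarith

theorem exists_minimal_norm {q : ℝ} (hq : 1 < q) [Fact (1 ≤ ENNReal.ofReal q)]
    {C : Set (Lp ℝ (ENNReal.ofReal q) μ)}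
    (hcl : IsClosed C) (hne : C.Nonempty)
    (hmid : ∀ x ∈ C, ∀ y ∈ C, (1 / 2 : ℝ) • (x + y) ∈ C) : ∃ k ∈ C, ∀ c ∈ C, ‖k‖ ≤ ‖c‖ := by
  set S : Set ℝ := norm '' C
  have hS : BddBelow S := ⟨0, by rintro _ ⟨x, -, rfl⟩; exact norm_nonneg x⟩
  have hSne : S.Nonempty := hne.image _
  have hlow : ∀ c ∈ C, sInf S ≤ ‖c‖ := fun c hc => csInf_le hS ⟨c, hc, rfl⟩
  have hex : ∀ n : ℕ, ∃ c ∈ C, ‖c‖ < sInf S + 1 / ((n : ℝ) + 1) := fun n => by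
    obtain ⟨_, ⟨c, hc, rfl⟩, h⟩ := exists_lt_of_csInf_lt hSne
      (show sInf S < sInf S + 1 / ((n : ℝ) + 1) by
        have : (0 : ℝ) < 1 / ((n : ℝ) + 1) := by positivity
        linarith)
    exact ⟨c, hc, h⟩
  choose x hxC hx using hex
  have hlim : Tendsto (fun n => ‖x n‖) atTop (𝓝 (sInf S)) := by
    have h1 : Tendsto (fun n : ℕ => sInf S + 1 / ((n : ℝ) + 1)) atTop (𝓝 (sInf S)) := by
      simpa using tendsto_one_div_add_atTop_nhds_zero_nat.const_add (sInf S)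
    exact tendsto_of_tendsto_of_tendsto_of_le_of_le tendsto_const_nhds h1
      (fun n => hlow _ (hxC n)) fun n => (hx n).le
  have hc : CauchySeq x := cauchySeq_Lp_of_midpoint hq (b := fun _ => sInf S)
    (fun _ => le_csInf hSne (by rintro _ ⟨x, -, rfl⟩; exact norm_nonneg x)) tendsto_const_nhds hlim
    fun j k _ => hlow _ (hmid _ (hxC j) _ (hxC k))
  obtain ⟨k, hk⟩ := cauchySeq_tendsto_of_complete hc
  exact ⟨k, hcl.mem_of_tendsto hk (Eventually.of_forall hxC), fun c hc =>
    (tendsto_nhds_unique hk.norm hlim).trans_le (hlow c hc)⟩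

theorem integrable_rpow_sub_one_mul {q : ℝ} (hq : 1 < q) {u w : X → ℝ}
    (hu : MemLp u (ENNReal.ofReal q) μ) (hw : MemLp w (ENNReal.ofReal q) μ)
    (hu0 : ∀ᵐ x ∂μ, 0 ≤ u x) :
    Integrable (fun x => u x ^ (q - 1) * w x) μ := by
  refine Integrable.mono' (((integrable_abs_rpow hq hu).const_mul (q - 1)).add
    (integrable_abs_rpow hq hw)) ?_ ?_
  · exact ((hu.1.aemeasurable.pow_const _).mul hw.1.aemeasurable).aestronglyMeasurable
  · filter_upwards [hu0] with x hx
    have h := rpow_sub_one_mul_le hq hx (abs_nonneg (w x))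
    rw [Real.norm_eq_abs, abs_mul, abs_of_nonneg (Real.rpow_nonneg hx _)]
    have h0 : 0 ≤ u x ^ (q - 1) * |w x| := by positivity
    simp only [Pi.add_apply, abs_of_nonneg hx]
    nlinarith

/-- The Euler–Lagrange inequality for the element of minimal `L^q`-norm of a convex set. -/
theorem integral_rpow_le_of_minimal {q : ℝ} (hq : 1 < q) {C : Set (Lp ℝ (ENNReal.ofReal q) μ)}
    [Fact (1 ≤ ENNReal.ofReal q)]
    (hC : Convex ℝ C) {k w : Lp ℝ (ENNReal.ofReal q) μ} (hkC : k ∈ C) (hwC : w ∈ C)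
    (hmin : ∀ c ∈ C, ‖k‖ ≤ ‖c‖) (hk0 : ∀ᵐ x ∂μ, 0 ≤ k x) (hw0 : ∀ᵐ x ∂μ, 0 ≤ w x) :
    ∫ x, k x ^ q ∂μ ≤ ∫ x, k x ^ (q - 1) * w x ∂μ := by
  have hq0 : 0 < q := by linarith
  have ikw := integrable_abs_rpow hq ((Lp.memLp k).add (Lp.memLp w))
  -- The tangent inequality is taken at the perturbed point `y`, so minimality signs the derivative
  -- there; letting `t → 0` moves it back to `k`.
  have key : ∀ t ∈ Ioo (0 : ℝ) 1,
      0 ≤ ∫ x, (k x + t * (w x - k x)) ^ (q - 1) * (w x - k x) ∂μ := by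
    intro t ht
    set y : Lp ℝ (ENNReal.ofReal q) μ := (1 - t) • k + t • w
    have hyC : y ∈ C := hC hkC hwC (by linarith [ht.2]) ht.1.le (by ring)
    have hy : ∀ᵐ x ∂μ, y x = k x + t * (w x - k x) := by
      filter_upwards [Lp.coeFn_add ((1 - t) • k) (t • w), Lp.coeFn_smul (1 - t) k,
        Lp.coeFn_smul t w] with x h1 h2 h3
      rw [h1, Pi.add_apply, h2, h3]
      simp only [Pi.smul_apply, smul_eq_mul]; ring
    have hle := Real.rpow_le_rpow (norm_nonneg _) (hmin y hyC) hq0.le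
    rw [Lp_norm_rpow hq, Lp_norm_rpow hq, ← sub_nonneg, ← integral_sub
      (integrable_abs_rpow hq (Lp.memLp y)) (integrable_abs_rpow hq (Lp.memLp k))] at hle
    have hy0 : ∀ᵐ x ∂μ, 0 ≤ y x := by
      filter_upwards [hy, hk0, hw0] with x h1 h2 h3
      rw [h1]; nlinarith [mul_nonneg (sub_nonneg.2 ht.2.le) h2, mul_nonneg ht.1.le h3]
    have hint := (integrable_rpow_sub_one_mul hq (Lp.memLp y)
      ((Lp.memLp w).sub (Lp.memLp k)) hy0)
    have hint' : Integrable (fun x => q * t * (y x ^ (q - 1) * (w x - k x))) μ :=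
      hint.const_mul _
    have h2 : ∫ x, (|y x| ^ q - |k x| ^ q) ∂μ ≤ ∫ x, q * t * (y x ^ (q - 1) * (w x - k x)) ∂μ := by
      refine integral_mono_ae ((integrable_abs_rpow hq (Lp.memLp y)).sub
        (integrable_abs_rpow hq (Lp.memLp k))) hint' ?_
      filter_upwards [hk0, hy0, hy] with x h1 h2 h3
      simp only [abs_of_nonneg h1, abs_of_nonneg h2]
      refine (rpow_sub_rpow_le hq h1 h2).trans (le_of_eq ?_)
      rw [show y x - k x = t * (w x - k x) by rw [h3]; ring]
      ring
    rw [integral_const_mul] at h2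
    have h3 : ∫ x, y x ^ (q - 1) * (w x - k x) ∂μ =
        ∫ x, (k x + t * (w x - k x)) ^ (q - 1) * (w x - k x) ∂μ :=
      integral_congr_ae (by filter_upwards [hy] with x hx; rw [hx])
    rw [← h3]
    have : 0 < q * t := mul_pos hq0 ht.1
    exact nonneg_of_mul_nonneg_right (hle.trans h2) this
  have hlim : Tendsto (fun t => ∫ x, (k x + t * (w x - k x)) ^ (q - 1) * (w x - k x) ∂μ)
      (𝓝[>] 0) (𝓝 (∫ x, k x ^ (q - 1) * (w x - k x) ∂μ)) := by
    refine tendsto_integral_filter_of_dominated_convergence (fun x => |k x + w x| ^ q) ?_ ?_ ikw ?_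
    · refine Eventually.of_forall fun t => AEMeasurable.aestronglyMeasurable ?_
      have h1 := (Lp.memLp k).1.aemeasurable
      have h2 := (Lp.memLp w).1.aemeasurable
      exact ((h1.add ((h2.sub h1).const_mul t)).pow_const _).mul (h2.sub h1)
    · filter_upwards [Ioo_mem_nhdsGT (show (0 : ℝ) < 1 by norm_num)] with t ht
      filter_upwards [hk0, hw0] with x h1 h2
      have h3 : 0 ≤ k x + t * (w x - k x) := by
        nlinarith [mul_nonneg (sub_nonneg.2 ht.2.le) h1, mul_nonneg ht.1.le h2]
      have h4 : k x + t * (w x - k x) ≤ k x + w x := by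
        nlinarith [mul_nonneg (sub_nonneg.2 ht.2.le) h2, mul_nonneg ht.1.le h1]
      rw [norm_mul, Real.norm_eq_abs, Real.norm_eq_abs, abs_of_nonneg (Real.rpow_nonneg h3 _),
        abs_of_nonneg (add_nonneg h1 h2)]
      calc _ ≤ (k x + w x) ^ (q - 1) * (k x + w x) := by
            gcongr
            rw [abs_le]; constructor <;> linarith
        _ = _ := by rw [← Real.rpow_add_one' (add_nonneg h1 h2) (by linarith)]; ring_nf
    · refine Eventually.of_forall fun x => ?_
      have : Continuous fun t : ℝ => (k x + t * (w x - k x)) ^ (q - 1) * (w x - k x) :=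
        (Continuous.rpow_const (by fun_prop) fun _ => Or.inr (by linarith)).mul continuous_const
      have h := this.tendsto 0
      simp only [zero_mul, add_zero] at h
      exact h.mono_left nhdsWithin_le_nhds
  have h0 := ge_of_tendsto hlim (by
    filter_upwards [Ioo_mem_nhdsGT (show (0 : ℝ) < 1 by norm_num)] with t ht using key t ht)
  have hi1 := integrable_rpow_sub_one_mul hq (Lp.memLp k) (Lp.memLp w) hk0
  have hi2 := integrable_rpow_sub_one_mul hq (Lp.memLp k) (Lp.memLp k) hk0
  simp_rw [mul_sub] at h0
  rw [integral_sub hi1 hi2, sub_nonneg] at h0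
  refine le_trans (le_of_eq (integral_congr_ae ?_)) h0
  filter_upwards [hk0] with x hx
  rw [← Real.rpow_add_one' hx (by linarith)]; ring_nf

/-- Young's inequality `q k^(q-1) g ≤ (q-1) k^q + |g|^q`. The hypothesis is linear in `g`, hence
stable under weak limits, unlike a comparison of norms. -/
theorem norm_le_of_integral_rpow_le {q : ℝ} (hq : 1 < q) {k g : Lp ℝ (ENNReal.ofReal q) μ}
    (hk0 : ∀ᵐ x ∂μ, 0 ≤ k x) (h : ∫ x, k x ^ q ∂μ ≤ ∫ x, k x ^ (q - 1) * g x ∂μ) :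
    ‖k‖ ≤ ‖g‖ := by
  have hq0 : 0 < q := by linarith
  have := fact_one_le_ofReal hq
  have ik := integrable_abs_rpow hq (Lp.memLp k)
  have ig := integrable_abs_rpow hq (Lp.memLp g)
  have hkk : ∫ x, k x ^ q ∂μ = ∫ x, |k x| ^ q ∂μ :=
    integral_congr_ae (by filter_upwards [hk0] with x hx; rw [abs_of_nonneg hx])
  have h1 : q * ∫ x, k x ^ (q - 1) * g x ∂μ ≤
      (q - 1) * ∫ x, |k x| ^ q ∂μ + ∫ x, |g x| ^ q ∂μ := by
    rw [← integral_const_mul, ← integral_const_mul, ← integral_add (ik.const_mul _) ig]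
    refine integral_mono_ae ((integrable_rpow_sub_one_mul hq (Lp.memLp k) (Lp.memLp g)
      hk0).const_mul _) ((ik.const_mul _).add ig) ?_
    filter_upwards [hk0] with x hx
    have := rpow_sub_one_mul_le hq hx (abs_nonneg (g x))
    simp only [abs_of_nonneg hx]
    refine le_trans ?_ this
    gcongr
    exact le_abs_self _
  rw [hkk] at h
  rw [← Real.rpow_le_rpow_iff (norm_nonneg _) (norm_nonneg _) hq0, Lp_norm_rpow hq,
    Lp_norm_rpow hq]
  nlinarith

/-- The Euler–Lagrange inequality holds with equality for `g = k`, and being linear in `g` it passes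
to the midpoint. The midpoint bound is what uniform convexity consumes. -/
theorem norm_le_midpoint_of_integral_rpow_le {q : ℝ} (hq : 1 < q)
    {k g : Lp ℝ (ENNReal.ofReal q) μ}
    (hk0 : ∀ᵐ x ∂μ, 0 ≤ k x) (h : ∫ x, k x ^ q ∂μ ≤ ∫ x, k x ^ (q - 1) * g x ∂μ) :
    ‖k‖ ≤ ‖(1 / 2 : ℝ) • (k + g)‖ := by
  refine norm_le_of_integral_rpow_le hq hk0 ?_
  have i1 := integrable_rpow_sub_one_mul hq (Lp.memLp k) (Lp.memLp k) hk0
  have i2 := integrable_rpow_sub_one_mul hq (Lp.memLp k) (Lp.memLp g) hk0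
  have h1 : ∫ x, k x ^ (q - 1) * ((1 / 2 : ℝ) • (k + g) : Lp ℝ (ENNReal.ofReal q) μ) x ∂μ =
      (1 / 2) * (∫ x, k x ^ (q - 1) * k x ∂μ + ∫ x, k x ^ (q - 1) * g x ∂μ) := by
    rw [← integral_add i1 i2, ← integral_const_mul]
    refine integral_congr_ae ?_
    filter_upwards [Lp.coeFn_smul (1 / 2 : ℝ) (k + g), Lp.coeFn_add k g] with x h1 h2
    rw [h1, Pi.smul_apply, h2, smul_eq_mul, Pi.add_apply]; ring
  have h2 : ∫ x, k x ^ (q - 1) * k x ∂μ = ∫ x, k x ^ q ∂μ := by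
    refine integral_congr_ae ?_
    filter_upwards [hk0] with x hx
    rw [← Real.rpow_add_one' hx (by linarith)]; ring_nf
  rw [h1, h2]; linarith

end MinimalNorm

/-! ### The minimal relaxed slope as a strong limit. -/

section MinimalSlope

variable {X : Type*} [MetricSpace X] [MeasurableSpace X] [BorelSpace X] {μ : Measure X}

theorem memLp_realLip [IsFiniteMeasure μ] {u : X → ℝ} {K : ℝ≥0} (hu : LipschitzWith K u)
    (s : ℝ≥0∞) : MemLp (realLip u) s μ :=
  MemLp.of_bound (measurable_realLip hu.continuous).aestronglyMeasurable K
    (ae_of_all _ fun x => by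
      rw [Real.norm_of_nonneg (realLip_nonneg u x)]; exact realLip_le_of_lipschitz hu x)

theorem aestronglyMeasurable_sub_Lp {u : X → ℝ} {K : ℝ≥0} (hu : LipschitzWith K u)
    (f : Lp ℝ 2 μ) : AEStronglyMeasurable (fun x => u x - f x) μ :=
  hu.continuous.measurable.aestronglyMeasurable.sub (Lp.memLp f).1

/-- The `L^q` functions dominating `|Dv|` for some Lipschitz `v` which is `δ`-close to `f`. -/
def slopeSet (q : ℝ) (f : Lp ℝ 2 μ) (δ : ℝ) : Set (Lp ℝ (ENNReal.ofReal q) μ) :=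
  {h | ∃ v : X → ℝ, (∃ K : ℝ≥0, LipschitzWith K v) ∧
    eLpNorm (fun x => v x - f x) 2 μ ≤ ENNReal.ofReal δ ∧ ∀ᵐ x ∂μ, realLip v x ≤ h x}

/-- `f` is approximated by Lipschitz functions whose slopes have `L^q`-norms at most `r`. -/
def HasApproxSlope (q : ℝ) (f : Lp ℝ 2 μ) (r : ℝ) : Prop :=
  ∀ δ > 0, ∃ v : X → ℝ, (∃ K : ℝ≥0, LipschitzWith K v) ∧
    eLpNorm (fun x => v x - f x) 2 μ ≤ ENNReal.ofReal δ ∧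
    eLpNorm (realLip v) (ENNReal.ofReal q) μ ≤ ENNReal.ofReal (r + δ)

theorem slopeSet_mono (q : ℝ) (f : Lp ℝ 2 μ) {δ δ' : ℝ} (h : δ ≤ δ') :
    slopeSet q f δ ⊆ slopeSet q f δ' := fun _ ⟨v, hv, h1, h2⟩ =>
  ⟨v, hv, h1.trans (ENNReal.ofReal_le_ofReal h), h2⟩

theorem lipschitzWith_linear_comb {u v : X → ℝ} {K L : ℝ≥0} (hu : LipschitzWith K u)
    (hv : LipschitzWith L v) (a b : ℝ) :
    LipschitzWith (‖a‖₊ * K + ‖b‖₊ * L) fun x => a * u x + b * v x := by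
  have h : ∀ c : ℝ, LipschitzWith ‖c‖₊ fun r : ℝ => c * r := fun c =>
    LipschitzWith.of_dist_le_mul fun x y => by
      rw [Real.dist_eq, Real.dist_eq, ← mul_sub, abs_mul]; rfl
  exact ((h a).comp hu).add ((h b).comp hv)

theorem convex_slopeSet [IsFiniteMeasure μ] (q : ℝ) [Fact (1 ≤ ENNReal.ofReal q)]
    (f : Lp ℝ 2 μ) (δ : ℝ) : Convex ℝ (slopeSet q f δ) := by
  rintro h₁ ⟨u, ⟨K, hu⟩, hu1, hu2⟩ h₂ ⟨v, ⟨L, hv⟩, hv1, hv2⟩ a b ha hb hab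
  refine ⟨fun x => a * u x + b * v x, ⟨_, lipschitzWith_linear_comb hu hv a b⟩, ?_, ?_⟩
  · have h0 : (fun x => a * u x + b * v x - f x) =
        a • (fun x => u x - f x) + b • (fun x => v x - f x) := by
      ext x
      simp only [Pi.add_apply, Pi.smul_apply, smul_eq_mul]
      linear_combination (f x) * hab
    rw [h0]
    refine (eLpNorm_add_le ((aestronglyMeasurable_sub_Lp hu f).const_smul a)
      ((aestronglyMeasurable_sub_Lp hv f).const_smul b) (by norm_num)).trans ?_
    rw [eLpNorm_const_smul, eLpNorm_const_smul]
    calc _ ≤ ‖a‖ₑ * ENNReal.ofReal δ + ‖b‖ₑ * ENNReal.ofReal δ := by gcongr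
      _ = ENNReal.ofReal δ := by
        rw [← add_mul, Real.enorm_of_nonneg ha, Real.enorm_of_nonneg hb,
          ← ENNReal.ofReal_add ha hb, hab, ENNReal.ofReal_one, one_mul]
  · filter_upwards [hu2, hv2, Lp.coeFn_add (a • h₁) (b • h₂), Lp.coeFn_smul a h₁,
      Lp.coeFn_smul b h₂] with x h1 h2 h3 h4 h5
    have h6 := realLip_add_le ((lipschitzWith_linear_comb hu hv a 0)) 
      ((lipschitzWith_linear_comb hu hv 0 b)) x
    simp only [zero_mul, add_zero, zero_add] at h6
    have h7 := realLip_const_mul_le hu a x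
    have h8 := realLip_const_mul_le hv b x
    rw [abs_of_nonneg ha] at h7
    rw [abs_of_nonneg hb] at h8
    rw [h3, Pi.add_apply, h4, h5, Pi.smul_apply, Pi.smul_apply, smul_eq_mul, smul_eq_mul]
    have := mul_le_mul_of_nonneg_left h1 ha
    have := mul_le_mul_of_nonneg_left h2 hb
    linarith

theorem nonneg_of_mem_closure_slopeSet {q : ℝ} [Fact (1 ≤ ENNReal.ofReal q)] {f : Lp ℝ 2 μ}
    {δ : ℝ} {h : Lp ℝ (ENNReal.ofReal q) μ} (hh : h ∈ closure (slopeSet q f δ)) :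
    ∀ᵐ x ∂μ, 0 ≤ h x := by
  have hsub : slopeSet q f δ ⊆ {h | 0 ≤ h} := by
    rintro h ⟨v, -, -, hv⟩
    refine (Lp.coeFn_nonneg h).1 ?_
    filter_upwards [hv] with x hx using (realLip_nonneg v x).trans hx
  exact (Lp.coeFn_nonneg h).2 (closure_minimal hsub isClosed_Ici hh)

theorem eLpNorm_Lp_eq {q : ℝ} (h : Lp ℝ (ENNReal.ofReal q) μ) :
    eLpNorm h (ENNReal.ofReal q) μ = ENNReal.ofReal ‖h‖ := by
  rw [Lp.norm_def, ENNReal.ofReal_toReal (Lp.eLpNorm_ne_top h)]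

theorem exists_mem_slopeSet_of_hasApproxSlope [IsFiniteMeasure μ] {q : ℝ} {f : Lp ℝ 2 μ} {r : ℝ}
    (hr : 0 ≤ r) (h : HasApproxSlope q f r) {δ : ℝ} (hδ : 0 < δ) :
    ∃ k ∈ slopeSet q f δ, ‖k‖ ≤ r + δ := by
  obtain ⟨v, ⟨K, hv⟩, h1, h2⟩ := h δ hδ
  have hm := memLp_realLip (μ := μ) hv (ENNReal.ofReal q)
  refine ⟨hm.toLp _, ⟨v, ⟨K, hv⟩, h1, ?_⟩, ?_⟩
  · filter_upwards [hm.coeFn_toLp] with x hx using hx.ge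
  · rw [Lp.norm_toLp]
    exact ENNReal.toReal_le_of_le_ofReal (by linarith) h2

theorem hasApproxSlope_of_forall_closure {q : ℝ} [Fact (1 ≤ ENNReal.ofReal q)] {f : Lp ℝ 2 μ}
    {r : ℝ} (h : ∀ δ > 0, ∃ k ∈ closure (slopeSet q f δ), ‖k‖ ≤ r) : HasApproxSlope q f r := by
  intro δ hδ
  obtain ⟨k, hk, hkr⟩ := h δ hδ
  obtain ⟨w, ⟨v, hv, hv1, hv2⟩, hwk⟩ := Metric.mem_closure_iff.1 hk δ hδ
  refine ⟨v, hv, hv1, ?_⟩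
  calc eLpNorm (realLip v) (ENNReal.ofReal q) μ ≤ eLpNorm w (ENNReal.ofReal q) μ :=
        eLpNorm_mono_ae_real (by
          filter_upwards [hv2] with x hx
          rwa [Real.norm_of_nonneg (realLip_nonneg v x)])
    _ ≤ _ := by
      rw [eLpNorm_Lp_eq]
      refine ENNReal.ofReal_le_ofReal ?_
      have : ‖w‖ ≤ ‖k‖ + ‖k - w‖ := by
        have := norm_sub_le k (k - w); simpa using this
      rw [dist_eq_norm] at hwk
      linarith

theorem exists_minimal_of_slopeSet_nonempty [IsFiniteMeasure μ] {q : ℝ} (hq : 1 < q)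
    [Fact (1 ≤ ENNReal.ofReal q)] {f : Lp ℝ 2 μ} {δ : ℝ} (h : (slopeSet q f δ).Nonempty) :
    ∃ k ∈ closure (slopeSet q f δ), ∀ c ∈ closure (slopeSet q f δ), ‖k‖ ≤ ‖c‖ := by
  refine exists_minimal_norm hq isClosed_closure h.closure fun x hx y hy => ?_
  rw [smul_add]
  exact (convex_slopeSet q f δ).closure hx hy (by norm_num) (by norm_num) (by norm_num)

theorem memLp_rpow_sub_one {q : ℝ} (hq : 1 < q) {k : X → ℝ} (hk : MemLp k (ENNReal.ofReal q) μ)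
    (hk0 : ∀ᵐ x ∂μ, 0 ≤ k x) :
    MemLp (fun x => k x ^ (q - 1)) (ENNReal.ofReal (Real.conjExponent q)) μ := by
  have h := hk.norm_rpow_div (ENNReal.ofReal (q - 1))
  rw [ENNReal.toReal_ofReal (by linarith), ← ENNReal.ofReal_div_of_pos (by linarith)] at h
  exact h.ae_eq (by filter_upwards [hk0] with x hx; rw [Real.norm_of_nonneg hx])

/-- The minimal elements of the slope sets satisfy the Euler–Lagrange inequality with respect to
relaxed slopes. -/
theorem integral_rpow_le_of_isRelaxedSlope [IsFiniteMeasure μ] {q : ℝ} (hq : 1 < q)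
    [Fact (1 ≤ ENNReal.ofReal q)] {f : Lp ℝ 2 μ} {δ : ℝ} (hδ : 0 < δ)
    {k g : Lp ℝ (ENNReal.ofReal q) μ} (hg : IsRelaxedSlope q f g)
    (hk : k ∈ closure (slopeSet q f δ)) (hmin : ∀ c ∈ closure (slopeSet q f δ), ‖k‖ ≤ ‖c‖) :
    ∫ x, k x ^ q ∂μ ≤ ∫ x, k x ^ (q - 1) * g x ∂μ := by
  obtain ⟨u, g', hu, hu1, hu2, hu3, hle⟩ := hg
  have hk0 := nonneg_of_mem_closure_slopeSet hk
  -- `k ^ (q - 1)` lies in the dual space, so it is an admissible test function: the Euler–Lagrange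
  -- inequality for the slopes of `u n` passes to their weak limit.
  have hlim := hu3 _ (memLp_rpow_sub_one hq (Lp.memLp k) hk0)
  have hev : ∀ᶠ n in atTop, ∫ x, k x ^ q ∂μ ≤
      ∫ x, (localLip (u n) x).toReal * k x ^ (q - 1) ∂μ := by
    have hδ' : (0 : ℝ≥0∞) < ENNReal.ofReal δ := ENNReal.ofReal_pos.2 hδ
    filter_upwards [hu1.eventually (gt_mem_nhds hδ')] with n hn
    obtain ⟨K, hK⟩ := hu n
    have hm := memLp_realLip (μ := μ) hK (ENNReal.ofReal q)
    have hmem : hm.toLp _ ∈ slopeSet q f δ := by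
      refine ⟨u n, hu n, hn.le, ?_⟩
      filter_upwards [hm.coeFn_toLp] with x hx using hx.ge
    have h := integral_rpow_le_of_minimal hq (convex_slopeSet q f δ).closure hk
      (subset_closure hmem) hmin hk0 (nonneg_of_mem_closure_slopeSet (subset_closure hmem))
    refine h.trans (le_of_eq (integral_congr_ae ?_))
    filter_upwards [hm.coeFn_toLp] with x hx
    rw [hx, mul_comm]; rfl
  refine (ge_of_tendsto hlim hev).trans ?_
  refine integral_mono_ae ?_ (integrable_rpow_sub_one_mul hq (Lp.memLp k) (Lp.memLp g) hk0) ?_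
  · refine (integrable_rpow_sub_one_mul hq (Lp.memLp k) (Lp.memLp g') hk0).congr (ae_of_all _ ?_)
    intro x; simp only [mul_comm]
  · filter_upwards [hle, hk0] with x h1 h2
    rw [mul_comm]
    gcongr

/-- Passes from weak to strong approximation without Mazur's lemma: the minimal element of each
closed slope set has norm at most `‖g‖` by the Euler–Lagrange inequality. -/
theorem hasApproxSlope_of_isRelaxedSlope [IsFiniteMeasure μ] {q : ℝ} (hq : 1 < q)
    {f : Lp ℝ 2 μ} {g : Lp ℝ (ENNReal.ofReal q) μ} (hg : IsRelaxedSlope q f g) :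
    HasApproxSlope q f ‖g‖ := by
  have := fact_one_le_ofReal hq
  refine hasApproxSlope_of_forall_closure fun δ hδ => ?_
  have hne : (slopeSet q f δ).Nonempty := by
    obtain ⟨u, -, hu, hu1, -⟩ := hg
    obtain ⟨n, hn⟩ := (hu1.eventually (gt_mem_nhds (ENNReal.ofReal_pos.2 hδ))).exists
    obtain ⟨K, hK⟩ := hu n
    have hm := memLp_realLip (μ := μ) hK (ENNReal.ofReal q)
    exact ⟨hm.toLp _, u n, hu n, hn.le, by filter_upwards [hm.coeFn_toLp] with x hx using hx.ge⟩
  obtain ⟨k, hk, hmin⟩ := exists_minimal_of_slopeSet_nonempty hq hne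
  exact ⟨k, hk, norm_le_of_integral_rpow_le hq (nonneg_of_mem_closure_slopeSet hk)
    (integral_rpow_le_of_isRelaxedSlope hq hδ hg hk hmin)⟩

theorem isRelaxedSlope_of_tendsto [IsFiniteMeasure μ] {q : ℝ} (hq : 1 < q) {f : Lp ℝ 2 μ}
    {g : Lp ℝ (ENNReal.ofReal q) μ} {u : ℕ → X → ℝ} (hu : ∀ n, ∃ K : ℝ≥0, LipschitzWith K (u n))
    (hf : Tendsto (fun n => eLpNorm (fun x => u n x - f x) 2 μ) atTop (𝓝 0))
    (hg : Tendsto (fun n => eLpNorm (fun x => realLip (u n) x - g x) (ENNReal.ofReal q) μ) atTop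
      (𝓝 0)) : IsRelaxedSlope q f g := by
  have hm : ∀ n, MemLp (realLip (u n)) (ENNReal.ofReal q) μ := fun n => by
    obtain ⟨K, hK⟩ := hu n; exact memLp_realLip hK _
  refine ⟨u, g, hu, hf, hm, fun h hh => ?_, ae_of_all _ fun x => le_rfl⟩
  have hconj := ((Real.HolderConjugate.conjExponent hq).ennrealOfReal)
  have hconj' := hconj.symm
  refine tendsto_integral_of_L1 _ ((Lp.memLp g).1.mul hh.1) (Eventually.of_forall fun n =>
    (hm n).integrable_mul hh) ?_
  have hlim := ENNReal.Tendsto.mul_const (b := eLpNorm h (ENNReal.ofReal (Real.conjExponent q)) μ)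
    hg (Or.inr hh.2.ne)
  rw [zero_mul] at hlim
  refine tendsto_of_tendsto_of_tendsto_of_le_of_le tendsto_const_nhds hlim (fun _ => bot_le)
    fun n => ?_
  have := eLpNorm_smul_le_mul_eLpNorm (μ := μ) (p := ENNReal.ofReal q)
    (q := ENNReal.ofReal (Real.conjExponent q)) (r := 1) hh.1
    (φ := fun x => realLip (u n) x - g x) ((hm n).1.sub (Lp.memLp g).1)
  rw [eLpNorm_one_eq_lintegral_enorm] at this
  refine le_trans (le_of_eq ?_) this
  refine lintegral_congr fun x => ?_
  simp only [Pi.smul_apply', smul_eq_mul, sub_mul]; rfl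

/-- `g` is the strong `L^q`-limit of the slopes of Lipschitz functions converging to `f`, and
its norm is minimal. -/
structure IsOptimalSlope (q : ℝ) (f : Lp ℝ 2 μ) (g : Lp ℝ (ENNReal.ofReal q) μ) : Prop where
  nonneg : ∀ᵐ x ∂μ, 0 ≤ g x
  isMinimal : IsMinimalRelaxedSlope q f g
  unique : ∀ g', IsMinimalRelaxedSlope q f g' → g' = g
  le_of_hasApproxSlope : ∀ r, 0 ≤ r → HasApproxSlope q f r → ‖g‖ ≤ r
  exists_seq : ∃ u : ℕ → X → ℝ, (∀ n, ∃ K : ℝ≥0, LipschitzWith K (u n)) ∧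
    Tendsto (fun n => eLpNorm (fun x => u n x - f x) 2 μ) atTop (𝓝 0) ∧
    Tendsto (fun n => eLpNorm (fun x => realLip (u n) x - g x) (ENNReal.ofReal q) μ) atTop (𝓝 0)

/-- Let `k n` be the minimal element of the closed slope set at scale `δ n → 0`. The sets decrease,
so the norms increase to some `m`, and uniform convexity makes `k` Cauchy. The limit is a candidate
below every relaxed slope in norm; it remains to see that it is also a limit of actual slopes. -/
theorem exists_isOptimalSlope [IsFiniteMeasure μ] {q : ℝ} (hq : 1 < q) {f : Lp ℝ 2 μ} {r : ℝ}
    (hr : 0 ≤ r) (h : HasApproxSlope q f r) :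
    ∃ g : Lp ℝ (ENNReal.ofReal q) μ, IsOptimalSlope q f g := by
  have := fact_one_le_ofReal hq
  set δ : ℕ → ℝ := fun n => 1 / ((n : ℝ) + 1) with hδ
  have hδ0 : ∀ n, 0 < δ n := fun n => by positivity
  have hδlim : Tendsto δ atTop (𝓝 0) := tendsto_one_div_add_atTop_nhds_zero_nat
  have hδanti : Antitone δ := fun j k hjk => by
    simp only [hδ]; gcongr
  set C : ℕ → Set (Lp ℝ (ENNReal.ofReal q) μ) := fun n => closure (slopeSet q f (δ n)) with hC
  have hCanti : ∀ j k, j ≤ k → C k ⊆ C j := fun j k hjk =>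
    closure_mono (slopeSet_mono q f (hδanti hjk))
  have hmid : ∀ n, ∀ x ∈ C n, ∀ y ∈ C n, (1 / 2 : ℝ) • (x + y) ∈ C n := fun n x hx y hy => by
    rw [smul_add]
    exact (convex_slopeSet q f (δ n)).closure hx hy (by norm_num) (by norm_num) (by norm_num)
  have happrox : ∀ r', 0 ≤ r' → HasApproxSlope q f r' → ∀ n, ∃ w ∈ slopeSet q f (δ n),
      ‖w‖ ≤ r' + δ n := fun r' hr' h' n => exists_mem_slopeSet_of_hasApproxSlope hr' h' (hδ0 n)
  have hex : ∀ n, ∃ k ∈ C n, ∀ c ∈ C n, ‖k‖ ≤ ‖c‖ := fun n =>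
    exists_minimal_of_slopeSet_nonempty hq (by obtain ⟨w, hw, -⟩ := happrox r hr h n; exact ⟨w, hw⟩)
  choose k hkC hkmin using hex
  have hkle : ∀ r', 0 ≤ r' → HasApproxSlope q f r' → ∀ n, ‖k n‖ ≤ r' + δ n := fun r' hr' h' n => by
    obtain ⟨w, hw, hwr⟩ := happrox r' hr' h' n
    exact (hkmin n w (subset_closure hw)).trans hwr
  have hkmono : Monotone fun n => ‖k n‖ := fun j l hjl => hkmin j _ (hCanti j l hjl (hkC l))
  have hbdd : BddAbove (range fun n => ‖k n‖) := by
    refine ⟨r + 1, ?_⟩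
    rintro _ ⟨n, rfl⟩
    have : δ n ≤ 1 := by
      simp only [hδ]; rw [div_le_one (by positivity)]; linarith [n.cast_nonneg (α := ℝ)]
    exact (hkle r hr h n).trans (by linarith)
  set m := ⨆ n, ‖k n‖
  have hkm : Tendsto (fun n => ‖k n‖) atTop (𝓝 m) := tendsto_atTop_ciSup hkmono hbdd
  -- For `j ≤ l` the midpoint lies in the larger set `C j`, so its norm is at least `‖k j‖`.
  have hkc : CauchySeq k := cauchySeq_Lp_of_midpoint hq (fun n => norm_nonneg (k n)) hkm hkm
    fun j l hjl => hkmin j _ (hmid j _ (hkC j) _ (hCanti j l hjl (hkC l)))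
  obtain ⟨g, hg⟩ := cauchySeq_tendsto_of_complete hkc
  have hgm : ‖g‖ = m := tendsto_nhds_unique hg.norm hkm
  have hm0 : 0 ≤ m := hgm ▸ norm_nonneg g
  have hwex : ∀ n, ∃ v : X → ℝ, (∃ K : ℝ≥0, LipschitzWith K v) ∧
      eLpNorm (fun x => v x - f x) 2 μ ≤ ENNReal.ofReal (δ n) ∧
      eLpNorm (realLip v) (ENNReal.ofReal q) μ ≤ ENNReal.ofReal (m + δ n) := by
    intro n
    refine hasApproxSlope_of_forall_closure (fun η hη => ?_) (δ n) (hδ0 n)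
    obtain ⟨N, hN⟩ := (hδlim.eventually (gt_mem_nhds hη)).exists
    exact ⟨k N, closure_mono (slopeSet_mono q f hN.le) (hkC N), le_ciSup hbdd N⟩
  choose v hv hv1 hv2 using hwex
  have hmem : ∀ n, MemLp (realLip (v n)) (ENNReal.ofReal q) μ := fun n => by
    obtain ⟨K, hK⟩ := hv n; exact memLp_realLip hK _
  set d : ℕ → Lp ℝ (ENNReal.ofReal q) μ := fun n => (hmem n).toLp _ with hd
  have hdC : ∀ n, d n ∈ C n := fun n => subset_closure ⟨v n, hv n, hv1 n, by
    filter_upwards [(hmem n).coeFn_toLp] with x hx using hx.ge⟩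
  have hdm : Tendsto (fun n => ‖d n‖) atTop (𝓝 m) := by
    have h1 : Tendsto (fun n => m + δ n) atTop (𝓝 m) := by simpa using hδlim.const_add m
    refine tendsto_of_tendsto_of_tendsto_of_le_of_le hkm h1 (fun n => hkmin n _ (hdC n)) fun n => ?_
    simp only [hd, Lp.norm_toLp]
    exact ENNReal.toReal_le_of_le_ofReal (by linarith [hδ0 n]) (hv2 n)
  -- The elements `k n` only dominate slopes, or are limits of such functions. The slopes `d n` of
  -- near-optimal Lipschitz functions lie in the same sets with norms tending to `m`, so they too
  -- converge, and by strict convexity to the same `g`.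
  have hdc : CauchySeq d := cauchySeq_Lp_of_midpoint hq (fun n => norm_nonneg (k n)) hkm hdm
    fun j l hjl => hkmin j _ (hmid j _ (hdC j) _ (hCanti j l hjl (hdC l)))
  obtain ⟨g₁, hg₁⟩ := cauchySeq_tendsto_of_complete hdc
  have hg₁g : g₁ = g := by
    refine Lp_eq_of_norm_le_midpoint hq hm0 (tendsto_nhds_unique hg₁.norm hdm).le hgm.le ?_
    exact le_of_tendsto_of_tendsto' hkm ((hg₁.add hg).const_smul (1 / 2 : ℝ)).norm
      fun n => hkmin n _ (hmid n _ (hdC n) _ (hkC n))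
  rw [hg₁g] at hg₁
  have hg0 : ∀ᵐ x ∂μ, 0 ≤ g x := nonneg_of_mem_closure_slopeSet (q := q) (f := f) (δ := δ 0)
    (isClosed_closure.mem_of_tendsto hg (Eventually.of_forall fun n =>
      hCanti 0 n (Nat.zero_le n) (hkC n)))
  have hf : Tendsto (fun n => eLpNorm (fun x => v n x - f x) 2 μ) atTop (𝓝 0) := by
    refine tendsto_of_tendsto_of_tendsto_of_le_of_le tendsto_const_nhds ?_ (fun _ => bot_le) hv1
    simpa using ENNReal.tendsto_ofReal hδlim
  have hgl : Tendsto (fun n => eLpNorm (fun x => realLip (v n) x - g x) (ENNReal.ofReal q) μ) atTop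
      (𝓝 0) := by
    rw [Lp.tendsto_Lp_iff_tendsto_eLpNorm'] at hg₁
    refine hg₁.congr fun n => eLpNorm_congr_ae ?_
    filter_upwards [(hmem n).coeFn_toLp] with x hx
    simp only [Pi.sub_apply, hd, hx]
  have hrel := isRelaxedSlope_of_tendsto hq hv hf hgl
  have hle : ∀ g', IsRelaxedSlope q f g' → m ≤ ‖g'‖ ∧ m ≤ ‖(1 / 2 : ℝ) • (g + g')‖ := by
    intro g' hg'
    have hEL := fun n => integral_rpow_le_of_isRelaxedSlope hq (hδ0 n) hg' (hkC n) (hkmin n)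
    have hk0 := fun n => nonneg_of_mem_closure_slopeSet (hkC n)
    exact ⟨le_of_tendsto' hkm fun n => norm_le_of_integral_rpow_le hq (hk0 n) (hEL n),
      le_of_tendsto_of_tendsto' hkm ((hg.add_const g').const_smul (1 / 2 : ℝ)).norm fun n =>
        norm_le_midpoint_of_integral_rpow_le hq (hk0 n) (hEL n)⟩
  refine ⟨g, hg0, ⟨hrel, fun g' hg' => ?_⟩, fun g' hg' => ?_, fun r' hr' h' => ?_,
    v, hv, hf, hgl⟩
  · rw [eLpNorm_Lp_eq, eLpNorm_Lp_eq, hgm]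
    exact ENNReal.ofReal_le_ofReal (hle g' hg').1
  · have h1 := hg'.2 g hrel
    rw [eLpNorm_Lp_eq, eLpNorm_Lp_eq, ENNReal.ofReal_le_ofReal_iff (norm_nonneg _), hgm] at h1
    exact (Lp_eq_of_norm_le_midpoint hq hm0 hgm.le h1 (hle g' hg'.1).2).symm
  · have h1 : Tendsto (fun n => r' + δ n) atTop (𝓝 r') := by simpa using hδlim.const_add r'
    rw [hgm]
    exact le_of_tendsto_of_tendsto' hkm h1 (hkle r' hr' h')

theorem exists_isOptimalSlope_of_cheeger_ne_top [IsFiniteMeasure μ] {q : ℝ} (hq : 1 < q)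
    {f : Lp ℝ 2 μ} (h : cheeger q f ≠ ⊤) :
    ∃ g : Lp ℝ (ENNReal.ofReal q) μ, IsOptimalSlope q f g := by
  rw [cheeger] at h
  split_ifs at h with hg
  · obtain ⟨g, hg⟩ := hg
    have := fact_one_le_ofReal hq
    exact exists_isOptimalSlope hq (norm_nonneg g) (hasApproxSlope_of_isRelaxedSlope hq hg)
  · exact absurd rfl h

theorem IsOptimalSlope.minRelaxedSlope_eq {q : ℝ} {f : Lp ℝ 2 μ}
    {g : Lp ℝ (ENNReal.ofReal q) μ} (h : IsOptimalSlope q f g) :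
    minRelaxedSlope q f = fun x => ENNReal.ofReal (g x) := by
  have hex : ∃ g : Lp ℝ (ENNReal.ofReal q) μ, IsMinimalRelaxedSlope q f g := ⟨g, h.isMinimal⟩
  -- Uniqueness identifies the slope picked by choice in the definition.
  rw [minRelaxedSlope, dif_pos hex, h.unique _ hex.choose_spec]

theorem IsOptimalSlope.cheeger_eq [IsFiniteMeasure μ] {q : ℝ} (hq : 1 < q) {f : Lp ℝ 2 μ}
    {g : Lp ℝ (ENNReal.ofReal q) μ} (h : IsOptimalSlope q f g) :
    cheeger q f = ENNReal.ofReal (1 / q * ‖g‖ ^ q) := by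
  have hq0 : 0 < q := by linarith
  rw [cheeger, if_pos ⟨g, h.isMinimal.1⟩, h.minRelaxedSlope_eq, Lp_norm_rpow hq,
    ENNReal.ofReal_mul (by positivity),
    ofReal_integral_eq_lintegral_ofReal (integrable_abs_rpow hq (Lp.memLp g))
      (ae_of_all _ fun x => by positivity)]
  congr 1
  refine lintegral_congr_ae ?_
  filter_upwards [h.nonneg] with x hx
  rw [ENNReal.ofReal_rpow_of_nonneg hx hq0.le, abs_of_nonneg hx]

theorem IsOptimalSlope.toReal_cheeger [IsFiniteMeasure μ] {q : ℝ} (hq : 1 < q) {f : Lp ℝ 2 μ}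
    {g : Lp ℝ (ENNReal.ofReal q) μ} (h : IsOptimalSlope q f g) :
    (cheeger q f).toReal = 1 / q * ∫ x, g x ^ q ∂μ := by
  rw [h.cheeger_eq hq, ENNReal.toReal_ofReal (by rw [Lp_norm_rpow hq]; positivity), Lp_norm_rpow hq]
  congr 1
  refine integral_congr_ae ?_
  filter_upwards [h.nonneg] with x hx
  rw [abs_of_nonneg hx]

theorem cheeger_le_of_hasApproxSlope [IsFiniteMeasure μ] {q : ℝ} (hq : 1 < q) {f : Lp ℝ 2 μ}
    {r : ℝ} (hr : 0 ≤ r) (h : HasApproxSlope q f r) :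
    cheeger q f ≠ ⊤ ∧ (cheeger q f).toReal ≤ 1 / q * r ^ q := by
  obtain ⟨g, hg⟩ := exists_isOptimalSlope hq hr h
  have := fact_one_le_ofReal hq
  have h1 := hg.le_of_hasApproxSlope r hr h
  rw [hg.cheeger_eq hq, ENNReal.toReal_ofReal (by positivity)]
  refine ⟨ENNReal.ofReal_ne_top, ?_⟩
  gcongr

end MinimalSlope

/-! ### Composition with Lipschitz functions in L^p spaces. -/

section Composition

variable {X : Type*} [MeasurableSpace X] {μ : Measure X}

theorem lipschitzWith_of_hasDerivAt_le {φ φ' : ℝ → ℝ} {K : ℝ} (hφ : ∀ r, HasDerivAt φ (φ' r) r)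
    (hK : ∀ r, |φ' r| ≤ K) : LipschitzWith K.toNNReal φ := by
  refine lipschitzWith_of_nnnorm_deriv_le (fun r => (hφ r).differentiableAt) fun r => ?_
  rw [(hφ r).deriv, ← NNReal.coe_le_coe, coe_nnnorm,
    Real.coe_toNNReal _ ((abs_nonneg _).trans (hK r))]
  exact hK r

theorem memLp_comp_of_lipschitz [IsFiniteMeasure μ] {φ : ℝ → ℝ} {K : ℝ≥0}
    (hφ : LipschitzWith K φ) {u : X → ℝ} {s : ℝ≥0∞} (hu : MemLp u s μ) :
    MemLp (fun x => φ (u x)) s μ := by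
  have h0 : MemLp (fun x => (K : ℝ) * ‖u x‖) s μ := hu.norm.const_mul (K : ℝ)
  have h1 : MemLp (fun x => |φ 0| + (K : ℝ) * ‖u x‖) s μ :=
    MemLp.add (f := fun _ : X => |φ 0|) (memLp_const _) h0
  refine h1.mono (hφ.continuous.comp_aestronglyMeasurable hu.1) (ae_of_all _ fun x => ?_)
  have h2 : |φ (u x) - φ 0| ≤ K * |u x - 0| := hφ.dist_le_mul (u x) 0
  rw [sub_zero] at h2
  rw [Real.norm_eq_abs, Real.norm_of_nonneg (by positivity), Real.norm_eq_abs]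
  linarith [abs_sub_abs_le_abs_sub (φ (u x)) (φ 0)]

theorem eLpNorm_eq_ofReal_rpow {q : ℝ} (hq : 1 < q) {u : X → ℝ}
    (hu : MemLp u (ENNReal.ofReal q) μ) :
    eLpNorm u (ENNReal.ofReal q) μ = ENNReal.ofReal ((∫ x, |u x| ^ q ∂μ) ^ (1 / q)) := by
  have hq0 : 0 < q := by linarith
  rw [← toReal_eLpNorm_rpow hq hu, ← Real.rpow_mul ENNReal.toReal_nonneg,
    mul_one_div_cancel hq0.ne', Real.rpow_one, ENNReal.ofReal_toReal hu.2.ne]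

end Composition

/-! ### First variations of the Cheeger energy: chain rule, linear perturbations and locality. -/

section Subdifferential

variable {X : Type*} [MetricSpace X] [MeasurableSpace X] [BorelSpace X] {μ : Measure X}

theorem hasApproxSlope_of_tendsto {q : ℝ} {F : Lp ℝ 2 μ} {r : ℝ} (hr : 0 ≤ r)
    {v : ℕ → X → ℝ} {a : ℕ → ℝ≥0∞}
    (hv : ∀ n, ∃ K : ℝ≥0, LipschitzWith K (v n))
    (hF : Tendsto (fun n => eLpNorm (fun x => v n x - F x) 2 μ) atTop (𝓝 0))
    (ha : ∀ n, eLpNorm (realLip (v n)) (ENNReal.ofReal q) μ ≤ a n)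
    (hlim : Tendsto a atTop (𝓝 (ENNReal.ofReal r))) : HasApproxSlope q F r := by
  intro δ hδ
  have h1 := hF.eventually (gt_mem_nhds (ENNReal.ofReal_pos.2 hδ))
  have h2 := hlim.eventually (gt_mem_nhds
    ((ENNReal.ofReal_lt_ofReal_iff (by linarith)).2 (show r < r + δ by linarith)))
  obtain ⟨n, hn1, hn2⟩ := (h1.and h2).exists
  exact ⟨v n, hv n, hn1.le, (ha n).trans hn2.le⟩

/-- Composition with a `C¹` function: `|∇(φ ∘ f)|_* ≤ |φ'(f)| |∇f|_*` in the sense of norms. -/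
theorem IsOptimalSlope.hasApproxSlope_comp [IsFiniteMeasure μ] {q : ℝ} (hq : 1 < q)
    {f : Lp ℝ 2 μ} {g : Lp ℝ (ENNReal.ofReal q) μ} (hg : IsOptimalSlope q f g) {φ φ' : ℝ → ℝ}
    {K : ℝ} (hφ : ∀ r, HasDerivAt φ (φ' r) r) (hc : Continuous φ') (hK : ∀ r, |φ' r| ≤ K)
    {F : Lp ℝ 2 μ} (hF : ∀ᵐ x ∂μ, F x = φ (f x)) :
    HasApproxSlope q F ((∫ x, (|φ' (f x)| * g x) ^ q ∂μ) ^ (1 / q)) := by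
  have hq0 : 0 < q := by linarith
  have h1q : (1 : ℝ≥0∞) ≤ ENNReal.ofReal q := (fact_one_le_ofReal hq).out
  have hK0 : 0 ≤ K := (abs_nonneg _).trans (hK 0)
  have hφL := lipschitzWith_of_hasDerivAt_le hφ hK
  obtain ⟨u₀, hu₀, hf₀, hg₀⟩ := hg.exists_seq
  have hmeas : ∀ n, AEStronglyMeasurable (u₀ n) μ := fun n => by
    obtain ⟨L, hL⟩ := hu₀ n; exact hL.continuous.measurable.aestronglyMeasurable
  have hmes := tendstoInMeasure_of_tendsto_eLpNorm (by norm_num : (2 : ℝ≥0∞) ≠ 0) hmeas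
    (Lp.memLp f).1 hf₀
  -- Almost everywhere convergence along a subsequence is needed for `φ' (u n) → φ' f`.
  obtain ⟨ns, hns, hae⟩ := hmes.exists_seq_tendsto_ae
  have hnst := hns.tendsto_atTop
  set u : ℕ → X → ℝ := fun n => u₀ (ns n)
  have hu : ∀ n, ∃ K : ℝ≥0, LipschitzWith K (u n) := fun n => hu₀ (ns n)
  have hmu : ∀ n, AEStronglyMeasurable (u n) μ := fun n => hmeas (ns n)
  have hfu : Tendsto (fun n => eLpNorm (fun x => u n x - f x) 2 μ) atTop (𝓝 0) := hf₀.comp hnst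
  have hgu : Tendsto (fun n => eLpNorm (fun x => realLip (u n) x - g x) (ENNReal.ofReal q) μ) atTop
    (𝓝 0) := hg₀.comp hnst
  have hgm := Lp.memLp g
  have hφg : ∀ w : X → ℝ, AEStronglyMeasurable w μ →
      MemLp (fun x => φ' (w x) * g x) (ENNReal.ofReal q) μ := fun w hw =>
    MemLp.of_le_mul (c := K) hgm ((hc.comp_aestronglyMeasurable hw).mul hgm.1) (ae_of_all _ fun x => by
      rw [norm_mul]; gcongr; exact hK _)
  have hlimI : Tendsto (fun n => ∫ x, |φ' (u n x) * g x| ^ q ∂μ) atTop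
      (𝓝 (∫ x, |φ' (f x) * g x| ^ q ∂μ)) := by
    refine tendsto_integral_of_dominated_convergence (fun x => |K * g x| ^ q) (fun n => ?_)
      (integrable_abs_rpow hq (hgm.const_mul K)) (fun n => ae_of_all _ fun x => ?_) ?_
    · exact (((hφg _ (hmu n)).1.aemeasurable.abs).pow_const q).aestronglyMeasurable
    · rw [Real.norm_of_nonneg (by positivity)]
      gcongr ?_ ^ q
      rw [abs_mul, abs_mul, abs_of_nonneg hK0]
      gcongr
      exact hK _
    · filter_upwards [hae] with x hx
      have h1 : Tendsto (fun n => φ' (u n x)) atTop (𝓝 (φ' (f x))) :=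
        (hc.tendsto _).comp hx
      exact ((h1.mul_const (g x)).abs).rpow_const (Or.inr hq0.le)
  have hlimN : Tendsto (fun n => eLpNorm (fun x => φ' (u n x) * g x) (ENNReal.ofReal q) μ) atTop
      (𝓝 (ENNReal.ofReal ((∫ x, |φ' (f x) * g x| ^ q ∂μ) ^ (1 / q)))) := by
    simp_rw [fun n => eLpNorm_eq_ofReal_rpow hq (hφg _ (hmu n))]
    exact ENNReal.tendsto_ofReal (hlimI.rpow_const (Or.inr (by positivity)))
  -- The slope of `φ (u n)` is at most `|φ' (u n)| g + K |realLip (u n) - g|`. The error vanishes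
  -- because the slopes converge strongly; weak convergence would not suffice.
  have hlim := (ENNReal.Tendsto.const_mul (a := ENNReal.ofReal K) hgu
    (Or.inr ENNReal.ofReal_ne_top)).add hlimN
  rw [mul_zero, zero_add] at hlim
  have hrw : ∫ x, (|φ' (f x)| * g x) ^ q ∂μ = ∫ x, |φ' (f x) * g x| ^ q ∂μ := by
    refine integral_congr_ae ?_
    filter_upwards [hg.nonneg] with x hx
    rw [abs_mul, abs_of_nonneg hx]
  rw [hrw]
  refine hasApproxSlope_of_tendsto (v := fun n x => φ (u n x)) (by positivity)
    (fun n => ?_) ?_ (fun n => ?_) hlim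
  · obtain ⟨L, hL⟩ := hu n; exact ⟨_, hφL.comp hL⟩
  · have h0 := ENNReal.Tendsto.const_mul (a := ENNReal.ofReal K) hfu
      (Or.inr ENNReal.ofReal_ne_top)
    rw [mul_zero] at h0
    refine tendsto_of_tendsto_of_tendsto_of_le_of_le tendsto_const_nhds h0 (fun _ => bot_le)
      fun n => ?_
    refine eLpNorm_le_mul_eLpNorm_of_ae_le_mul ?_ 2
    filter_upwards [hF] with x hx
    rw [hx]
    have := hφL.dist_le_mul (u n x) (f x)
    rwa [Real.coe_toNNReal _ hK0] at this
  · obtain ⟨L, hL⟩ := hu n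
    have hd := memLp_realLip (μ := μ) hL (ENNReal.ofReal q)
    have hA : MemLp (fun x => K * |realLip (u n) x - g x|) (ENNReal.ofReal q) μ :=
      (hd.sub hgm).norm.const_mul K
    have hB := hφg _ (hmu n)
    calc eLpNorm (realLip fun x => φ (u n x)) (ENNReal.ofReal q) μ
        ≤ eLpNorm ((fun x => K * |realLip (u n) x - g x|) + fun x => |φ' (u n x) * g x|)
            (ENNReal.ofReal q) μ := by
          refine eLpNorm_mono_ae_real ?_
          filter_upwards [hg.nonneg] with x hx
          rw [Real.norm_of_nonneg (realLip_nonneg _ _)]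
          refine (realLip_comp_le hL (hφ (u n x))).trans ?_
          rw [Pi.add_apply, abs_mul, abs_of_nonneg hx]
          have h1 : realLip (u n) x ≤ |realLip (u n) x - g x| + g x := by
            linarith [le_abs_self (realLip (u n) x - g x)]
          calc _ ≤ |φ' (u n x)| * (|realLip (u n) x - g x| + g x) := by gcongr
            _ = |φ' (u n x)| * |realLip (u n) x - g x| + |φ' (u n x)| * g x := by ring
            _ ≤ _ := by gcongr; exact hK _
      _ ≤ eLpNorm (fun x => K * |realLip (u n) x - g x|) (ENNReal.ofReal q) μ +
            eLpNorm (fun x => |φ' (u n x) * g x|) (ENNReal.ofReal q) μ :=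
          eLpNorm_add_le hA.1 hB.norm.1 h1q
      _ ≤ _ := by
          gcongr
          · refine eLpNorm_le_mul_eLpNorm_of_ae_le_mul (ae_of_all _ fun x => ?_) _
            rw [norm_mul, Real.norm_of_nonneg hK0, Real.norm_eq_abs, abs_abs, Real.norm_eq_abs]
          · exact (eLpNorm_norm (fun x => φ' (u n x) * g x)).le

theorem IsOptimalSlope.hasApproxSlope_add [IsFiniteMeasure μ] {q : ℝ} (hq : 1 < q)
    {f : Lp ℝ 2 μ} {g : Lp ℝ (ENNReal.ofReal q) μ} (hg : IsOptimalSlope q f g) {W D : X → ℝ}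
    {K : ℝ≥0} (hW : LipschitzWith K W) (hD : MemLp D (ENNReal.ofReal q) μ)
    (hWD : ∀ x, realLip W x ≤ D x) (t : ℝ)
    {F : Lp ℝ 2 μ} (hF : ∀ᵐ x ∂μ, F x = f x + t * W x) :
    HasApproxSlope q F ((∫ x, (g x + |t| * D x) ^ q ∂μ) ^ (1 / q)) := by
  have h1q : (1 : ℝ≥0∞) ≤ ENNReal.ofReal q := (fact_one_le_ofReal hq).out
  obtain ⟨u, hu, hfu, hgu⟩ := hg.exists_seq
  have hD0 : ∀ x, 0 ≤ D x := fun x => (realLip_nonneg W x).trans (hWD x)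
  have hgm := Lp.memLp g
  have hgD : MemLp (fun x => g x + |t| * D x) (ENNReal.ofReal q) μ := hgm.add (hD.const_mul |t|)
  have hlim := hgu.add_const (ENNReal.ofReal ((∫ x, |g x + |t| * D x| ^ q ∂μ) ^ (1 / q)))
  rw [zero_add] at hlim
  have hrw : ∫ x, (g x + |t| * D x) ^ q ∂μ = ∫ x, |g x + |t| * D x| ^ q ∂μ := by
    refine integral_congr_ae ?_
    filter_upwards [hg.nonneg] with x hx
    rw [abs_of_nonneg (add_nonneg hx (mul_nonneg (abs_nonneg t) (hD0 x)))]
  rw [hrw]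
  refine hasApproxSlope_of_tendsto (v := fun n x => u n x + t * W x) (by positivity)
    (fun n => ?_) ?_ (fun n => ?_) hlim
  · obtain ⟨L, hL⟩ := hu n
    have := lipschitzWith_linear_comb hL hW 1 t
    simp only [one_mul] at this
    exact ⟨_, this⟩
  · refine hfu.congr fun n => eLpNorm_congr_ae ?_
    filter_upwards [hF] with x hx
    rw [hx]; ring
  · obtain ⟨L, hL⟩ := hu n
    have hd := memLp_realLip (μ := μ) hL (ENNReal.ofReal q)
    rw [← eLpNorm_eq_ofReal_rpow hq hgD]
    refine le_trans (eLpNorm_mono_ae_real (g := (fun x => |realLip (u n) x - g x|) +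
      fun x => g x + |t| * D x) (ae_of_all _ fun x => ?_))
      ((eLpNorm_add_le (hd.sub hgm).norm.1 hgD.1 h1q).trans ?_)
    · rw [Real.norm_of_nonneg (realLip_nonneg _ _), Pi.add_apply]
      have h0 := lipschitzWith_linear_comb hW hW t 0
      simp only [zero_mul, add_zero] at h0
      have h1 := realLip_add_le hL h0 x
      have h2 := realLip_const_mul_le hW t x
      have h3 : |t| * realLip W x ≤ |t| * D x := mul_le_mul_of_nonneg_left (hWD x) (abs_nonneg t)
      linarith [le_abs_self (realLip (u n) x - g x)]
    · gcongr
      exact (eLpNorm_norm (fun x => realLip (u n) x - g x)).le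

/-- The subdifferential inequality with the energy of the competitor replaced by an upper bound,
since the exact minimal slope of `F` is never needed. -/
theorem integral_mul_sub_le_of_hasApproxSlope [IsFiniteMeasure μ] {q : ℝ} (hq : 1 < q)
    {f l F : Lp ℝ 2 μ} (hl : l ∈ subdiffCheeger q f) {g : Lp ℝ (ENNReal.ofReal q) μ}
    (hg : IsOptimalSlope q f g) {R : ℝ} (hR : 0 ≤ R) (hF : HasApproxSlope q F (R ^ (1 / q))) :
    q * ∫ x, l x * (F x - f x) ∂μ ≤ R - ∫ x, g x ^ q ∂μ := by
  have hq0 : 0 < q := by linarith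
  obtain ⟨h1, h2⟩ := cheeger_le_of_hasApproxSlope hq (by positivity) hF
  have h3 := hl.2 F h1
  rw [hg.toReal_cheeger hq] at h3
  rw [← Real.rpow_mul hR, one_div_mul_cancel hq0.ne', Real.rpow_one] at h2
  have h4 : ∫ x, l x * (F x - f x) ∂μ ≤ 1 / q * (R - ∫ x, g x ^ q ∂μ) := by linarith
  calc _ ≤ q * (1 / q * (R - ∫ x, g x ^ q ∂μ)) := by gcongr
    _ = _ := by field_simp

theorem integrable_slope_rpow {q : ℝ} (hq : 1 < q) {f : Lp ℝ 2 μ}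
    {g : Lp ℝ (ENNReal.ofReal q) μ} (hg : IsOptimalSlope q f g) :
    Integrable (fun x => g x ^ q) μ :=
  (integrable_abs_rpow hq (Lp.memLp g)).congr (by
    filter_upwards [hg.nonneg] with x hx; rw [abs_of_nonneg hx])

/-- The chain rule `∫ l Θ(f) dμ = ∫ Θ'(f) |∇f|_*^q dμ` for `l ∈ ∂⁻Ch_q(f)`. -/
theorem integral_mul_comp_eq [IsFiniteMeasure μ] {q : ℝ} (hq : 1 < q)
    {f l : Lp ℝ 2 μ} (hl : l ∈ subdiffCheeger q f) {g : Lp ℝ (ENNReal.ofReal q) μ}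
    (hg : IsOptimalSlope q f g) {Θ θ : ℝ → ℝ} {K : ℝ} (hΘ : ∀ r, HasDerivAt Θ (θ r) r)
    (hc : Continuous θ) (h0 : ∀ r, 0 ≤ θ r) (hK : ∀ r, θ r ≤ K) :
    ∫ x, l x * Θ (f x) ∂μ = ∫ x, θ (f x) * g x ^ q ∂μ := by
  have hq0 : 0 < q := by linarith
  have hK0 : 0 ≤ K := (h0 0).trans (hK 0)
  have hΘL := lipschitzWith_of_hasDerivAt_le hΘ (K := K) fun r => by
    rw [abs_of_nonneg (h0 r)]; exact hK r
  have hΘm : MemLp (fun x => Θ (f x)) 2 μ := memLp_comp_of_lipschitz hΘL (Lp.memLp f)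
  have hgi := integrable_slope_rpow hq hg
  have hθm : AEMeasurable (fun x => θ (f x)) μ := (hc.measurable).comp_aemeasurable
    (Lp.memLp f).1.aemeasurable
  have hgme := (Lp.memLp g).1.aemeasurable
  -- Keeps `1 + t * θ` in `[0, 2]` for either sign of `t`, so no absolute value survives and
  -- negative `t` gives the reverse inequality.
  set τ : ℝ := 1 / (K + 1) with hτ
  have hτ0 : 0 < τ := by positivity
  have hpos : ∀ t, |t| < τ → ∀ r, 0 ≤ 1 + t * θ r ∧ 1 + t * θ r ≤ 2 := by
    intro t ht r
    have h1 : |t * θ r| ≤ 1 := by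
      rw [abs_mul, abs_of_nonneg (h0 r)]
      calc |t| * θ r ≤ τ * (K + 1) := mul_le_mul ht.le (by linarith [hK r]) (h0 r) hτ0.le
        _ = 1 := by rw [hτ]; field_simp
    rw [abs_le] at h1
    constructor <;> linarith
  set J : ℝ → ℝ := fun t => ∫ x, θ (f x) * (1 + t * θ (f x)) ^ (q - 1) * g x ^ q ∂μ with hJ
  have hJi : ∀ t, |t| < τ →
      Integrable (fun x => θ (f x) * (1 + t * θ (f x)) ^ (q - 1) * g x ^ q) μ ∧
      ∀ᵐ x ∂μ, ‖θ (f x) * (1 + t * θ (f x)) ^ (q - 1) * g x ^ q‖ ≤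
        K * 2 ^ (q - 1) * g x ^ q := by
    intro t ht
    have hb : ∀ᵐ x ∂μ, ‖θ (f x) * (1 + t * θ (f x)) ^ (q - 1) * g x ^ q‖ ≤
        K * 2 ^ (q - 1) * g x ^ q := by
      filter_upwards [hg.nonneg] with x hx
      obtain ⟨h1, h2⟩ := hpos t ht (f x)
      have h3 := h0 (f x)
      have h4 : 0 ≤ (1 + t * θ (f x)) ^ (q - 1) := Real.rpow_nonneg h1 _
      rw [Real.norm_of_nonneg (by positivity)]
      gcongr
      exact hK _
    refine ⟨Integrable.mono' (hgi.const_mul _) ?_ hb, hb⟩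
    exact ((hθm.mul (((hθm.const_mul t).const_add 1).pow_const _)).mul
      (hgme.pow_const q)).aestronglyMeasurable
  have key : ∀ t, |t| < τ → t * ∫ x, l x * Θ (f x) ∂μ ≤ t * J t := by
    intro t ht
    have hFm : MemLp (fun x => f x + t * Θ (f x)) 2 μ := (Lp.memLp f).add (hΘm.const_mul t)
    have hφ : ∀ r, HasDerivAt (fun r => r + t * Θ r) (1 + t * θ r) r := fun r =>
      (hasDerivAt_id r).add ((hΘ r).const_mul t)
    have happ := hg.hasApproxSlope_comp hq hφ (by fun_prop) (K := 2) (fun r => by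
      obtain ⟨h1, h2⟩ := hpos t ht r
      rwa [abs_of_nonneg h1]) (F := hFm.toLp _) hFm.coeFn_toLp
    have hle := integral_mul_sub_le_of_hasApproxSlope hq hl hg (integral_nonneg_of_ae (by
      filter_upwards [hg.nonneg] with x hx
      show 0 ≤ _
      positivity)) happ
    have e1 : ∫ x, l x * ((hFm.toLp _ : Lp ℝ 2 μ) x - f x) ∂μ = t * ∫ x, l x * Θ (f x) ∂μ := by
      rw [← integral_const_mul]
      refine integral_congr_ae ?_
      filter_upwards [hFm.coeFn_toLp] with x hx
      rw [hx]; ring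
    rw [e1] at hle
    have hi : Integrable (fun x => (|1 + t * θ (f x)| * g x) ^ q) μ := by
      refine Integrable.mono' (hgi.const_mul (2 ^ q)) ?_ ?_
      · exact ((((hθm.const_mul t).const_add 1).abs.mul hgme).pow_const q).aestronglyMeasurable
      · filter_upwards [hg.nonneg] with x hx
        obtain ⟨h1, h2⟩ := hpos t ht (f x)
        rw [abs_of_nonneg h1, Real.norm_of_nonneg (by positivity), Real.mul_rpow h1 hx]
        gcongr
    rw [← integral_sub hi hgi] at hle
    have h5 : ∫ x, ((|1 + t * θ (f x)| * g x) ^ q - g x ^ q) ∂μ ≤ q * (t * J t) := by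
      rw [hJ, ← integral_const_mul, ← integral_const_mul]
      refine integral_mono_ae (hi.sub hgi) (((hJi t ht).1.const_mul _).const_mul _) ?_
      filter_upwards [hg.nonneg] with x hx
      obtain ⟨h1, h2⟩ := hpos t ht (f x)
      have h3 := rpow_sub_rpow_le hq zero_le_one h1
      rw [Real.one_rpow] at h3
      rw [abs_of_nonneg h1, Real.mul_rpow h1 hx]
      have h4 := mul_le_mul_of_nonneg_right h3 (Real.rpow_nonneg hx q)
      linarith
    exact le_of_mul_le_mul_left (hle.trans h5) hq0
  have hJlim : Tendsto J (𝓝 0) (𝓝 (∫ x, θ (f x) * g x ^ q ∂μ)) := by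
    have hev : ∀ᶠ t in 𝓝 (0 : ℝ), |t| < τ := by
      have : Tendsto (fun t : ℝ => |t|) (𝓝 0) (𝓝 |0|) := continuous_abs.tendsto 0
      rw [abs_zero] at this
      exact this.eventually (gt_mem_nhds hτ0)
    refine tendsto_integral_filter_of_dominated_convergence (fun x => K * 2 ^ (q - 1) * g x ^ q)
      (hev.mono fun t ht => (hJi t ht).1.1) (hev.mono fun t ht => (hJi t ht).2)
      (hgi.const_mul _) (ae_of_all _ fun x => ?_)
    have : Continuous fun t : ℝ => θ (f x) * (1 + t * θ (f x)) ^ (q - 1) * g x ^ q :=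
      (continuous_const.mul (Continuous.rpow_const (by fun_prop)
        fun _ => Or.inr (by linarith))).mul continuous_const
    have h := this.tendsto 0
    simpa only [zero_mul, add_zero, Real.one_rpow, mul_one] using h
  -- Dividing by `t > 0` gives one inequality, by `t < 0` the other.
  refine le_antisymm ?_ ?_
  · refine ge_of_tendsto (hJlim.mono_left (nhdsWithin_le_nhds (s := Ioi 0))) ?_
    filter_upwards [Ioo_mem_nhdsGT hτ0] with t ht
    exact le_of_mul_le_mul_left (key t (by rw [abs_of_pos ht.1]; exact ht.2)) ht.1
  · refine le_of_tendsto (hJlim.mono_left (nhdsWithin_le_nhds (s := Iio 0))) ?_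
    filter_upwards [Ioo_mem_nhdsLT (neg_lt_zero.2 hτ0)] with t ht
    have := key t (by rw [abs_of_neg ht.2]; linarith [ht.1])
    nlinarith [ht.2]

/-- The competitor `f + t W` has slope at most `g + |t| D`; first order expansion for both signs of
`t` gives the absolute value. Only an inequality results, because the slopes of `f` and `W` need not
be parallel. -/
theorem abs_integral_mul_le [IsFiniteMeasure μ] {q : ℝ} (hq : 1 < q)
    {f l : Lp ℝ 2 μ} (hl : l ∈ subdiffCheeger q f) {g : Lp ℝ (ENNReal.ofReal q) μ}
    (hg : IsOptimalSlope q f g) {W D : X → ℝ}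
    {K : ℝ≥0} (hW : LipschitzWith K W) (hWm : MemLp W 2 μ) (hD : MemLp D (ENNReal.ofReal q) μ)
    (hWD : ∀ x, realLip W x ≤ D x) :
    |∫ x, l x * W x ∂μ| ≤ ∫ x, D x * g x ^ (q - 1) ∂μ := by
  have hq0 : 0 < q := by linarith
  have hD0 : ∀ x, 0 ≤ D x := fun x => (realLip_nonneg W x).trans (hWD x)
  have hgi := integrable_slope_rpow hq hg
  have hgm := Lp.memLp g
  have hgme := hgm.1.aemeasurable
  have hgD : ∀ s, MemLp (fun x => g x + s * D x) (ENNReal.ofReal q) μ := fun s =>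
    hgm.add (hD.const_mul s)
  have hgD0 : ∀ s, 0 ≤ s → ∀ᵐ x ∂μ, 0 ≤ g x + s * D x := fun s hs => by
    filter_upwards [hg.nonneg] with x hx
    have := hD0 x
    positivity
  set J : ℝ → ℝ := fun s => ∫ x, (g x + s * D x) ^ (q - 1) * D x ∂μ with hJ
  have hJi : ∀ s, 0 ≤ s → Integrable (fun x => (g x + s * D x) ^ (q - 1) * D x) μ := fun s hs =>
    integrable_rpow_sub_one_mul hq (hgD s) hD (hgD0 s hs)
  have key : ∀ s, 0 < s → ∀ t, |t| = s → t * ∫ x, l x * W x ∂μ ≤ s * J s := by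
    intro s hs t ht
    have hFm : MemLp (fun x => f x + t * W x) 2 μ := (Lp.memLp f).add (hWm.const_mul t)
    have happ := hg.hasApproxSlope_add hq hW hD hWD t (F := hFm.toLp _) hFm.coeFn_toLp
    rw [ht] at happ
    have hle := integral_mul_sub_le_of_hasApproxSlope hq hl hg (integral_nonneg_of_ae (by
      filter_upwards [hgD0 s hs.le] with x hx
      exact Real.rpow_nonneg hx _)) happ
    have e1 : ∫ x, l x * ((hFm.toLp _ : Lp ℝ 2 μ) x - f x) ∂μ = t * ∫ x, l x * W x ∂μ := by
      rw [← integral_const_mul]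
      refine integral_congr_ae ?_
      filter_upwards [hFm.coeFn_toLp] with x hx
      rw [hx]; ring
    rw [e1] at hle
    have hi : Integrable (fun x => (g x + s * D x) ^ q) μ :=
      (integrable_abs_rpow hq (hgD s)).congr (by
        filter_upwards [hgD0 s hs.le] with x hx; rw [abs_of_nonneg hx])
    rw [← integral_sub hi hgi] at hle
    have h5 : ∫ x, ((g x + s * D x) ^ q - g x ^ q) ∂μ ≤ q * (s * J s) := by
      rw [hJ, ← integral_const_mul, ← integral_const_mul]
      refine integral_mono_ae (hi.sub hgi) (((hJi s hs.le).const_mul _).const_mul _) ?_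
      filter_upwards [hg.nonneg, hgD0 s hs.le] with x hx hx2
      refine (rpow_sub_rpow_le hq hx hx2).trans (le_of_eq ?_)
      ring
    exact le_of_mul_le_mul_left (hle.trans h5) hq0
  have hJlim : Tendsto J (𝓝[>] 0) (𝓝 (∫ x, D x * g x ^ (q - 1) ∂μ)) := by
    have hrw : ∫ x, D x * g x ^ (q - 1) ∂μ = ∫ x, (g x + 0 * D x) ^ (q - 1) * D x ∂μ := by
      simp only [zero_mul, add_zero, mul_comm (D _)]
    rw [hrw]
    refine tendsto_integral_filter_of_dominated_convergence
      (fun x => (g x + 1 * D x) ^ (q - 1) * D x) ?_ ?_ (hJi 1 zero_le_one) ?_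
    · filter_upwards [self_mem_nhdsWithin] with s hs using (hJi s (le_of_lt hs)).1
    · filter_upwards [Ioo_mem_nhdsGT (show (0 : ℝ) < 1 by norm_num)] with s hs
      filter_upwards [hgD0 s hs.1.le] with x hx
      have := hD0 x
      rw [Real.norm_of_nonneg (by positivity)]
      gcongr
      exact hs.2.le
    · refine ae_of_all _ fun x => ?_
      have : Continuous fun s : ℝ => (g x + s * D x) ^ (q - 1) * D x :=
        (Continuous.rpow_const (by fun_prop) fun _ => Or.inr (by linarith)).mul continuous_const
      exact (this.tendsto 0).mono_left nhdsWithin_le_nhds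
  refine ge_of_tendsto hJlim ?_
  filter_upwards [self_mem_nhdsWithin] with s hs
  have hs : 0 < s := hs
  rw [abs_le]
  have h1 := key s hs s (abs_of_pos hs)
  have h2 := key s hs (-s) (by rw [abs_neg, abs_of_pos hs])
  constructor <;> nlinarith

/-- Locality: `|∇f|_* = 0` almost everywhere on `{f = 0}`. -/
theorem IsOptimalSlope.eq_zero_of_eq_zero [IsFiniteMeasure μ] {q : ℝ} (hq : 1 < q)
    {f : Lp ℝ 2 μ} {g : Lp ℝ (ENNReal.ofReal q) μ} (hg : IsOptimalSlope q f g) :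
    ∀ᵐ x ∂μ, f x = 0 → g x = 0 := by
  have hq0 : 0 < q := by linarith
  have := fact_one_le_ofReal hq
  have hgi := integrable_slope_rpow hq hg
  have hfm : AEMeasurable f μ := (Lp.memLp f).1.aemeasurable
  set N : X → ℝ := fun x => if f x = 0 then 0 else g x ^ q with hN
  have hNm : AEStronglyMeasurable N μ := by
    have hs : NullMeasurableSet {x | f x = 0} μ := hfm.nullMeasurable (measurableSet_singleton 0)
    refine AEMeasurable.aestronglyMeasurable ?_
    have h := ((Lp.memLp g).1.aemeasurable.pow_const q).indicator₀ hs.compl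
    refine h.congr (ae_of_all _ fun x => ?_)
    by_cases hx : f x = 0 <;> simp [hN, hx]
  have hNi : Integrable N μ := Integrable.mono' hgi hNm (by
    filter_upwards [hg.nonneg] with x hx
    simp only [hN]
    split_ifs
    · simp; positivity
    · rw [Real.norm_of_nonneg (by positivity)])
  have hN0 : 0 ≤ ∫ x, N x ∂μ := integral_nonneg_of_ae (by
    filter_upwards [hg.nonneg] with x hx
    simp only [hN]
    split_ifs
    · simp
    · simp only [Pi.zero_apply]; positivity)
  have happ : HasApproxSlope q f ((∫ x, N x ∂μ) ^ (1 / q)) := by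
    intro η hη
    set M : ℝ := (eLpNorm (fun _ : X => (1 : ℝ)) 2 μ).toReal with hM
    have hM0 : 0 ≤ M := ENNReal.toReal_nonneg
    set δ : ℝ := η / 2 / (2 * (M + 1)) with hδ
    have hδ0 : 0 < δ := by positivity
    -- This function is within `2 * δ` of the identity, has derivative at most one, and its
    -- derivative vanishes at zero. So `f` is approximated in L² by functions whose energy does not
    -- see `{f = 0}`.
    have hφ : ∀ r : ℝ, HasDerivAt (fun r => r - δ * Real.arctan (r / δ))
        (r ^ 2 / (r ^ 2 + δ ^ 2)) r := fun r => by
      have h1 := ((Real.hasDerivAt_arctan (r / δ)).comp r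
        ((hasDerivAt_id r).div_const δ)).const_mul δ
      refine ((hasDerivAt_id r).sub h1).congr_deriv ?_
      have : r ^ 2 + δ ^ 2 ≠ 0 := by positivity
      field_simp
      ring
    have hden : ∀ r : ℝ, 0 < r ^ 2 + δ ^ 2 := fun r => by positivity
    have hφ1 : ∀ r : ℝ, |r ^ 2 / (r ^ 2 + δ ^ 2)| ≤ 1 := fun r => by
      rw [abs_of_nonneg (by positivity), div_le_one (hden r)]; nlinarith
    have hφL := lipschitzWith_of_hasDerivAt_le hφ hφ1
    have hFm : MemLp (fun x => f x - δ * Real.arctan (f x / δ)) 2 μ :=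
      memLp_comp_of_lipschitz hφL (Lp.memLp f)
    have h1 := hg.hasApproxSlope_comp hq hφ (Continuous.div (by fun_prop) (by fun_prop)
      fun r => (hden r).ne') hφ1 (F := hFm.toLp _) hFm.coeFn_toLp
    obtain ⟨v, ⟨L, hv⟩, hv1, hv2⟩ := h1 (η / 2) (by linarith)
    refine ⟨v, ⟨L, hv⟩, ?_, hv2.trans (ENNReal.ofReal_le_ofReal (add_le_add ?_ (by linarith)))⟩
    · have h2 : eLpNorm (fun x => (hFm.toLp _ : Lp ℝ 2 μ) x - f x) 2 μ ≤
          ENNReal.ofReal (η / 2) := by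
        have h3 : eLpNorm (fun x => (hFm.toLp _ : Lp ℝ 2 μ) x - f x) 2 μ ≤
            ENNReal.ofReal (2 * δ) * eLpNorm (fun _ : X => (1 : ℝ)) 2 μ := by
          refine eLpNorm_le_mul_eLpNorm_of_ae_le_mul ?_ 2
          filter_upwards [hFm.coeFn_toLp] with x hx
          rw [hx, norm_one, mul_one, Real.norm_eq_abs]
          have h4 : |Real.arctan (f x / δ)| ≤ 2 := by
            rw [abs_le]
            constructor <;> linarith [Real.neg_pi_div_two_lt_arctan (f x / δ),
              Real.arctan_lt_pi_div_two (f x / δ), Real.pi_le_four]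
          calc _ = |δ| * |Real.arctan (f x / δ)| := by rw [← abs_mul, ← abs_neg]; ring_nf
            _ ≤ δ * 2 := by rw [abs_of_pos hδ0]; gcongr
            _ = _ := by ring
        refine h3.trans ?_
        rw [← ENNReal.ofReal_toReal (memLp_const (μ := μ) (p := 2) (1 : ℝ)).2.ne,
          ← ENNReal.ofReal_mul (by positivity)]
        refine ENNReal.ofReal_le_ofReal ?_
        rw [← hM]
        calc 2 * δ * M ≤ 2 * δ * (M + 1) := by gcongr; linarith
          _ = η / 2 := by rw [hδ]; field_simp
      have h3 : (fun x => v x - f x) = (fun x => v x - (hFm.toLp _ : Lp ℝ 2 μ) x) +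
          fun x => (hFm.toLp _ : Lp ℝ 2 μ) x - f x := by
        ext x; simp
      rw [h3]
      refine (eLpNorm_add_le (aestronglyMeasurable_sub_Lp hv _)
        ((Lp.memLp _).1.sub (Lp.memLp f).1) (by norm_num)).trans ?_
      calc _ ≤ ENNReal.ofReal (η / 2) + ENNReal.ofReal (η / 2) := add_le_add hv1 h2
        _ = ENNReal.ofReal η := by
          rw [← ENNReal.ofReal_add (by linarith) (by linarith)]; ring_nf
    · have hnn : ∀ᵐ x ∂μ, 0 ≤ (|f x ^ 2 / (f x ^ 2 + δ ^ 2)| * g x) ^ q := by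
        filter_upwards [hg.nonneg] with x hx
        positivity
      refine Real.rpow_le_rpow (integral_nonneg_of_ae hnn) ?_ (by positivity)
      refine integral_mono_of_nonneg hnn hNi ?_
      filter_upwards [hg.nonneg] with x hx
      by_cases hfx : f x = 0
      · simp [hN, hfx, Real.zero_rpow hq0.ne']
      · simp only [hN, hfx, if_false]
        gcongr
        exact mul_le_of_le_one_left hx (hφ1 _)
  -- Minimality of `g` forces its mass on `{f = 0}` to vanish.
  have hle := hg.le_of_hasApproxSlope _ (by positivity) happ
  have hle2 := Real.rpow_le_rpow (norm_nonneg g) hle hq0.le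
  rw [← Real.rpow_mul hN0, one_div_mul_cancel hq0.ne', Real.rpow_one, Lp_norm_rpow hq] at hle2
  have hgg : ∫ x, |g x| ^ q ∂μ = ∫ x, g x ^ q ∂μ := integral_congr_ae (by
    filter_upwards [hg.nonneg] with x hx; rw [abs_of_nonneg hx])
  rw [hgg] at hle2
  have hdiff : 0 ≤ᵐ[μ] fun x => g x ^ q - N x := by
    filter_upwards [hg.nonneg] with x hx
    simp only [hN, Pi.zero_apply]
    split_ifs
    · simp; positivity
    · simp
  have hz : ∫ x, (g x ^ q - N x) ∂μ = 0 := by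
    refine le_antisymm ?_ (integral_nonneg_of_ae hdiff)
    rw [integral_sub hgi hNi]; linarith
  rw [integral_eq_zero_iff_of_nonneg_ae hdiff (hgi.sub hNi)] at hz
  filter_upwards [hz, hg.nonneg] with x hx hx0 hfx
  simp only [hN, hfx, if_true, sub_zero, Pi.zero_apply] at hx
  exact (Real.rpow_eq_zero hx0 hq0.ne').1 hx

end Subdifferential

/-! ### Absolutely continuous functions on the half-line and Grönwall's inequality. -/

section Scalar

theorem setIntegral_Ioc_eq_sub {φ φ' : ℝ → ℝ} {s t : ℝ} (hst : s ≤ t)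
    (hac : AbsolutelyContinuousOnInterval φ s t)
    (hd : ∀ᵐ r ∂(volume.restrict (Ioc s t)), HasDerivAt φ (φ' r) r) :
    IntegrableOn φ' (Ioc s t) ∧ ∫ r in Ioc s t, φ' r = φ t - φ s := by
  have h1 := hac.intervalIntegrable_deriv
  rw [intervalIntegrable_iff_integrableOn_Ioc_of_le hst] at h1
  have h2 : deriv φ =ᵐ[volume.restrict (Ioc s t)] φ' := by
    filter_upwards [hd] with r hr using hr.deriv
  refine ⟨h1.congr h2, ?_⟩
  rw [← hac.integral_deriv_eq_sub, intervalIntegral.integral_of_le hst]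
  exact (integral_congr_ae h2).symm

/-- A function which is locally absolutely continuous in `(0, ∞)`, continuous at `0` and has
derivative `-S ≤ 0` almost everywhere satisfies the fundamental theorem of calculus. -/
theorem lintegral_eq_ofReal_sub {φ : ℝ → ℝ} {S : ℝ → ℝ≥0∞}
    (hac : ∀ s t, 0 < s → s ≤ t → AbsolutelyContinuousOnInterval φ s t)
    (hc : ContinuousOn φ (Ici 0))
    (hd : ∀ᵐ t ∂(volume.restrict (Ioi (0 : ℝ))), S t ≠ ⊤ ∧ HasDerivAt φ (-(S t).toReal) t) :
    AEMeasurable S (volume.restrict (Ioi 0)) ∧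
      ∀ t, 0 ≤ t → φ t ≤ φ 0 ∧ ∫⁻ s in Ioc 0 t, S s = ENNReal.ofReal (φ 0 - φ t) := by
  have hS : S =ᵐ[volume.restrict (Ioi (0 : ℝ))] fun t => ENNReal.ofReal (-deriv φ t) := by
    filter_upwards [hd] with t ht
    rw [ht.2.deriv, neg_neg, ENNReal.ofReal_toReal ht.1]
  have hsub : ∀ s t : ℝ, 0 ≤ s → Ioc s t ⊆ Ioi 0 := fun s t hs r hr => hs.trans_lt hr.1
  have hpos : ∀ s t, 0 < s → s ≤ t →
      φ t ≤ φ s ∧ ∫⁻ r in Ioc s t, S r = ENNReal.ofReal (φ s - φ t) := by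
    intro s t hs hst
    have hd' : ∀ᵐ r ∂(volume.restrict (Ioc s t)), S r ≠ ⊤ ∧ HasDerivAt φ (-(S r).toReal) r :=
      ae_restrict_of_ae_restrict_of_subset (hsub s t hs.le) hd
    obtain ⟨h1, h2⟩ := setIntegral_Ioc_eq_sub hst (hac s t hs hst) (hd'.mono fun r hr => hr.2)
    have h3 : ∫ r in Ioc s t, (S r).toReal = φ s - φ t := by
      rw [integral_neg] at h2; linarith
    have h1' : IntegrableOn (fun r => (S r).toReal) (Ioc s t) := by simpa using h1.neg
    have h4 : 0 ≤ ∫ r in Ioc s t, (S r).toReal := integral_nonneg fun r => ENNReal.toReal_nonneg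
    refine ⟨by linarith, ?_⟩
    rw [← h3, ofReal_integral_eq_lintegral_ofReal h1' (ae_of_all _ fun r => ENNReal.toReal_nonneg)]
    refine lintegral_congr_ae ?_
    filter_upwards [hd'] with r hr
    rw [ENNReal.ofReal_toReal hr.1]
  -- `S` inherits measurability from the derivative of `φ`, with which it agrees almost everywhere
  -- up to sign.
  refine ⟨((measurable_deriv φ).neg.ennreal_ofReal.aemeasurable).congr hS.symm, fun t ht => ?_⟩
  rcases ht.eq_or_lt with rfl | ht
  · simp
  have hlim : Tendsto φ (𝓝[>] 0) (𝓝 (φ 0)) :=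
    (hc 0 self_mem_Ici).mono_left (nhdsWithin_mono _ Ioi_subset_Ici_self)
  refine ⟨ge_of_tendsto hlim ?_, ?_⟩
  · filter_upwards [Ioo_mem_nhdsGT ht] with s hs using (hpos s t hs.1 hs.2.le).1
  -- Absolute continuity is only known away from `0`, so `(0, t]` is exhausted by the intervals `(a
  -- n, t]`.
  set a : ℕ → ℝ := fun n => t / ((n : ℝ) + 1) with ha
  have ha0 : ∀ n, 0 < a n := fun n => by positivity
  have hat : ∀ n, a n ≤ t := fun n => div_le_self ht.le (by linarith [n.cast_nonneg (α := ℝ)])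
  have haanti : Antitone a := fun j k hjk => by simp only [ha]; gcongr
  have halim : Tendsto a atTop (𝓝 0) := by
    have := tendsto_one_div_add_atTop_nhds_zero_nat (𝕜 := ℝ)
    simpa [ha, div_eq_mul_inv] using this.const_mul t
  have halim' : Tendsto a atTop (𝓝[>] 0) :=
    tendsto_nhdsWithin_iff.2 ⟨halim, Eventually.of_forall ha0⟩
  have hU : Ioc 0 t = ⋃ n, Ioc (a n) t := by
    ext r
    simp only [mem_Ioc, mem_iUnion]
    refine ⟨fun ⟨h1, h2⟩ => ?_, fun ⟨n, h1, h2⟩ => ⟨(ha0 n).trans h1, h2⟩⟩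
    obtain ⟨n, hn⟩ := (halim.eventually (gt_mem_nhds h1)).exists
    exact ⟨n, hn, h2⟩
  have hmono : Monotone fun n => Ioc (a n) t := fun j k hjk => Ioc_subset_Ioc_left (haanti hjk)
  rw [hU, setLIntegral_iUnion_of_directed _ hmono.directed_le]
  have h1 : Monotone fun n => ∫⁻ r in Ioc (a n) t, S r := fun j k hjk =>
    lintegral_mono_set (hmono hjk)
  refine tendsto_nhds_unique (tendsto_atTop_iSup h1) ?_
  simp_rw [fun n => (hpos (a n) t (ha0 n) (hat n)).2]
  exact ENNReal.tendsto_ofReal ((hlim.comp halim').sub_const _)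

theorem abs_sub_le_setIntegral {φ ψ : ℝ → ℝ} {T : ℝ}
    (hac : ∀ s t, 0 < s → s ≤ t → AbsolutelyContinuousOnInterval φ s t)
    (hc : ContinuousOn φ (Ici 0))
    (hd : ∀ᵐ t ∂(volume.restrict (Ioc 0 T)), ∃ d, HasDerivAt φ d t ∧ |d| ≤ ψ t)
    (hψ : IntegrableOn ψ (Ioc 0 T)) {s t : ℝ} (hs : 0 ≤ s) (hst : s ≤ t) (htT : t ≤ T) :
    |φ t - φ s| ≤ ∫ r in Ioc s t, ψ r := by
  have hsub : ∀ s, 0 ≤ s → Ioc s t ⊆ Ioc 0 T := fun s hs => Ioc_subset_Ioc hs htT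
  have hpos : ∀ s, 0 < s → s ≤ t → |φ t - φ s| ≤ ∫ r in Ioc s t, ψ r := by
    intro s hs hst
    have hi : IntervalIntegrable ψ volume s t :=
      (intervalIntegrable_iff_integrableOn_Ioc_of_le hst).2 (hψ.mono_set (hsub s hs.le))
    rw [← (hac s t hs hst).integral_deriv_eq_sub, ← Real.norm_eq_abs,
      ← intervalIntegral.integral_of_le hst]
    refine intervalIntegral.norm_integral_le_of_norm_le hst ?_ hi
    have h := ae_restrict_of_ae_restrict_of_subset (hsub s hs.le) hd
    rw [ae_restrict_iff' measurableSet_Ioc] at h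
    filter_upwards [h] with r hr hmem
    obtain ⟨d, h1, h2⟩ := hr hmem
    rwa [h1.deriv]
  rcases hs.eq_or_lt with rfl | hs
  · rcases hst.eq_or_lt with rfl | ht
    · simp
    have hlim : Tendsto (fun s => |φ t - φ s|) (𝓝[>] 0) (𝓝 |φ t - φ 0|) :=
      (((hc 0 self_mem_Ici).mono_left (nhdsWithin_mono _ Ioi_subset_Ici_self)).const_sub _).abs
    refine le_of_tendsto hlim ?_
    filter_upwards [Ioo_mem_nhdsGT ht] with s hs
    refine (hpos s hs.1 hs.2.le).trans (setIntegral_mono_set (hψ.mono_set (hsub 0 le_rfl)) ?_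
      (Ioc_subset_Ioc_left hs.1.le).eventuallyLE)
    filter_upwards [ae_restrict_of_ae_restrict_of_subset (hsub 0 le_rfl) hd] with r hr
    obtain ⟨d, -, h2⟩ := hr
    exact (abs_nonneg d).trans h2
  · exact hpos s hs hst

/-- The increments are dominated by those of the primitive of `ψ`, which is absolutely continuous.
-/
theorem absolutelyContinuousOnInterval_of_abs_sub_le {φ ψ : ℝ → ℝ} {T : ℝ} (hT : 0 ≤ T)
    (hψ : IntegrableOn ψ (Ioc 0 T))
    (h : ∀ s t, 0 ≤ s → s ≤ t → t ≤ T → |φ t - φ s| ≤ ∫ r in Ioc s t, ψ r) :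
    AbsolutelyContinuousOnInterval φ 0 T := by
  have hi : IntervalIntegrable ψ volume 0 T :=
    (intervalIntegrable_iff_integrableOn_Ioc_of_le hT).2 hψ
  have hle : ∀ s ∈ uIcc 0 T, ∀ t ∈ uIcc 0 T,
      dist (φ s) (φ t) ≤ dist (∫ r in (0 : ℝ)..s, ψ r) (∫ r in (0 : ℝ)..t, ψ r) := by
    have key : ∀ s t, 0 ≤ s → s ≤ t → t ≤ T →
        dist (φ s) (φ t) ≤ dist (∫ r in (0 : ℝ)..s, ψ r) (∫ r in (0 : ℝ)..t, ψ r) := by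
      intro s t hs hst ht
      have i1 : ∀ u, 0 ≤ u → u ≤ T → IntervalIntegrable ψ volume 0 u := fun u h0 hu =>
        (intervalIntegrable_iff_integrableOn_Ioc_of_le h0).2
          (hψ.mono_set (Ioc_subset_Ioc_right hu))
      rw [dist_comm, dist_comm (∫ r in (0 : ℝ)..s, ψ r), Real.dist_eq, Real.dist_eq,
        intervalIntegral.integral_interval_sub_left (i1 t (hs.trans hst) ht)
          (i1 s hs (hst.trans ht)), intervalIntegral.integral_of_le hst]
      exact (h s t hs hst ht).trans (le_abs_self _)
    intro s hs t ht
    rw [uIcc_of_le hT] at hs ht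
    rcases le_total s t with hst | hst
    · exact key s t hs.1 hst ht.2
    · rw [dist_comm, dist_comm (∫ r in (0 : ℝ)..s, ψ r)]
      exact key t s ht.1 hst hs.2
  have hac := hi.absolutelyContinuousOnInterval_intervalIntegral (c := 0) (by simp)
  rw [absolutelyContinuousOnInterval_iff] at hac ⊢
  intro ε hε
  obtain ⟨δ, hδ, hE⟩ := hac ε hε
  refine ⟨δ, hδ, fun E hEm hlt => lt_of_le_of_lt (Finset.sum_le_sum fun i hi => ?_) (hE E hEm hlt)⟩
  exact hle _ (hEm.1 i hi).1 _ (hEm.1 i hi).2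

/-- Grönwall's inequality in integral form. -/
theorem add_setIntegral_le_mul_exp {y : ℝ → ℝ} {A b c T : ℝ} (hy : ContinuousOn y (Icc 0 T))
    (h : ∀ t ∈ Icc 0 T, b * y t ≤ c * (A + b * ∫ r in Ioc 0 t, y r)) {t : ℝ}
    (ht : t ∈ Icc 0 T) : A + b * ∫ r in Ioc 0 t, y r ≤ A * Real.exp (c * t) := by
  have hT : 0 ≤ T := ht.1.trans ht.2
  set Y : ℝ → ℝ := fun t => A + b * ∫ r in (0 : ℝ)..t, y r with hY
  have hYeq : ∀ t, 0 ≤ t → Y t = A + b * ∫ r in Ioc 0 t, y r := fun t ht => by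
    rw [hY, ← intervalIntegral.integral_of_le ht]
  have hYc : ContinuousOn Y (Icc 0 T) := by
    have h1 := intervalIntegral.continuousOn_primitive_interval (μ := volume) (f := y) (a := 0)
      (b := T) (by rw [uIcc_of_le hT]; exact hy.integrableOn_Icc)
    rw [uIcc_of_le hT] at h1
    exact (h1.const_mul b).const_add A
  have hYd : ∀ t ∈ Ioo 0 T, HasDerivAt Y (b * y t) t := fun t ht => by
    have hc : ContinuousAt y t := hy.continuousAt (Icc_mem_nhds ht.1 ht.2)
    have hi : IntervalIntegrable y volume 0 t :=
      (hy.mono (Icc_subset_Icc_right ht.2.le)).intervalIntegrable_of_Icc ht.1.le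
    have hm : StronglyMeasurableAtFilter y (𝓝 t) volume :=
      (hy.mono Ioo_subset_Icc_self).stronglyMeasurableAtFilter isOpen_Ioo t ht
    exact ((intervalIntegral.integral_hasDerivAt_right hi hm hc).const_mul b).const_add A
  have hexp : ∀ t : ℝ, HasDerivAt (fun t => Real.exp (-(c * t))) (Real.exp (-(c * t)) * -c) t :=
    fun t => by simpa using ((hasDerivAt_id t).const_mul c).neg.exp
  -- The hypothesis says `Y' ≤ c Y`, so `Y` times `exp (-(c t))` does not increase.
  have hanti : AntitoneOn (fun t => Y t * Real.exp (-(c * t))) (Icc 0 T) := by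
    refine antitoneOn_of_deriv_nonpos (convex_Icc 0 T)
      (hYc.mul (Continuous.continuousOn (by fun_prop))) ?_ ?_
    · rw [interior_Icc]
      exact fun t ht => ((hYd t ht).mul (hexp t)).differentiableAt.differentiableWithinAt
    · rw [interior_Icc]
      intro t ht
      refine ((hYd t ht).mul (hexp t)).deriv.trans_le ?_
      have h1 := h t (Ioo_subset_Icc_self ht)
      rw [← hYeq t ht.1.le] at h1
      have h2 := mul_le_mul_of_nonneg_right h1 (Real.exp_pos (-(c * t))).le
      linarith
  have h1 := hanti (left_mem_Icc.2 hT) ht ht.1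
  simp only [mul_zero, neg_zero, Real.exp_zero, mul_one] at h1
  rw [hYeq t ht.1, show Y 0 = A by simp [hY], Real.exp_neg] at h1
  have h2 := mul_le_mul_of_nonneg_right h1 (Real.exp_pos (c * t)).le
  rwa [mul_assoc, inv_mul_cancel₀ (Real.exp_pos _).ne', mul_one] at h2

end Scalar

/-! ### Integral functionals on L². -/

section Functionals

variable {X : Type*} [MeasurableSpace X] {μ : Measure X}

theorem inner_Lp_eq (w h : Lp ℝ 2 μ) : inner ℝ w h = ∫ x, w x * h x ∂μ := by
  rw [L2.inner_def]
  exact integral_congr_ae (ae_of_all _ fun x => by simp [mul_comm])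

theorem inner_toLp_eq {W : X → ℝ} (hW : MemLp W 2 μ) (h : Lp ℝ 2 μ) :
    inner ℝ (hW.toLp W) h = ∫ x, W x * h x ∂μ := by
  rw [inner_Lp_eq]
  refine integral_congr_ae ?_
  filter_upwards [hW.coeFn_toLp] with x hx
  rw [hx]

theorem integrable_mul_Lp {W : X → ℝ} (hW : MemLp W 2 μ) (h : Lp ℝ 2 μ) :
    Integrable (fun x => W x * h x) μ := hW.integrable_mul (Lp.memLp h)

theorem integral_sq_Lp (h : Lp ℝ 2 μ) : ∫ x, h x ^ 2 ∂μ = ‖h‖ ^ 2 := by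
  rw [← real_inner_self_eq_norm_sq, inner_Lp_eq]
  simp only [sq]

/-- Mean value inequality for `r ↦ e r - Θ a * r`, whose derivative vanishes at `a`. The quadratic
remainder makes `h ↦ ∫ e (h)` Fréchet differentiable on L². -/
theorem abs_sub_sub_mul_le {e Θ : ℝ → ℝ} {K : ℝ≥0} (he : ∀ r, HasDerivAt e (Θ r) r)
    (hΘ : LipschitzWith K Θ) (a b : ℝ) : |e b - e a - Θ a * (b - a)| ≤ K * (b - a) ^ 2 := by
  have h : ∀ x ∈ uIcc a b, ‖Θ x - Θ a‖ ≤ K * |b - a| := fun x hx => by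
    refine (hΘ.dist_le_mul x a).trans ?_
    gcongr
    rw [Real.dist_eq]
    rcases le_total a b with hab | hab
    · rw [uIcc_of_le hab] at hx
      rw [abs_of_nonneg (by linarith [hx.1]), abs_of_nonneg (by linarith)]; linarith [hx.2]
    · rw [uIcc_of_ge hab] at hx
      rw [abs_of_nonpos (by linarith [hx.2]), abs_of_nonpos (by linarith)]; linarith [hx.1]
  have h2 := (convex_uIcc a b).norm_image_sub_le_of_norm_hasDerivWithin_le
    (f := fun r => e r - Θ a * r) (f' := fun r => Θ r - Θ a)
    (fun x _ => ((he x).sub (by simpa using (hasDerivAt_id x).const_mul (Θ a))).hasDerivWithinAt)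
    h left_mem_uIcc right_mem_uIcc
  calc |e b - e a - Θ a * (b - a)| = ‖(e b - Θ a * b) - (e a - Θ a * a)‖ := by
        rw [Real.norm_eq_abs]; ring_nf
    _ ≤ K * |b - a| * ‖b - a‖ := h2
    _ = K * (b - a) ^ 2 := by rw [Real.norm_eq_abs, mul_assoc, ← sq, sq_abs]

variable [IsFiniteMeasure μ]

theorem integrable_comp_Lp {e Θ : ℝ → ℝ} {K : ℝ≥0} (he : ∀ r, HasDerivAt e (Θ r) r)
    (hΘ : LipschitzWith K Θ) (h : Lp ℝ 2 μ) : Integrable (fun x => e (h x)) μ := by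
  have hi := (Lp.memLp h).integrable (by norm_num)
  have hec : Continuous e := continuous_iff_continuousAt.2 fun r => (he r).continuousAt
  refine Integrable.mono' (((integrable_const |e 0|).add (hi.abs.const_mul |Θ 0|)).add
    ((Lp.memLp h).integrable_sq.const_mul (K : ℝ)))
    (hec.comp_aestronglyMeasurable (Lp.memLp h).1) (ae_of_all _ fun x => ?_)
  have h1 := abs_sub_sub_mul_le he hΘ 0 (h x)
  simp only [sub_zero] at h1
  simp only [Pi.add_apply, Real.norm_eq_abs, ← abs_mul]
  calc |e (h x)| = |(e (h x) - e 0 - Θ 0 * h x) + (e 0 + Θ 0 * h x)| := by ring_nf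
    _ ≤ _ := (abs_add_le _ _).trans (by linarith [abs_add_le (e 0) (Θ 0 * h x)])

theorem abs_integral_comp_sub_le {e Θ : ℝ → ℝ} {K : ℝ≥0} (he : ∀ r, HasDerivAt e (Θ r) r)
    (hΘ : LipschitzWith K Θ) (k h : Lp ℝ 2 μ) :
    |∫ x, e (h x) ∂μ - ∫ x, e (k x) ∂μ - ∫ x, Θ (k x) * (h - k : Lp ℝ 2 μ) x ∂μ| ≤
      K * ‖h - k‖ ^ 2 := by
  have i1 := integrable_comp_Lp he hΘ h
  have i2 := integrable_comp_Lp he hΘ k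
  have i3 := integrable_mul_Lp (memLp_comp_of_lipschitz hΘ (Lp.memLp k)) (h - k)
  have i12 : Integrable (fun x => e (h x) - e (k x)) μ := i1.sub i2
  rw [← integral_sub i1 i2, ← integral_sub i12 i3, ← integral_sq_Lp, ← integral_const_mul]
  refine (abs_integral_le_integral_abs).trans (integral_mono_ae (i12.sub i3).abs
    ((Lp.memLp _).integrable_sq.const_mul _) ?_)
  filter_upwards [Lp.coeFn_sub h k] with x hx
  simp only [hx, Pi.sub_apply]
  exact abs_sub_sub_mul_le he hΘ _ _

theorem hasFDerivAt_integral_comp {e Θ : ℝ → ℝ} {K : ℝ≥0} (he : ∀ r, HasDerivAt e (Θ r) r)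
    (hΘ : LipschitzWith K Θ) (k : Lp ℝ 2 μ) :
    HasFDerivAt (fun h : Lp ℝ 2 μ => ∫ x, e (h x) ∂μ)
      (innerSL ℝ ((memLp_comp_of_lipschitz hΘ (Lp.memLp k)).toLp _)) k := by
  refine HasFDerivAt.of_isLittleO ?_
  refine Asymptotics.IsBigO.trans_isLittleO (g := fun h : Lp ℝ 2 μ => ‖h - k‖ ^ 2) ?_
    (Asymptotics.isLittleO_pow_sub_sub k one_lt_two)
  refine Asymptotics.IsBigO.of_bound K (Eventually.of_forall fun h => ?_)
  rw [innerSL_apply_apply, inner_toLp_eq, Real.norm_eq_abs, norm_pow, norm_norm]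
  exact abs_integral_comp_sub_le he hΘ k h

/-- Lipschitz bounds on balls are what makes the functional absolutely continuous along a locally
Lipschitz curve. -/
theorem lipschitzOnWith_integral_comp {e Θ : ℝ → ℝ} {K : ℝ≥0} (he : ∀ r, HasDerivAt e (Θ r) r)
    (hΘ : LipschitzWith K Θ) (B : ℝ) :
    ∃ C : ℝ≥0, LipschitzOnWith C (fun h : Lp ℝ 2 μ => ∫ x, e (h x) ∂μ)
      (Metric.closedBall 0 B) := by
  set M : ℝ := ‖(memLp_const (Θ 0) : MemLp (fun _ : X => Θ 0) 2 μ).toLp _‖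
  refine ⟨(M + K * B + K * (2 * B)).toNNReal, LipschitzOnWith.of_dist_le_mul fun h hh k hk => ?_⟩
  rw [mem_closedBall_zero_iff] at hh hk
  have hB : 0 ≤ B := (norm_nonneg h).trans hh
  rw [Real.coe_toNNReal _ (by positivity), Real.dist_eq, dist_eq_norm]
  have hm := memLp_comp_of_lipschitz hΘ (Lp.memLp k)
  have h1 := abs_integral_comp_sub_le he hΘ k h
  rw [← inner_toLp_eq hm] at h1
  have h2 : |inner ℝ (hm.toLp _) (h - k)| ≤ (M + K * B) * ‖h - k‖ := by
    refine (abs_real_inner_le_norm _ _).trans ?_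
    gcongr
    have h3 : ‖hm.toLp _ - (memLp_const (Θ 0) : MemLp (fun _ : X => Θ 0) 2 μ).toLp _‖ ≤
        K * ‖k‖ := by
      refine Lp.norm_le_mul_norm_of_ae_le_mul ?_
      filter_upwards [hm.coeFn_toLp, (memLp_const (Θ 0) : MemLp (fun _ : X => Θ 0) 2 μ).coeFn_toLp,
        Lp.coeFn_sub (hm.toLp _) ((memLp_const (Θ 0) : MemLp (fun _ : X => Θ 0) 2 μ).toLp _)]
        with x h1 h2 h3
      rw [h3, Pi.sub_apply, h1, h2]
      simpa [dist_eq_norm] using hΘ.dist_le_mul (k x) 0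
    have h4 := norm_le_norm_add_norm_sub' (hm.toLp _)
      ((memLp_const (Θ 0) : MemLp (fun _ : X => Θ 0) 2 μ).toLp _)
    have h5 : (K : ℝ) * ‖k‖ ≤ K * B := by gcongr
    linarith
  have h6 : (K : ℝ) * ‖h - k‖ ^ 2 ≤ K * (2 * B) * ‖h - k‖ := by
    have : ‖h - k‖ ≤ 2 * B := (norm_sub_le h k).trans (by linarith)
    rw [sq, ← mul_assoc]
    gcongr
  have h7 := abs_sub_abs_le_abs_sub (∫ x, e (h x) ∂μ - ∫ x, e (k x) ∂μ)
    (inner ℝ (hm.toLp _) (h - k))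
  linarith

end Functionals

/-! ### Dissipation, conservation of mass and positivity along the flow. -/

section Flow

variable {X : Type*} [MetricSpace X] [MeasurableSpace X] [BorelSpace X] {μ : Measure X}

/-- `∫ θ(f) |∇f|_*^q dμ`. -/
def weightedEnergy (q : ℝ) (θ : ℝ → ℝ) (f : Lp ℝ 2 μ) : ℝ≥0∞ :=
  ∫⁻ x, ENNReal.ofReal (θ (f x)) * minRelaxedSlope q f x ^ q ∂μ

theorem IsHeatFlow.continuousOn {q : ℝ} {f : ℝ → Lp ℝ 2 μ} (hf : IsHeatFlow q f) :
    ContinuousOn f (Ici 0) := by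
  intro t ht
  rcases (mem_Ici.1 ht).eq_or_lt with rfl | ht
  · exact continuousWithinAt_Ioi_iff_Ici.1 hf.tendsto_zero
  · exact (hf.locallyLipschitz.continuousOn.continuousAt (Ioi_mem_nhds ht)).continuousWithinAt

theorem IsHeatFlow.absolutelyContinuousOnInterval {q : ℝ} {f : ℝ → Lp ℝ 2 μ}
    (hf : IsHeatFlow q f) {Φ : Lp ℝ 2 μ → ℝ}
    (hΦ : ∀ B : ℝ, ∃ C : ℝ≥0, LipschitzOnWith C Φ (Metric.closedBall 0 B)) {s t : ℝ} (hs : 0 < s)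
    (hst : s ≤ t) : AbsolutelyContinuousOnInterval (fun r => Φ (f r)) s t := by
  have hsub : Icc s t ⊆ Ioi 0 := fun r hr => hs.trans_le hr.1
  obtain ⟨L, hL⟩ := (hf.locallyLipschitz.mono hsub).exists_lipschitzOnWith_of_compact isCompact_Icc
  obtain ⟨B, hB⟩ := (isCompact_Icc.image_of_continuousOn hL.continuousOn).isBounded.subset_closedBall
    (0 : Lp ℝ 2 μ)
  obtain ⟨C, hC⟩ := hΦ B
  refine LipschitzOnWith.absolutelyContinuousOnInterval (K := C * L) ?_
  rw [uIcc_of_le hst]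
  exact hC.comp hL fun r hr => hB ⟨r, hr, rfl⟩

theorem IsHeatFlow.continuousOn_comp {q : ℝ} {f : ℝ → Lp ℝ 2 μ}
    (hf : IsHeatFlow q f) {Φ : Lp ℝ 2 μ → ℝ}
    (hΦ : ∀ B : ℝ, ∃ C : ℝ≥0, LipschitzOnWith C Φ (Metric.closedBall 0 B)) :
    ContinuousOn (fun r => Φ (f r)) (Ici 0) := by
  have hc : Continuous Φ := continuous_iff_continuousAt.2 fun h => by
    obtain ⟨C, hC⟩ := hΦ (‖h‖ + 1)
    refine hC.continuousOn.continuousAt (Filter.mem_of_superset (Metric.ball_mem_nhds h one_pos) ?_)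
    intro k hk
    rw [mem_closedBall_zero_iff]
    rw [mem_ball_iff_norm] at hk
    linarith [norm_le_norm_add_norm_sub' k h]
  exact hc.comp_continuousOn hf.continuousOn

variable [IsFiniteMeasure μ]

theorem IsHeatFlow.ae_exists_slope {q : ℝ} (hq : 1 < q) {f : ℝ → Lp ℝ 2 μ}
    (hf : IsHeatFlow q f) : ∀ᵐ t ∂(volume.restrict (Ioi (0 : ℝ))),
      ∃ (l : Lp ℝ 2 μ) (g : Lp ℝ (ENNReal.ofReal q) μ), l ∈ subdiffCheeger q (f t) ∧
        IsOptimalSlope q (f t) g ∧ HasDerivAt f (-l) t := by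
  filter_upwards [hf.deriv_mem] with t ht
  obtain ⟨l, hl, hd⟩ := ht
  obtain ⟨g, hg⟩ := exists_isOptimalSlope_of_cheeger_ne_top hq hl.1
  exact ⟨l, g, hl, hg, hd⟩

theorem IsOptimalSlope.weightedEnergy_eq {q : ℝ} (hq : 1 < q) {f : Lp ℝ 2 μ}
    {g : Lp ℝ (ENNReal.ofReal q) μ} (hg : IsOptimalSlope q f g) {θ : ℝ → ℝ} (hc : Continuous θ)
    (h0 : ∀ r, 0 ≤ θ r) {K : ℝ} (hK : ∀ r, θ r ≤ K) :
    weightedEnergy q θ f = ENNReal.ofReal (∫ x, θ (f x) * g x ^ q ∂μ) := by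
  have hi : Integrable (fun x => θ (f x) * g x ^ q) μ :=
    (integrable_slope_rpow hq hg).bdd_mul (c := K)
      (hc.comp_aestronglyMeasurable (Lp.memLp f).1) (ae_of_all _ fun x => by
        rw [Real.norm_of_nonneg (h0 _)]; exact hK _)
  rw [ofReal_integral_eq_lintegral_ofReal hi (by
    filter_upwards [hg.nonneg] with x hx
    exact mul_nonneg (h0 _) (Real.rpow_nonneg hx q)), weightedEnergy, hg.minRelaxedSlope_eq]
  refine lintegral_congr_ae ?_
  filter_upwards [hg.nonneg] with x hx
  rw [ENNReal.ofReal_rpow_of_nonneg hx (by linarith), ← ENNReal.ofReal_mul (h0 _)]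

/-- Dissipation of `∫ e(f) dμ` along the heat flow. -/
theorem IsHeatFlow.lintegral_weightedEnergy {q : ℝ} (hq : 1 < q) {f : ℝ → Lp ℝ 2 μ}
    (hf : IsHeatFlow q f) {e Θ θ : ℝ → ℝ} {K : ℝ} (he : ∀ r, HasDerivAt e (Θ r) r)
    (hΘ : ∀ r, HasDerivAt Θ (θ r) r) (hc : Continuous θ) (h0 : ∀ r, 0 ≤ θ r)
    (hK : ∀ r, θ r ≤ K) :
    AEMeasurable (fun t => weightedEnergy q θ (f t)) (volume.restrict (Ioi 0)) ∧
      ∀ t, 0 ≤ t → ∫ x, e (f t x) ∂μ ≤ ∫ x, e (f 0 x) ∂μ ∧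
        ∫⁻ s in Ioc 0 t, weightedEnergy q θ (f s) =
          ENNReal.ofReal (∫ x, e (f 0 x) ∂μ - ∫ x, e (f t x) ∂μ) := by
  have hΘL := lipschitzWith_of_hasDerivAt_le hΘ (K := K) fun r => by
    rw [abs_of_nonneg (h0 r)]; exact hK r
  have hΦ := lipschitzOnWith_integral_comp (μ := μ) he hΘL
  refine lintegral_eq_ofReal_sub (φ := fun t => ∫ x, e (f t x) ∂μ)
    (fun s t hs hst => hf.absolutelyContinuousOnInterval hΦ hs hst) (hf.continuousOn_comp hΦ) ?_
  filter_upwards [hf.ae_exists_slope hq] with t ht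
  obtain ⟨l, g, hl, hg, hd⟩ := ht
  rw [hg.weightedEnergy_eq hq hc h0 hK]
  refine ⟨ENNReal.ofReal_ne_top, ?_⟩
  have hnn : 0 ≤ ∫ x, θ (f t x) * g x ^ q ∂μ := integral_nonneg_of_ae (by
    filter_upwards [hg.nonneg] with x hx
    exact mul_nonneg (h0 _) (Real.rpow_nonneg hx q))
  rw [ENNReal.toReal_ofReal hnn, ← integral_mul_comp_eq hq hl hg hΘ hc h0 hK]
  have h1 := (hasFDerivAt_integral_comp he hΘL (f t)).comp_hasDerivAt t hd
  refine h1.congr_deriv ?_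
  rw [innerSL_apply_apply, inner_neg_right, inner_toLp_eq]
  simp only [mul_comm]

theorem lipschitzOnWith_integral_mul {W : X → ℝ} (hW : MemLp W 2 μ) (B : ℝ) :
    ∃ C : ℝ≥0, LipschitzOnWith C (fun h : Lp ℝ 2 μ => ∫ x, W x * h x ∂μ)
      (Metric.closedBall 0 B) := by
  refine ⟨‖innerSL ℝ (hW.toLp W)‖₊, ?_⟩
  have h := (innerSL ℝ (hW.toLp W)).lipschitz.lipschitzOnWith (s := Metric.closedBall 0 B)
  have e : (fun h : Lp ℝ 2 μ => ∫ x, W x * h x ∂μ) = innerSL ℝ (hW.toLp W) := by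
    ext h; rw [innerSL_apply_apply, inner_toLp_eq]
  rw [e]; exact h

theorem IsHeatFlow.ae_hasDerivAt_integral_mul {q : ℝ} (hq : 1 < q) {f : ℝ → Lp ℝ 2 μ}
    (hf : IsHeatFlow q f) {W D : X → ℝ} {K : ℝ≥0} (hW : LipschitzWith K W) (hWm : MemLp W 2 μ)
    (hD : MemLp D (ENNReal.ofReal q) μ) (hWD : ∀ x, realLip W x ≤ D x) :
    ∀ᵐ t ∂(volume.restrict (Ioi (0 : ℝ))), ∃ (d : ℝ) (g : Lp ℝ (ENNReal.ofReal q) μ),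
      IsOptimalSlope q (f t) g ∧ HasDerivAt (fun t => ∫ x, W x * f t x ∂μ) d t ∧
        |d| ≤ ∫ x, D x * g x ^ (q - 1) ∂μ := by
  filter_upwards [hf.ae_exists_slope hq] with t ht
  obtain ⟨l, g, hl, hg, hd⟩ := ht
  refine ⟨-∫ x, l x * W x ∂μ, g, hg, ?_, ?_⟩
  · have h1 := (innerSL ℝ (hWm.toLp W)).hasFDerivAt.comp_hasDerivAt t hd
    have e : (innerSL ℝ (hWm.toLp W) ∘ f) = fun t => ∫ x, W x * f t x ∂μ := by
      ext t; rw [Function.comp_apply, innerSL_apply_apply, inner_toLp_eq]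
    rw [e] at h1
    refine h1.congr_deriv ?_
    rw [innerSL_apply_apply, inner_neg_right, inner_toLp_eq]
    simp only [mul_comm]
  · rw [abs_neg]; exact abs_integral_mul_le hq hl hg hW hWm hD hWD

/-- Conservation of mass. -/
theorem IsHeatFlow.integral_eq {q : ℝ} (hq : 1 < q) {f : ℝ → Lp ℝ 2 μ}
    (hf : IsHeatFlow q f) {t : ℝ} (ht : 0 ≤ t) : ∫ x, f t x ∂μ = ∫ x, f 0 x ∂μ := by
  have hWm : MemLp (fun _ : X => (1 : ℝ)) 2 μ := memLp_const 1
  have hΦ := lipschitzOnWith_integral_mul hWm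
  -- The constant weight has zero slope, so the derivative of the mass vanishes.
  have h := abs_sub_le_setIntegral (φ := fun t => ∫ x, 1 * f t x ∂μ) (ψ := fun _ => 0) (T := t)
    (fun s t hs hst => hf.absolutelyContinuousOnInterval hΦ hs hst) (hf.continuousOn_comp hΦ)
    (by
      have h1 := hf.ae_hasDerivAt_integral_mul hq (LipschitzWith.const (1 : ℝ)) hWm
        (D := fun _ => 0) (memLp_const 0) (fun x => by
          simpa using realLip_le_of_lipschitz (LipschitzWith.const (1 : ℝ)) x)
      filter_upwards [ae_restrict_of_ae_restrict_of_subset Ioc_subset_Ioi_self h1] with s hs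
      obtain ⟨d, g, -, h2, h3⟩ := hs
      exact ⟨d, h2, by simpa using h3⟩) integrableOn_zero le_rfl ht le_rfl
  simpa [sub_eq_zero] using h

theorem exists_double_primitive {θ : ℝ → ℝ} (hc : Continuous θ) (a b : ℝ) :
    ∃ e Θ : ℝ → ℝ, (∀ r, HasDerivAt e (Θ r) r) ∧ (∀ r, HasDerivAt Θ (θ r) r) ∧ Θ 0 = b ∧
      e 0 = a := by
  set Θ : ℝ → ℝ := fun r => b + ∫ s in (0 : ℝ)..r, θ s with hΘ
  have h1 : ∀ r, HasDerivAt Θ (θ r) r := fun r =>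
    ((hc.integral_hasStrictDerivAt 0 r).hasDerivAt).const_add b
  have hΘc : Continuous Θ := continuous_iff_continuousAt.2 fun r => (h1 r).continuousAt
  refine ⟨fun r => a + ∫ s in (0 : ℝ)..r, Θ s, Θ, fun r =>
    ((hΘc.integral_hasStrictDerivAt 0 r).hasDerivAt).const_add a, h1, by simp [hΘ], by simp⟩

/-- Functions with the same derivative on `[0, ∞)` and the same value at `0` agree there. -/
theorem eq_of_hasDerivAt_eq {u v u' : ℝ → ℝ} (hu : ∀ r, 0 ≤ r → HasDerivAt u (u' r) r)
    (hv : ∀ r, 0 ≤ r → HasDerivAt v (u' r) r) (h0 : u 0 = v 0) {r : ℝ} (hr : 0 ≤ r) :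
    u r = v r := by
  have h := (convex_Ici (0 : ℝ)).is_const_of_fderivWithin_eq_zero (𝕜 := ℝ)
    (f := fun r => u r - v r)
    (fun x hx => ((hu x hx).sub (hv x hx)).differentiableAt.differentiableWithinAt)
    (fun x hx => by
      have h1 := ((hu x hx).sub (hv x hx))
      rw [sub_self] at h1
      have h2 := h1.hasFDerivAt.hasFDerivWithinAt (s := Ici (0 : ℝ))
      refine (h2.fderivWithin (uniqueDiffOn_Ici 0 x hx)).trans ?_
      ext; simp) (mem_Ici.2 hr) (mem_Ici.2 le_rfl)
  simp only [h0, sub_self] at h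
  linarith

/-- The heat flow preserves non-negativity. -/
theorem IsHeatFlow.nonneg {q : ℝ} (hq : 1 < q) {f : ℝ → Lp ℝ 2 μ}
    (hf : IsHeatFlow q f) (hf0 : 0 ≤ f 0) {t : ℝ} (ht : 0 ≤ t) : ∀ᵐ x ∂μ, 0 ≤ f t x := by
  -- The associated `e` is zero on `[0, ∞)` and positive on the negative axis, so its integral
  -- starts at zero and cannot grow. The cap at one meets the boundedness required by the chain
  -- rule.
  set θ : ℝ → ℝ := fun r => min (max (-r) 0) 1 with hθ
  have hc : Continuous θ := by fun_prop
  have h0 : ∀ r, 0 ≤ θ r := fun r => le_min (le_max_right _ _) zero_le_one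
  have hK : ∀ r, θ r ≤ 1 := fun r => min_le_right _ _
  obtain ⟨e, Θ, he, hΘ, hΘ0, he0⟩ := exists_double_primitive hc 0 0
  have hΘp : ∀ r, 0 ≤ r → Θ r = 0 := fun r hr =>
    eq_of_hasDerivAt_eq (v := fun _ => 0) (u' := fun _ => 0) (fun r hr => by
      have := hΘ r
      rwa [show θ r = 0 by simp [hθ, hr]] at this) (fun r _ => hasDerivAt_const r 0) hΘ0 hr
  have hep : ∀ r, 0 ≤ r → e r = 0 := fun r hr =>
    eq_of_hasDerivAt_eq (v := fun _ => 0) (u' := fun _ => 0) (fun r hr => by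
      have := he r
      rwa [hΘp r hr] at this) (fun r _ => hasDerivAt_const r 0) he0 hr
  have hθn : ∀ r < 0, 0 < θ r := fun r hr => lt_min (lt_max_of_lt_left (by linarith)) one_pos
  have hΘn : ∀ r < 0, Θ r < 0 := fun r hr => by
    obtain ⟨c, hc, h⟩ := exists_hasDerivAt_eq_slope Θ θ hr
      (fun x _ => (hΘ x).continuousAt.continuousWithinAt) fun x _ => hΘ x
    have := hθn c hc.2
    rw [h, hΘ0, lt_div_iff₀ (by linarith)] at this
    linarith
  have hen : ∀ r < 0, 0 < e r := fun r hr => by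
    obtain ⟨c, hc, h⟩ := exists_hasDerivAt_eq_slope e Θ hr
      (fun x _ => (he x).continuousAt.continuousWithinAt) fun x _ => he x
    have := hΘn c hc.2
    rw [h, he0, div_lt_iff₀ (by linarith)] at this
    linarith
  have he_nn : ∀ r, 0 ≤ e r := fun r => by
    rcases lt_or_ge r 0 with hr | hr
    · exact (hen r hr).le
    · exact (hep r hr).ge
  have hle := ((hf.lintegral_weightedEnergy hq he hΘ hc h0 hK).2 t ht).1
  have hz : ∫ x, e (f 0 x) ∂μ = 0 := by
    refine integral_eq_zero_of_ae ?_
    filter_upwards [(Lp.coeFn_nonneg (f 0)).2 hf0] with x hx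
    exact hep _ hx
  have hΘL := lipschitzWith_of_hasDerivAt_le hΘ (K := 1) fun r => by
    rw [abs_of_nonneg (h0 r)]; exact hK r
  have hz2 : ∫ x, e (f t x) ∂μ = 0 :=
    le_antisymm (hle.trans hz.le) (integral_nonneg fun x => he_nn _)
  rw [integral_eq_zero_iff_of_nonneg (fun x => he_nn _) (integrable_comp_Lp he hΘL (f t))] at hz2
  filter_upwards [hz2] with x hx
  by_contra hneg
  exact (hen _ (not_le.1 hneg)).ne' hx

end Flow

/-! ### The Fisher information and entropy dissipation. -/

section Fisher

variable {X : Type*} [MetricSpace X] [MeasurableSpace X] [BorelSpace X] {μ : Measure X}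
  [IsFiniteMeasure μ]

/-- The density of `fisher`, for the slope `g` of `f`. -/
def fisherDensity (p q : ℝ) (f g : X → ℝ) (x : X) : ℝ :=
  if 0 < f x then g x ^ q / f x ^ (p - 1) else 0

theorem IsOptimalSlope.fisherDensity_nonneg {p q : ℝ} {f : Lp ℝ 2 μ}
    {g : Lp ℝ (ENNReal.ofReal q) μ} (hg : IsOptimalSlope q f g) :
    ∀ᵐ x ∂μ, 0 ≤ fisherDensity p q f g x := by
  filter_upwards [hg.nonneg] with x hx
  rw [fisherDensity]
  split_ifs <;> positivity

theorem IsOptimalSlope.fisher_eq {p q : ℝ} (hq : 1 < q) {f : Lp ℝ 2 μ}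
    {g : Lp ℝ (ENNReal.ofReal q) μ} (hg : IsOptimalSlope q f g) :
    fisher p q f = ∫⁻ x, ENNReal.ofReal (fisherDensity p q f g x) ∂μ := by
  have hs : MeasurableSet {x | 0 < f x} :=
    measurableSet_lt measurable_const (Lp.stronglyMeasurable f).measurable
  rw [fisher, hg.minRelaxedSlope_eq, ← lintegral_indicator hs]
  refine lintegral_congr_ae ?_
  filter_upwards [hg.nonneg] with x hx
  by_cases h : 0 < f x
  · rw [indicator_of_mem (by exact h), fisherDensity, if_pos h,
      ENNReal.ofReal_rpow_of_nonneg hx (by linarith), ENNReal.ofReal_div_of_pos (by positivity)]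
  · rw [indicator_of_notMem (by exact h), fisherDensity, if_neg h, ENNReal.ofReal_zero]

theorem aestronglyMeasurable_fisherDensity {p q : ℝ} (f : Lp ℝ 2 μ)
    (g : Lp ℝ (ENNReal.ofReal q) μ) : AEStronglyMeasurable (fisherDensity p q f g) μ := by
  have hf := (Lp.stronglyMeasurable f).measurable
  have hg := (Lp.stronglyMeasurable g).measurable
  exact (Measurable.ite (measurableSet_lt measurable_const hf)
    ((hg.pow_const q).div (hf.pow_const _)) measurable_const).aestronglyMeasurable

theorem IsOptimalSlope.integral_fisherDensity {p q : ℝ} (hq : 1 < q) {f : Lp ℝ 2 μ}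
    {g : Lp ℝ (ENNReal.ofReal q) μ} (hg : IsOptimalSlope q f g) (hfin : fisher p q f ≠ ⊤) :
    Integrable (fisherDensity p q f g) μ ∧
      ∫ x, fisherDensity p q f g x ∂μ = (fisher p q f).toReal := by
  have hm := aestronglyMeasurable_fisherDensity (p := p) f g
  rw [hg.fisher_eq hq] at hfin ⊢
  have hi := (lintegral_ofReal_ne_top_iff_integrable hm hg.fisherDensity_nonneg).1 hfin
  refine ⟨hi, ?_⟩
  rw [← ofReal_integral_eq_lintegral_ofReal hi hg.fisherDensity_nonneg,
    ENNReal.toReal_ofReal (integral_nonneg_of_ae hg.fisherDensity_nonneg)]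

/-- Regularizations of the weight `r ↦ r ^ (1 - p)` on `(0, ∞)`. -/
def regWeight (p δ r : ℝ) : ℝ := (max r 0 + δ) ^ (1 - p)

theorem continuous_regWeight (p : ℝ) {δ : ℝ} (hδ : 0 < δ) : Continuous (regWeight p δ) :=
  Continuous.rpow_const (by fun_prop) fun r =>
    Or.inl (add_pos_of_nonneg_of_pos (le_max_right r 0) hδ).ne'

theorem regWeight_nonneg (p : ℝ) {δ : ℝ} (hδ : 0 < δ) (r : ℝ) : 0 ≤ regWeight p δ r :=
  Real.rpow_nonneg (add_nonneg (le_max_right r 0) hδ.le) _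

theorem regWeight_le {p δ δ' : ℝ} (hp : 1 < p) (hδ : 0 < δ) (h : δ ≤ δ') (r : ℝ) :
    regWeight p δ' r ≤ regWeight p δ r :=
  Real.rpow_le_rpow_of_nonpos (add_pos_of_nonneg_of_pos (le_max_right r 0) hδ) (by linarith)
    (by linarith)

theorem regWeight_le_const {p δ : ℝ} (hp : 1 < p) (hδ : 0 < δ) (r : ℝ) :
    regWeight p δ r ≤ δ ^ (1 - p) :=
  Real.rpow_le_rpow_of_nonpos hδ (by linarith [le_max_right r 0]) (by linarith)

/-- Monotone convergence as the regularization is removed. On `{f = 0}` the weights blow up, but the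
slope vanishes there by locality, so only `{f > 0}` survives in the limit. -/
theorem IsOptimalSlope.tendsto_weightedEnergy {p q : ℝ} (hp : 1 < p) (hq : 1 < q) {f : Lp ℝ 2 μ}
    (hf : ∀ᵐ x ∂μ, 0 ≤ f x) {g : Lp ℝ (ENNReal.ofReal q) μ} (hg : IsOptimalSlope q f g) :
    Monotone (fun n : ℕ => weightedEnergy q (regWeight p (1 / ((n : ℝ) + 1))) f) ∧
    Tendsto (fun n : ℕ => weightedEnergy q (regWeight p (1 / ((n : ℝ) + 1))) f) atTop
      (𝓝 (fisher p q f)) := by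
  have hδ : ∀ n : ℕ, (0 : ℝ) < 1 / ((n : ℝ) + 1) := fun n => by positivity
  have hmono : ∀ x, Monotone fun n : ℕ =>
      ENNReal.ofReal (regWeight p (1 / ((n : ℝ) + 1)) (f x)) * ENNReal.ofReal (g x) ^ q := by
    intro x j k hjk
    dsimp only
    gcongr
    exact regWeight_le hp (hδ k) (by gcongr) _
  simp only [weightedEnergy, hg.minRelaxedSlope_eq]
  refine ⟨fun j k hjk => lintegral_mono fun x => hmono x hjk, ?_⟩
  rw [hg.fisher_eq hq]
  have hfm := (Lp.stronglyMeasurable f).measurable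
  have hgm := (Lp.stronglyMeasurable g).measurable
  refine lintegral_tendsto_of_tendsto_of_monotone (fun n => ?_) (ae_of_all _ hmono) ?_
  · exact ((((continuous_regWeight p (hδ n)).measurable.comp hfm).ennreal_ofReal).mul
      (hgm.ennreal_ofReal.pow_const q)).aemeasurable
  filter_upwards [hf, hg.nonneg, hg.eq_zero_of_eq_zero hq] with x h1 h2 h3
  rcases h1.eq_or_lt with h0 | h0
  · rw [fisherDensity, if_neg (by rw [← h0]; exact lt_irrefl _), h3 h0.symm, ENNReal.ofReal_zero,
      ENNReal.zero_rpow_of_pos (by linarith)]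
    simp
  · rw [fisherDensity, if_pos h0, div_eq_inv_mul, ENNReal.ofReal_mul (by positivity),
      ENNReal.ofReal_rpow_of_nonneg h2 (by linarith)]
    refine ENNReal.Tendsto.mul_const (ENNReal.tendsto_ofReal ?_) (Or.inr ENNReal.ofReal_ne_top)
    have h4 : Tendsto (fun n : ℕ => f x + 1 / ((n : ℝ) + 1)) atTop (𝓝 (f x)) := by
      simpa using tendsto_one_div_add_atTop_nhds_zero_nat.const_add (f x)
    have h5 := h4.rpow_const (p := 1 - p) (Or.inl h0.ne')
    rw [show (1 : ℝ) - p = -(p - 1) by ring, Real.rpow_neg h1] at h5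
    simpa [regWeight, max_eq_left h1] using h5

theorem integrable_rpow_of_nonneg {f : Lp ℝ 2 μ} (hf : ∀ᵐ x ∂μ, 0 ≤ f x) {s : ℝ} (hs0 : 0 ≤ s)
    (hs2 : s ≤ 2) {δ : ℝ} (hδ : 0 ≤ δ) : Integrable (fun x => (f x + δ) ^ s) μ := by
  have hi : Integrable (fun x => 1 + (f x + δ) ^ 2) μ :=
    (integrable_const 1).add (((Lp.memLp f).add (memLp_const δ)).integrable_sq)
  refine Integrable.mono' hi
    ((((Lp.stronglyMeasurable f).measurable.add_const δ).pow_const s).aestronglyMeasurable) ?_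
  filter_upwards [hf] with x hx
  have h0 : 0 ≤ f x + δ := by positivity
  rw [Real.norm_of_nonneg (by positivity)]
  rcases le_total (f x + δ) 1 with h | h
  · have := Real.rpow_le_one h0 h hs0
    nlinarith [sq_nonneg (f x + δ)]
  · have := Real.rpow_le_rpow_of_exponent_le h hs2
    rw [Real.rpow_two] at this
    linarith

/-- The entropy `∫ (f^(3-p) - f) / (2-p) dμ`. -/
def entropy (p : ℝ) (f : Lp ℝ 2 μ) : ℝ := ∫ x, 1 / (2 - p) * (f x ^ (3 - p) - f x) ∂μ

theorem entropy_eq {p : ℝ} (hp1 : 1 < p) (hp3 : p < 3) {f : Lp ℝ 2 μ} (hf : ∀ᵐ x ∂μ, 0 ≤ f x) :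
    Integrable (fun x => 1 / (2 - p) * (f x ^ (3 - p) - f x)) μ ∧
    entropy p f = 1 / (2 - p) * (∫ x, f x ^ (3 - p) ∂μ - ∫ x, f x ∂μ) := by
  have h1 := integrable_rpow_of_nonneg hf (s := 3 - p) (by linarith) (by linarith) le_rfl
  simp only [add_zero] at h1
  have h2 := (Lp.memLp f).integrable (by norm_num)
  exact ⟨(h1.sub h2).const_mul _, by rw [entropy, integral_const_mul, integral_sub h1 h2]⟩

/-- The initial values are chosen so that no affine term appears. Extending the weight by a constant
to negative `r` keeps it bounded and continuous on the line, as the chain rule demands. -/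
theorem exists_regWeight_primitive {p : ℝ} (hp3 : p < 3) (hp2 : p ≠ 2) {δ : ℝ} (hδ : 0 < δ) :
    ∃ e Θ : ℝ → ℝ, (∀ r, HasDerivAt e (Θ r) r) ∧ (∀ r, HasDerivAt Θ (regWeight p δ r) r) ∧
      ∀ r, 0 ≤ r → e r = (r + δ) ^ (3 - p) / ((3 - p) * (2 - p)) := by
  have h3 : 3 - p ≠ 0 := by linarith
  have h2 : 2 - p ≠ 0 := sub_ne_zero.2 hp2.symm
  obtain ⟨e, Θ, he, hΘ, hΘ0, he0⟩ := exists_double_primitive (continuous_regWeight p hδ)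
    (δ ^ (3 - p) / ((3 - p) * (2 - p))) (δ ^ (2 - p) / (2 - p))
  refine ⟨e, Θ, he, hΘ, ?_⟩
  have hpow : ∀ s r : ℝ, 0 ≤ r → HasDerivAt (fun r => (r + δ) ^ s) (s * (r + δ) ^ (s - 1)) r :=
    fun s r hr => by
      have h := ((hasDerivAt_id r).add_const δ).rpow_const (p := s)
        (Or.inl (by simp only [id]; positivity))
      refine h.congr_deriv ?_
      simp
  have hΘr : ∀ r, 0 ≤ r → Θ r = (r + δ) ^ (2 - p) / (2 - p) := fun r hr =>
    eq_of_hasDerivAt_eq (u' := regWeight p δ) (fun r _ => hΘ r) (fun r hr => by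
      refine ((hpow (2 - p) r hr).div_const (2 - p)).congr_deriv ?_
      rw [mul_div_cancel_left₀ _ h2, regWeight, max_eq_left hr]; ring_nf) (by simp [hΘ0]) hr
  exact fun r hr => eq_of_hasDerivAt_eq (u' := Θ) (fun r _ => he r) (fun r hr => by
    refine ((hpow (3 - p) r hr).div_const ((3 - p) * (2 - p))).congr_deriv ?_
    rw [hΘr r hr, mul_div_mul_left _ _ h3]; ring_nf) (by simp [he0]) hr

/-- The entropy dissipation identity along the heat flow. -/
theorem IsHeatFlow.lintegral_fisher {p q : ℝ} (hp1 : 1 < p) (hp3 : p < 3) (hp2 : p ≠ 2)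
    (hq : 1 < q) {f : ℝ → Lp ℝ 2 μ} (hf : IsHeatFlow q f) (hf0 : 0 ≤ f 0) :
    AEMeasurable (fun t => fisher p q (f t)) (volume.restrict (Ioi 0)) ∧
      ∀ t, 0 ≤ t → entropy p (f t) ≤ entropy p (f 0) ∧ ∫⁻ s in Ioc 0 t, fisher p q (f s) =
        ENNReal.ofReal ((entropy p (f 0) - entropy p (f t)) / (3 - p)) := by
  set δ : ℕ → ℝ := fun n => 1 / ((n : ℝ) + 1) with hδdef
  have hδ : ∀ n, 0 < δ n := fun n => by positivity
  have hδ1 : ∀ n, δ n ≤ 1 := fun n => by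
    simp only [hδdef]; rw [div_le_one (by positivity)]; linarith [n.cast_nonneg (α := ℝ)]
  have hlim : ∀ᵐ t ∂(volume.restrict (Ioi (0 : ℝ))),
      Monotone (fun n : ℕ => weightedEnergy q (regWeight p (δ n)) (f t)) ∧
      Tendsto (fun n : ℕ => weightedEnergy q (regWeight p (δ n)) (f t)) atTop
        (𝓝 (fisher p q (f t))) := by
    filter_upwards [hf.ae_exists_slope hq, ae_restrict_mem measurableSet_Ioi] with t ht ht0
    obtain ⟨l, g, -, hg, -⟩ := ht
    exact hg.tendsto_weightedEnergy hp1 hq (hf.nonneg hq hf0 (le_of_lt ht0))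
  choose e Θ he hΘ hepos using fun n => exists_regWeight_primitive hp3 hp2 (hδ n)
  have hdis := fun n => hf.lintegral_weightedEnergy hq (he n) (hΘ n) (continuous_regWeight p (hδ n))
    (regWeight_nonneg p (hδ n)) (regWeight_le_const hp1 (hδ n))
  refine ⟨aemeasurable_of_tendsto_metrizable_ae' (fun n => (hdis n).1)
    (hlim.mono fun t ht => ht.2), fun t ht => ?_⟩
  have hent : ∀ t, 0 ≤ t → Tendsto (fun n => ∫ x, e n (f t x) ∂μ) atTop
      (𝓝 (∫ x, f t x ^ (3 - p) / ((3 - p) * (2 - p)) ∂μ)) := by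
    intro t ht
    have hnn := hf.nonneg hq hf0 ht
    have hrw : ∀ n, ∫ x, e n (f t x) ∂μ =
        ∫ x, (f t x + δ n) ^ (3 - p) / ((3 - p) * (2 - p)) ∂μ := fun n => by
      refine integral_congr_ae ?_
      filter_upwards [hnn] with x hx using hepos n _ hx
    simp_rw [hrw]
    refine tendsto_integral_of_dominated_convergence
      (fun x => (f t x + 1) ^ (3 - p) / |(3 - p) * (2 - p)|) (fun n => ?_) ?_ (fun n => ?_) ?_
    · exact ((((Lp.stronglyMeasurable (f t)).measurable.add_const _).pow_const _).div_const
        _).aestronglyMeasurable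
    · exact (integrable_rpow_of_nonneg hnn (by linarith) (by linarith) zero_le_one).div_const _
    · filter_upwards [hnn] with x hx
      have := hδ n
      rw [norm_div, Real.norm_of_nonneg (by positivity), Real.norm_eq_abs]
      gcongr
      exact hδ1 n
    · refine ae_of_all _ fun x => ?_
      have h4 : Tendsto (fun n : ℕ => f t x + 1 / ((n : ℝ) + 1)) atTop (𝓝 (f t x)) := by
        simpa using tendsto_one_div_add_atTop_nhds_zero_nat.const_add (f t x)
      exact (h4.rpow_const (Or.inr (by linarith))).div_const _
  -- The linear part of the entropy cancels by conservation of mass.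
  have hdiff : ∫ x, f 0 x ^ (3 - p) / ((3 - p) * (2 - p)) ∂μ -
      ∫ x, f t x ^ (3 - p) / ((3 - p) * (2 - p)) ∂μ =
        (entropy p (f 0) - entropy p (f t)) / (3 - p) := by
    rw [(entropy_eq hp1 hp3 (hf.nonneg hq hf0 le_rfl)).2,
      (entropy_eq hp1 hp3 (hf.nonneg hq hf0 ht)).2, hf.integral_eq hq ht, integral_div,
      integral_div]
    have h3 : 3 - p ≠ 0 := by linarith
    have h2 : 2 - p ≠ 0 := sub_ne_zero.2 hp2.symm
    field_simp
    ring
  have hlimE := (hent 0 le_rfl).sub (hent t ht)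
  rw [hdiff] at hlimE
  have h0 : 0 ≤ (entropy p (f 0) - entropy p (f t)) / (3 - p) :=
    ge_of_tendsto' hlimE fun n => sub_nonneg.2 ((hdis n).2 t ht).1
  refine ⟨?_, ?_⟩
  · have h3 : 0 < 3 - p := by linarith
    have := mul_nonneg h0 h3.le
    rw [div_mul_cancel₀ _ h3.ne'] at this
    linarith
  have hsub : Ioc (0 : ℝ) t ⊆ Ioi 0 := Ioc_subset_Ioi_self
  have hlim' := ae_restrict_of_ae_restrict_of_subset hsub hlim
  have h1 := lintegral_tendsto_of_tendsto_of_monotone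
    (fun n => (hdis n).1.mono_measure (Measure.restrict_mono hsub le_rfl))
    (hlim'.mono fun t ht => ht.1) (hlim'.mono fun t ht => ht.2)
  refine tendsto_nhds_unique h1 ?_
  simp_rw [fun n => ((hdis n).2 t ht).2]
  exact ENNReal.tendsto_ofReal hlimE

end Fisher

/-! ### Growth of the moment, by truncation of the weight. -/

section Moment

variable {X : Type*} [MetricSpace X]

/-- The truncated weight `min(V, N)`. -/
def truncWeight (V : X → ℝ) (N : ℕ) (x : X) : ℝ := min (V x) N

theorem truncWeight_nonneg {V : X → ℝ} (hV0 : ∀ x, 0 ≤ V x) (N : ℕ) (x : X) :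
    0 ≤ truncWeight V N x := le_min (hV0 x) N.cast_nonneg

theorem lipschitzWith_truncWeight {V : X → ℝ} {L : ℝ≥0} (hV : LipschitzWith L V) (N : ℕ) :
    LipschitzWith L (truncWeight V N) := hV.min_const _

theorem abs_rpow_sub_rpow_le {p : ℝ} (hp : 1 < p) {N a b : ℝ} (ha : 0 ≤ a) (hb : 0 ≤ b)
    (haN : a ≤ N) (hbN : b ≤ N) : |a ^ p - b ^ p| ≤ p * N ^ (p - 1) * |a - b| := by
  have key : ∀ a b : ℝ, 0 ≤ a → 0 ≤ b → a ≤ N → b ≤ a → |a ^ p - b ^ p| ≤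
      p * N ^ (p - 1) * |a - b| := by
    intro a b ha hb haN hba
    have h := rpow_sub_rpow_le hp hb ha
    have h2 : b ^ p ≤ a ^ p := by gcongr
    rw [abs_of_nonneg (by linarith), abs_of_nonneg (by linarith)]
    refine h.trans ?_
    have : 0 ≤ a - b := by linarith
    gcongr
  rcases le_total b a with h | h
  · exact key a b ha hb haN h
  · rw [abs_sub_comm, abs_sub_comm a]; exact key b a hb ha hbN h

theorem lipschitzWith_truncWeight_rpow {p : ℝ} (hp : 1 < p) {V : X → ℝ} {L : ℝ≥0}
    (hV : LipschitzWith L V) (hV0 : ∀ x, 0 ≤ V x) (N : ℕ) :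
    LipschitzWith ((p * (N : ℝ) ^ (p - 1)).toNNReal * L) fun x => truncWeight V N x ^ p := by
  refine LipschitzWith.of_dist_le_mul fun x y => ?_
  have h1 := abs_rpow_sub_rpow_le hp (truncWeight_nonneg hV0 N x) (truncWeight_nonneg hV0 N y)
    (min_le_right _ _) (min_le_right _ _)
  have h2 := (lipschitzWith_truncWeight hV N).dist_le_mul x y
  rw [NNReal.coe_mul, Real.coe_toNNReal _ (by positivity), Real.dist_eq, mul_assoc]
  refine h1.trans ?_
  rw [Real.dist_eq] at h2
  gcongr

theorem realLip_truncWeight_rpow_le {p : ℝ} (hp : 1 < p) {V : X → ℝ} {L : ℝ≥0}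
    (hV : LipschitzWith L V) (hV0 : ∀ x, 0 ≤ V x) (N : ℕ) (x : X) :
    realLip (fun x => truncWeight V N x ^ p) x ≤ p * L * truncWeight V N x ^ (p - 1) := by
  have hL := lipschitzWith_truncWeight hV N
  have h0 := truncWeight_nonneg hV0 N x
  refine (realLip_comp_le hL (φ := fun r => r ^ p)
    (Real.hasDerivAt_rpow_const (x := truncWeight V N x) (p := p) (Or.inr hp.le))).trans ?_
  rw [abs_of_nonneg (by positivity)]
  calc _ ≤ p * truncWeight V N x ^ (p - 1) * L := by
        gcongr; exact realLip_le_of_lipschitz hL x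
    _ = _ := by ring

/-- The weighted Young inequality behind the moment estimate. -/
theorem mul_rpow_le_young {p q : ℝ} (hpq : p.HolderConjugate q) {c L v f g : ℝ} (hc : 0 < c)
    (hL : 0 ≤ L) (hv : 0 ≤ v) (hf : 0 < f) (hg : 0 ≤ g) :
    p * L * v ^ (p - 1) * g ^ (q - 1) ≤
      c ^ p * (g ^ q / f ^ (p - 1)) + (p - 1) * L ^ q * (c ^ q)⁻¹ * (v ^ p * f) := by
  have hp := hpq.lt
  have hq := hpq.symm.lt
  have hq0 : 0 < q := by linarith
  have h1 : (p - 1) * q = p := hpq.sub_one_mul_conj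
  have h2 : (q - 1) * p = q := hpq.symm.sub_one_mul_conj
  have hpq1 : p / q = p - 1 := by
    rw [div_eq_iff hq0.ne']; exact h1.symm
  -- Young's inequality is applied to `c g^(q-1) / w` and `L v^(p-1) w / c`; this `w` produces
  -- `f^(p-1)` in the first term and `f` in the second.
  set w : ℝ := f ^ (1 / q) with hw
  have hw0 : 0 < w := Real.rpow_pos_of_pos hf _
  have hwq : w ^ q = f := by
    rw [hw, ← Real.rpow_mul hf.le, one_div_mul_cancel hq0.ne', Real.rpow_one]
  have hwp : w ^ p = f ^ (p - 1) := by
    rw [hw, ← Real.rpow_mul hf.le]; congr 1; rw [← hpq1]; ring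
  have hG : (g ^ (q - 1)) ^ p = g ^ q := by rw [← Real.rpow_mul hg, h2]
  have hU : (v ^ (p - 1)) ^ q = v ^ p := by rw [← Real.rpow_mul hv, h1]
  set G := g ^ (q - 1)
  set U := v ^ (p - 1)
  have hG0 : 0 ≤ G := by positivity
  have hU0 : 0 ≤ U := by positivity
  have hy := Real.young_inequality_of_nonneg (a := c * G / w) (b := L * U * w / c)
    (by positivity) (by positivity) hpq
  have e1 : c * G / w * (L * U * w / c) = L * U * G := by field_simp
  have e2 : (c * G / w) ^ p = c ^ p * (g ^ q / f ^ (p - 1)) := by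
    rw [Real.div_rpow (by positivity) hw0.le, Real.mul_rpow hc.le hG0, hG, hwp]; ring
  have e3 : (L * U * w / c) ^ q = L ^ q * (c ^ q)⁻¹ * (v ^ p * f) := by
    rw [Real.div_rpow (by positivity) hc.le, Real.mul_rpow (by positivity) hw0.le,
      Real.mul_rpow hL hU0, hU, hwq]; ring
  rw [e1, e2, e3] at hy
  have h3 := mul_le_mul_of_nonneg_left hy (show 0 ≤ p by linarith)
  calc _ = p * (L * U * G) := by ring
    _ ≤ _ := h3
    _ = c ^ p * (g ^ q / f ^ (p - 1)) + p / q * (L ^ q * (c ^ q)⁻¹ * (v ^ p * f)) := by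
      field_simp
    _ = _ := by rw [hpq1]; ring

variable [MeasurableSpace X] [BorelSpace X] {μ : Measure X} [IsFiniteMeasure μ]

theorem memLp_truncWeight_rpow {V : X → ℝ} (hV : Continuous V)
    (hV0 : ∀ x, 0 ≤ V x) (N : ℕ) {s : ℝ} (hs : 0 ≤ s) (r : ℝ≥0∞) :
    MemLp (fun x => truncWeight V N x ^ s) r μ := by
  have hm : Measurable (truncWeight V N) := hV.measurable.min measurable_const
  refine MemLp.of_bound (hm.pow_const s).aestronglyMeasurable ((N : ℝ) ^ s)
    (ae_of_all _ fun x => ?_)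
  have h0 := truncWeight_nonneg hV0 N x
  rw [Real.norm_of_nonneg (by positivity)]
  exact Real.rpow_le_rpow h0 (min_le_right _ _) hs

theorem IsHeatFlow.ae_fisher_ne_top {p q : ℝ} (hp1 : 1 < p) (hp3 : p < 3) (hp2 : p ≠ 2)
    (hq : 1 < q) {f : ℝ → Lp ℝ 2 μ} (hf : IsHeatFlow q f) (hf0 : 0 ≤ f 0) {T : ℝ} (hT : 0 ≤ T) :
    (∀ᵐ t ∂(volume.restrict (Ioc 0 T)), fisher p q (f t) ≠ ⊤) ∧
      IntegrableOn (fun t => (fisher p q (f t)).toReal) (Ioc 0 T) ∧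
      ∫ t in Ioc 0 T, (fisher p q (f t)).toReal =
        (entropy p (f 0) - entropy p (f T)) / (3 - p) := by
  obtain ⟨h1, h2⟩ := hf.lintegral_fisher hp1 hp3 hp2 hq hf0
  have hm := h1.mono_measure (Measure.restrict_mono (fun r hr => hr.1 : Ioc (0 : ℝ) T ⊆ Ioi 0)
    (le_refl volume))
  have hfin : ∫⁻ s in Ioc 0 T, fisher p q (f s) ≠ ⊤ := by
    rw [(h2 T hT).2]; exact ENNReal.ofReal_ne_top
  have hae := ae_lt_top' hm hfin
  refine ⟨hae.mono fun t ht => ht.ne, integrable_toReal_of_lintegral_ne_top hm hfin, ?_⟩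
  rw [integral_toReal hm hae, (h2 T hT).2, ENNReal.toReal_ofReal]
  exact div_nonneg (by linarith [(h2 T hT).1]) (by linarith)

/-- The truncated moment `∫ min(V, N)^p f dμ`. -/
def truncMoment (p : ℝ) (V : X → ℝ) (N : ℕ) (f : Lp ℝ 2 μ) : ℝ := ∫ x, truncWeight V N x ^ p * f x ∂μ

theorem IsHeatFlow.continuousOn_truncMoment {p q : ℝ} (hp : 1 < p) {f : ℝ → Lp ℝ 2 μ}
    (hf : IsHeatFlow q f) {V : X → ℝ} (hV : Continuous V) (hV0 : ∀ x, 0 ≤ V x) (N : ℕ) :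
    ContinuousOn (fun t => truncMoment p V N (f t)) (Ici 0) :=
  hf.continuousOn_comp (lipschitzOnWith_integral_mul
    (memLp_truncWeight_rpow hV hV0 N (by linarith) 2))

/-- Young's inequality under the integral in the derivative bound for the weight `min(V,N)^p`. It is
needed only where `f > 0`; elsewhere the slope vanishes. The constants do not depend on `N`. -/
theorem IsHeatFlow.abs_truncMoment_sub_le {p q : ℝ} (hp3 : p < 3) (hp2 : p ≠ 2)
    (hpq : p.HolderConjugate q) {f : ℝ → Lp ℝ 2 μ} (hf : IsHeatFlow q f) (hf0 : 0 ≤ f 0)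
    {V : X → ℝ} {L : ℝ≥0} (hV : LipschitzWith L V) (hV0 : ∀ x, 0 ≤ V x) (N : ℕ) {c : ℝ}
    (hc : 0 < c) {s t : ℝ} (hs : 0 ≤ s) (hst : s ≤ t) :
    |truncMoment p V N (f t) - truncMoment p V N (f s)| ≤ ∫ r in Ioc s t,
      (c ^ p * (fisher p q (f r)).toReal +
        (p - 1) * (L : ℝ) ^ q * (c ^ q)⁻¹ * truncMoment p V N (f r)) := by
  have hp1 := hpq.lt
  have hq := hpq.symm.lt
  have ht : 0 ≤ t := hs.trans hst
  have hWm : MemLp (fun x => truncWeight V N x ^ p) 2 μ :=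
    memLp_truncWeight_rpow hV.continuous hV0 N (by linarith) 2
  have hDm : MemLp (fun x => p * L * truncWeight V N x ^ (p - 1)) (ENNReal.ofReal q) μ :=
    (memLp_truncWeight_rpow hV.continuous hV0 N (by linarith) _).const_mul _
  have hΦ := lipschitzOnWith_integral_mul hWm
  obtain ⟨hfin, hRi, -⟩ := hf.ae_fisher_ne_top hp1 hp3 hp2 hq hf0 ht
  have hMi : IntegrableOn (fun r => truncMoment p V N (f r)) (Ioc 0 t) :=
    (((hf.continuousOn_truncMoment hp1 hV.continuous hV0 N).mono
      Icc_subset_Ici_self).integrableOn_Icc).mono_set Ioc_subset_Icc_self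
  refine abs_sub_le_setIntegral (φ := fun t => truncMoment p V N (f t)) (T := t)
    (fun s t hs hst => hf.absolutelyContinuousOnInterval hΦ hs hst) (hf.continuousOn_comp hΦ) ?_
    ((hRi.const_mul _).add (hMi.const_mul _)) hs hst le_rfl
  have h1 := ae_restrict_of_ae_restrict_of_subset (fun r hr => hr.1 : Ioc (0 : ℝ) t ⊆ Ioi 0)
    (hf.ae_hasDerivAt_integral_mul hq (lipschitzWith_truncWeight_rpow hp1 hV hV0 N) hWm hDm
      (realLip_truncWeight_rpow_le hp1 hV hV0 N))
  filter_upwards [h1, hfin, ae_restrict_mem measurableSet_Ioc] with r hr hrfin hr0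
  obtain ⟨d, g, hg, hd, hdle⟩ := hr
  refine ⟨d, hd, hdle.trans ?_⟩
  obtain ⟨hi, hieq⟩ := hg.integral_fisherDensity hq hrfin
  have hfr := hf.nonneg hq hf0 hr0.1.le
  simp only [Pi.add_apply]
  rw [← hieq, truncMoment, ← integral_const_mul, ← integral_const_mul,
    ← integral_add (hi.const_mul _) ((integrable_mul_Lp hWm (f r)).const_mul _)]
  refine integral_mono_of_nonneg ?_ ((hi.const_mul _).add
    ((integrable_mul_Lp hWm (f r)).const_mul _)) ?_
  · filter_upwards [hg.nonneg] with x hx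
    have := truncWeight_nonneg hV0 N x
    simp only [Pi.zero_apply]
    positivity
  · filter_upwards [hg.nonneg, hfr, hg.eq_zero_of_eq_zero hq] with x h1 h2 h3
    have h4 := truncWeight_nonneg hV0 N x
    rcases h2.eq_or_lt with h0 | h0
    · rw [h3 h0.symm, Real.zero_rpow (by linarith), mul_zero, ← h0]
      simp [fisherDensity, ← h0]
    · rw [fisherDensity, if_pos h0]
      exact mul_rpow_le_young hpq hc L.2 h4 h0 h1

/-- A bound on the truncated moments which is uniform in the truncation. -/
theorem IsHeatFlow.exists_truncMoment_le {p q : ℝ} (hp3 : p < 3) (hp2 : p ≠ 2)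
    (hpq : p.HolderConjugate q) {f : ℝ → Lp ℝ 2 μ} (hf : IsHeatFlow q f) (hf0 : 0 ≤ f 0)
    {V : X → ℝ} {L : ℝ≥0} (hV : LipschitzWith L V) (hV0 : ∀ x, 0 ≤ V x)
    (hVf0 : Integrable (fun x => V x ^ p * f 0 x) μ) (T : ℝ) :
    ∃ B : ℝ, ∀ N : ℕ, ∀ t ∈ Icc 0 T, truncMoment p V N (f t) ≤ B := by
  rcases lt_or_ge T 0 with hT | hT
  · exact ⟨0, fun N t ht => absurd (ht.1.trans ht.2) (not_le.2 hT)⟩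
  have hp1 := hpq.lt
  have hq := hpq.symm.lt
  have hf0' := (Lp.coeFn_nonneg (f 0)).2 hf0
  set β : ℝ := (p - 1) * (L : ℝ) ^ q * ((1 : ℝ) ^ q)⁻¹ with hβ
  have hβ0 : 0 ≤ β := mul_nonneg (mul_nonneg (by linarith) (by positivity)) (by positivity)
  obtain ⟨-, hRi, -⟩ := hf.ae_fisher_ne_top hp1 hp3 hp2 hq hf0 hT
  set R : ℝ → ℝ := fun t => (fisher p q (f t)).toReal with hR
  -- Initial moment plus total Fisher information: independent of `N`, hence so is the Grönwall
  -- bound.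
  set A : ℝ := ∫ x, V x ^ p * f 0 x ∂μ + ∫ t in Ioc 0 T, R t with hA
  have hA0 : 0 ≤ A := by
    refine add_nonneg (integral_nonneg_of_ae ?_) (integral_nonneg fun t => ENNReal.toReal_nonneg)
    filter_upwards [hf0'] with x hx
    exact mul_nonneg (Real.rpow_nonneg (hV0 x) _) hx
  refine ⟨A * Real.exp (β * T), fun N t ht => ?_⟩
  set y : ℝ → ℝ := fun t => truncMoment p V N (f t) with hy
  have hyc : ContinuousOn y (Icc 0 T) :=
    (hf.continuousOn_truncMoment hp1 hV.continuous hV0 N).mono Icc_subset_Ici_self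
  have hy0 : y 0 ≤ ∫ x, V x ^ p * f 0 x ∂μ := by
    refine integral_mono_ae (integrable_mul_Lp
      (memLp_truncWeight_rpow hV.continuous hV0 N (by linarith) 2) (f 0)) hVf0 ?_
    filter_upwards [hf0'] with x hx
    have := truncWeight_nonneg hV0 N x
    gcongr
    exact min_le_left _ _
  have hint : ∀ t ∈ Icc 0 T, y t ≤ A + β * ∫ r in Ioc 0 t, y r := by
    intro t ht
    have h1 := hf.abs_truncMoment_sub_le hp3 hp2 hpq hf0 hV hV0 N one_pos le_rfl ht.1
    rw [Real.one_rpow p] at h1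
    simp only [one_mul] at h1
    have hsub : Ioc 0 t ⊆ Ioc 0 T := Ioc_subset_Ioc_right ht.2
    have hyi : IntegrableOn y (Ioc 0 t) :=
      (hyc.integrableOn_Icc.mono_set Ioc_subset_Icc_self).mono_set hsub
    rw [integral_add (hRi.mono_set hsub) (hyi.const_mul β), integral_const_mul] at h1
    have h2 : ∫ r in Ioc 0 t, R r ≤ ∫ r in Ioc 0 T, R r :=
      setIntegral_mono_set hRi (ae_of_all _ fun r => ENNReal.toReal_nonneg) hsub.eventuallyLE
    have h3 := (le_abs_self _).trans h1
    simp only [hA]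
    linarith
  refine (hint t ht).trans ((add_setIntegral_le_mul_exp (c := β) hyc (fun t ht => by
    have := hint t ht
    gcongr) ht).trans ?_)
  gcongr
  exact ht.2

/-- The moment `∫ V^p f dμ` along the heat flow. -/
theorem IsHeatFlow.moment {p q : ℝ} (hp3 : p < 3) (hp2 : p ≠ 2)
    (hpq : p.HolderConjugate q) {f : ℝ → Lp ℝ 2 μ} (hf : IsHeatFlow q f) (hf0 : 0 ≤ f 0)
    {V : X → ℝ} {L : ℝ≥0} (hV : LipschitzWith L V) (hV0 : ∀ x, 0 ≤ V x)
    (hVf0 : Integrable (fun x => V x ^ p * f 0 x) μ) :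
    (∀ t, 0 ≤ t → Integrable (fun x => V x ^ p * f t x) μ) ∧
    ∀ T, 0 ≤ T → IntegrableOn (fun t => ∫ x, V x ^ p * f t x ∂μ) (Ioc 0 T) ∧
      ∀ c > 0, ∀ s t, 0 ≤ s → s ≤ t → t ≤ T →
        |∫ x, V x ^ p * f t x ∂μ - ∫ x, V x ^ p * f s x ∂μ| ≤ ∫ r in Ioc s t,
          (c ^ p * (fisher p q (f r)).toReal +
            (p - 1) * (L : ℝ) ^ q * (c ^ q)⁻¹ * ∫ x, V x ^ p * f r x ∂μ) := by
  have hp1 := hpq.lt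
  have hq := hpq.symm.lt
  have hVp : ∀ x, Tendsto (fun N : ℕ => truncWeight V N x ^ p) atTop (𝓝 (V x ^ p)) := fun x => by
    obtain ⟨N, hN⟩ := exists_nat_ge (V x)
    refine tendsto_const_nhds.congr' ?_
    filter_upwards [eventually_ge_atTop N] with n hn
    have : (N : ℝ) ≤ n := by exact_mod_cast hn
    rw [truncWeight, min_eq_left (hN.trans this)]
  have hWm : ∀ N, MemLp (fun x => truncWeight V N x ^ p) 2 μ := fun N =>
    memLp_truncWeight_rpow hV.continuous hV0 N (by linarith) 2
  have hle : ∀ t, 0 ≤ t → ∀ N, ∀ᵐ x ∂μ, 0 ≤ truncWeight V N x ^ p * f t x ∧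
      truncWeight V N x ^ p * f t x ≤ V x ^ p * f t x := fun t ht N => by
    filter_upwards [hf.nonneg hq hf0 ht] with x hx
    have := truncWeight_nonneg hV0 N x
    refine ⟨by positivity, ?_⟩
    gcongr
    exact min_le_left _ _
  have hVm : Measurable fun x => V x ^ p := hV.continuous.measurable.pow_const p
  have hint : ∀ t, 0 ≤ t → Integrable (fun x => V x ^ p * f t x) μ := by
    intro t ht
    obtain ⟨B, hB⟩ := hf.exists_truncMoment_le hp3 hp2 hpq hf0 hV hV0 hVf0 t
    have hm : AEStronglyMeasurable (fun x => V x ^ p * f t x) μ :=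
      (hVm.mul (Lp.stronglyMeasurable (f t)).measurable).aestronglyMeasurable
    have hnn : 0 ≤ᵐ[μ] fun x => V x ^ p * f t x := by
      filter_upwards [hf.nonneg hq hf0 ht] with x hx
      exact mul_nonneg (Real.rpow_nonneg (hV0 x) _) hx
    refine (lintegral_ofReal_ne_top_iff_integrable hm hnn).1 (ne_of_lt ?_)
    -- Fatou's lemma turns the uniform bound on truncated moments into integrability.
    have hliminf : ∀ x, ENNReal.ofReal (V x ^ p * f t x) =
        liminf (fun N => ENNReal.ofReal (truncWeight V N x ^ p * f t x)) atTop := fun x =>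
      (ENNReal.tendsto_ofReal ((hVp x).mul_const _)).liminf_eq.symm
    simp_rw [hliminf]
    refine (lintegral_liminf_le' fun N => ?_).trans_lt (lt_of_le_of_lt (b := ENNReal.ofReal B) ?_
      ENNReal.ofReal_lt_top)
    · exact (integrable_mul_Lp (hWm N) (f t)).1.aemeasurable.ennreal_ofReal
    · refine liminf_le_of_le (by isBoundedDefault) fun b hb => ?_
      obtain ⟨N, hN⟩ := hb.exists
      refine hN.trans ?_
      rw [← ofReal_integral_eq_lintegral_ofReal (integrable_mul_Lp (hWm N) (f t))
        ((hle t ht N).mono fun x hx => hx.1)]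
      exact ENNReal.ofReal_le_ofReal (hB N t (right_mem_Icc.2 ht))
  have hMlim : ∀ t, 0 ≤ t → Tendsto (fun N => truncMoment p V N (f t)) atTop
      (𝓝 (∫ x, V x ^ p * f t x ∂μ)) := fun t ht => by
    refine tendsto_integral_of_dominated_convergence _
      (fun N => (integrable_mul_Lp (hWm N) (f t)).1) (hint t ht) (fun N => ?_)
      (ae_of_all _ fun x => (hVp x).mul_const _)
    filter_upwards [hle t ht N] with x hx
    rw [Real.norm_of_nonneg hx.1]
    exact hx.2
  have hMle : ∀ t, 0 ≤ t → ∀ N, truncMoment p V N (f t) ≤ ∫ x, V x ^ p * f t x ∂μ :=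
    fun t ht N => integral_mono_ae (integrable_mul_Lp (hWm N) (f t)) (hint t ht)
      ((hle t ht N).mono fun x hx => hx.2)
  refine ⟨hint, fun T hT => ?_⟩
  have hMi : IntegrableOn (fun t => ∫ x, V x ^ p * f t x ∂μ) (Ioc 0 T) := by
    obtain ⟨B, hB⟩ := hf.exists_truncMoment_le hp3 hp2 hpq hf0 hV hV0 hVf0 T
    refine Integrable.mono' (integrable_const B) (aestronglyMeasurable_of_tendsto_ae atTop
      (f := fun N t => truncMoment p V N (f t)) (fun N => ?_) ?_) ?_
    · exact ((hf.continuousOn_truncMoment hp1 hV.continuous hV0 N).mono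
        (Ioc_subset_Icc_self.trans Icc_subset_Ici_self)).aestronglyMeasurable measurableSet_Ioc
    · filter_upwards [ae_restrict_mem measurableSet_Ioc] with t ht using hMlim t ht.1.le
    · filter_upwards [ae_restrict_mem measurableSet_Ioc] with t ht
      rw [Real.norm_of_nonneg (integral_nonneg_of_ae (by
        filter_upwards [hf.nonneg hq hf0 ht.1.le] with x hx
        exact mul_nonneg (Real.rpow_nonneg (hV0 x) _) hx))]
      exact le_of_tendsto' (hMlim t ht.1.le) fun N => hB N t ⟨ht.1.le, ht.2⟩
  refine ⟨hMi, fun c hc s t hs hst htT => ?_⟩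
  obtain ⟨-, hRi, -⟩ := hf.ae_fisher_ne_top hp1 hp3 hp2 hq hf0 hT
  have hsub : Ioc s t ⊆ Ioc 0 T := Ioc_subset_Ioc hs htT
  -- The truncated moments increase to the full one, which bounds the right side before `N → ∞` on
  -- the left.
  refine le_of_tendsto' (((hMlim t (hs.trans hst)).sub (hMlim s hs)).abs) fun N => ?_
  refine (hf.abs_truncMoment_sub_le hp3 hp2 hpq hf0 hV hV0 N hc hs hst).trans ?_
  have hNi : IntegrableOn (fun r => truncMoment p V N (f r)) (Ioc 0 T) :=
    (((hf.continuousOn_truncMoment hp1 hV.continuous hV0 N).mono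
      Icc_subset_Ici_self).integrableOn_Icc).mono_set Ioc_subset_Icc_self
  refine setIntegral_mono_on
    (((hRi.mono_set hsub).const_mul _).add ((hNi.mono_set hsub).const_mul _))
    (((hRi.mono_set hsub).const_mul _).add ((hMi.mono_set hsub).const_mul _)) measurableSet_Ioc fun r hr => ?_
  have h1 := hMle r (hs.trans hr.1.le) N
  have h2 : 0 ≤ (p - 1) * (L : ℝ) ^ q * (c ^ q)⁻¹ :=
    mul_nonneg (mul_nonneg (by linarith) (by positivity)) (by positivity)
  gcongr

end Moment

/-! ### The Grönwall argument, entropy lower bounds and the growth constant. -/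

section Estimate

variable {X : Type*} [MetricSpace X] [MeasurableSpace X] [BorelSpace X] {μ : Measure X}
  [IsFiniteMeasure μ]

/-- The Grönwall argument: the combination of entropy dissipation and growth of the moment. -/
theorem IsHeatFlow.momentum_entropy {p q : ℝ} (hp3 : p < 3) (hp2 : p ≠ 2)
    (hpq : p.HolderConjugate q) {f : ℝ → Lp ℝ 2 μ} (hf : IsHeatFlow q f) (hf0 : 0 ≤ f 0)
    {V : X → ℝ} {L : ℝ≥0} (hV : LipschitzWith L V) (hV0 : ∀ x, 0 ≤ V x)
    (hVf0 : Integrable (fun x => V x ^ p * f 0 x) μ) {k κ a c : ℝ} (hk : 0 < k) (hκ : 1 ≤ κ)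
    (hc : 0 ≤ c)
    (hkc : (p - 1) * (L : ℝ) ^ q * (k ^ q / (3 - p) ^ (q - 1)) ≤ c * κ)
    (h1 : ∀ t, 0 ≤ t → κ * ∫ x, V x ^ p * f t x ∂μ ≤
      entropy p (f t) + a + k * ∫ x, V x ^ p * f t x ∂μ)
    (h2 : ∀ t, 0 ≤ t → 0 ≤ entropy p (f t) + a + 3 / 4 * (k * ∫ x, V x ^ p * f t x ∂μ))
    {t : ℝ} (ht : 0 ≤ t) :
    ∫ x, V x ^ p * f t x ∂μ ≤
        (entropy p (f 0) + a + k * ∫ x, V x ^ p * f 0 x ∂μ) * Real.exp (c * t) ∧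
      (3 - p) / 4 * ((entropy p (f 0) - entropy p (f t)) / (3 - p)) ≤
        (entropy p (f 0) + a + k * ∫ x, V x ^ p * f 0 x ∂μ) * Real.exp (c * t) := by
  have hp1 := hpq.lt
  have hq := hpq.symm.lt
  have h3p : 0 < 3 - p := by linarith
  set M : ℝ → ℝ := fun t => ∫ x, V x ^ p * f t x ∂μ with hM
  set E : ℝ → ℝ := fun t => entropy p (f t) with hE
  have hM0 : ∀ s, 0 ≤ s → 0 ≤ M s := fun s hs => integral_nonneg_of_ae (by
    filter_upwards [hf.nonneg hq hf0 hs] with x hx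
    exact mul_nonneg (Real.rpow_nonneg (hV0 x) _) hx)
  obtain ⟨-, hmom⟩ := hf.moment hp3 hp2 hpq hf0 hV hV0 hVf0
  obtain ⟨hMi, hmom⟩ := hmom t ht
  -- Chosen so that `k γ^p ∫ F` is exactly the dissipated entropy.
  set γ : ℝ := ((3 - p) / k) ^ (1 / p) with hγ
  have hγ0 : 0 < γ := Real.rpow_pos_of_pos (by positivity) _
  have hγp : γ ^ p = (3 - p) / k := by
    rw [hγ, ← Real.rpow_mul (by positivity), one_div_mul_cancel (by linarith), Real.rpow_one]
  have hγq : γ ^ q = ((3 - p) / k) ^ (q - 1) := by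
    rw [hγ, ← Real.rpow_mul (by positivity)]
    congr 1
    have := hpq.symm.sub_one_mul_conj
    have hp0 : p ≠ 0 := by linarith
    field_simp
    linarith
  set β : ℝ := (p - 1) * (L : ℝ) ^ q * (γ ^ q)⁻¹ with hβ
  have hβ0 : 0 ≤ β := mul_nonneg (mul_nonneg (by linarith) (by positivity)) (by positivity)
  set b : ℝ := k * β with hb
  have hb0 : 0 ≤ b := by positivity
  have hbeq : b = (p - 1) * (L : ℝ) ^ q * (k ^ q / (3 - p) ^ (q - 1)) := by
    rw [hb, hβ, hγq, Real.div_rpow h3p.le hk.le, inv_div,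
      show k ^ q = k ^ (q - 1) * k by
        rw [← Real.rpow_add_one hk.ne']; ring_nf]
    ring
  have hstep : ∀ s ∈ Icc 0 t, k * (M s - M 0) ≤ (E 0 - E s) + b * ∫ r in Ioc 0 s, M r := by
    intro s hs
    obtain ⟨-, hRi, hR⟩ := hf.ae_fisher_ne_top hp1 hp3 hp2 hq hf0 hs.1
    have h := (le_abs_self _).trans (hmom γ hγ0 0 s le_rfl hs.1 hs.2)
    rw [integral_add (hRi.const_mul _)
      ((hMi.mono_set (Ioc_subset_Ioc_right hs.2)).const_mul _), integral_const_mul,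
      integral_const_mul, hR, hγp, ← hβ] at h
    have h5 := mul_le_mul_of_nonneg_left h hk.le
    calc _ ≤ _ := h5
      _ = (E 0 - E s) + b * ∫ r in Ioc 0 s, M r := by
        simp only [hb, hE, hM]
        field_simp
  have hac : ContinuousOn M (Icc 0 t) := by
    obtain ⟨-, hRi, -⟩ := hf.ae_fisher_ne_top hp1 hp3 hp2 hq hf0 ht
    have := (absolutelyContinuousOnInterval_of_abs_sub_le ht
      ((hRi.const_mul _).add (hMi.const_mul _)) (hmom γ hγ0)).continuousOn
    rwa [uIcc_of_le ht] at this
  set A : ℝ := E 0 + a + k * M 0 with hA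
  have hHY : ∀ s ∈ Icc 0 t, E s + a + k * M s ≤ A + b * ∫ r in Ioc 0 s, M r := fun s hs => by
    have := hstep s hs
    simp only [hA]; linarith
  -- The loop closes through `b M ≤ c κ M ≤ c H ≤ c (A + b ∫ M)`.
  have hgr := add_setIntegral_le_mul_exp (A := A) (b := b) (c := c) hac (fun s hs => by
    have h5 : c * (κ * M s) ≤ c * (E s + a + k * M s) :=
      mul_le_mul_of_nonneg_left (h1 s hs.1) hc
    have h6 : b * M s ≤ c * κ * M s :=
      mul_le_mul_of_nonneg_right (hbeq ▸ hkc) (hM0 s hs.1)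
    have h7 := mul_le_mul_of_nonneg_left (hHY s hs) hc
    linarith) (right_mem_Icc.2 ht)
  have hJ : 0 ≤ ∫ r in Ioc 0 t, M r := setIntegral_nonneg measurableSet_Ioc fun r hr => hM0 r hr.1.le
  have htt := right_mem_Icc.2 ht
  refine ⟨?_, ?_⟩
  · have h5 : M t ≤ κ * M t := le_mul_of_one_le_left (hM0 t ht) hκ
    exact h5.trans ((h1 t ht).trans ((hHY t htt).trans hgr))
  -- By `h2`, `E 0 - E t ≤ E 0 + a + 3/4 k M t`, and `hstep` bounds `k M t` by `k M 0 + (E 0 - E t)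
  -- + b ∫ M`. Absorbing three quarters of `E 0 - E t` leaves the factor one quarter.
  · have h5 : (3 - p) / 4 * ((E 0 - E t) / (3 - p)) = (E 0 - E t) / 4 := by field_simp
    have h6 := hstep t htt
    have h7 := h2 t ht
    have h8 := hM0 0 le_rfl
    have h9 : 0 ≤ b * ∫ r in Ioc 0 t, M r := by positivity
    have h10 : 0 ≤ k * M 0 := by positivity
    change (3 - p) / 4 * ((E 0 - E t) / (3 - p)) ≤ A * Real.exp (c * t)
    rw [h5]
    refine le_trans ?_ hgr
    change 0 ≤ E t + a + 3 / 4 * (k * M t) at h7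
    simp only [hA]
    linarith

theorem entropy_add_nonneg_of_lt_two {p : ℝ} (hp1 : 1 < p) (hp2 : p < 2) {f : Lp ℝ 2 μ}
    (hf : ∀ᵐ x ∂μ, 0 ≤ f x) {z : ℝ} (hz : 0 < z) (hz1 : z ≤ 1) :
    0 ≤ entropy p f + z⁻¹ * max (1 / (2 - p)) 1 * ∫ x, f x ∂μ := by
  rw [(entropy_eq hp1 (by linarith) hf).2]
  have h1 : 0 ≤ ∫ x, f x ^ (3 - p) ∂μ := integral_nonneg_of_ae (by
    filter_upwards [hf] with x hx using Real.rpow_nonneg hx _)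
  have h2 : 0 ≤ ∫ x, f x ∂μ := integral_nonneg_of_ae hf
  have h3 : 1 ≤ z⁻¹ := (one_le_inv₀ hz).2 hz1
  have h4 : 0 ≤ 1 / (2 - p) := by
    have : 0 < 2 - p := by linarith
    positivity
  have h5 : 1 / (2 - p) ≤ z⁻¹ * max (1 / (2 - p)) 1 :=
    (le_max_left _ _).trans (le_mul_of_one_le_left (h4.trans (le_max_left _ _)) h3)
  have h6 := mul_le_mul_of_nonneg_right h5 h2
  have h7 := mul_nonneg h4 h1
  linarith

/-- The tangent line inequality for `r ↦ (r^(3-p) - r) / (2-p)` at `exp_p(-v)`. -/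
theorem le_entropy_density {p : ℝ} (hp2 : 2 < p) (hp3 : p < 3) {r v : ℝ} (hr : 0 ≤ r)
    (hv : 0 ≤ v) :
    r - expP p (-v) - (3 - p) * (v * r) - (p - 2) * (v * expP p (-v)) ≤
      1 / (2 - p) * (r ^ (3 - p) - r) := by
  set w := expP p (-v) with hw
  set B := 1 + (p - 2) * v with hB
  have hpv : 0 ≤ (p - 2) * v := mul_nonneg (by linarith) hv
  have hB0 : 0 < B := by linarith
  have hwB : w = B ^ (1 / (2 - p)) := by
    rw [hw, expP, hB]; ring_nf
  have hw0 : 0 ≤ w := hwB ▸ Real.rpow_nonneg hB0.le _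
  have h2p : 2 - p ≠ 0 := by linarith
  have hwp : w ^ (p - 2) = B⁻¹ := by
    rw [hwB, ← Real.rpow_mul hB0.le, ← Real.rpow_neg_one]
    congr 1
    field_simp
    ring
  -- Weighted AM–GM for `r` and `w` is the tangent line inequality for the concave power `3 - p`,
  -- since `w^(p-2) = B⁻¹`.
  have h := Real.geom_mean_le_arith_mean2_weighted (w₁ := 3 - p) (w₂ := p - 2) (by linarith)
    (by linarith) hr hw0 (by ring)
  rw [hwp, ← div_eq_mul_inv, div_le_iff₀ hB0] at h
  have h1 : 1 / (2 - p) * (r ^ (3 - p) - r) = (r - r ^ (3 - p)) / (p - 2) := by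
    have : p - 2 ≠ 0 := by linarith
    field_simp
    ring
  rw [h1, le_div_iff₀ (by linarith)]
  simp only [hB] at h
  nlinarith

/-- Integrate the tangent line inequality: the mass of exp_p(-V^p) is paid for by the `z`-term, and
its `V^p`-moment by I_p, whose factor 1/(3-p) exceeds one. -/
theorem entropy_add_nonneg_of_two_lt {p : ℝ} (hp2 : 2 < p) (hp3 : p < 3) {f : Lp ℝ 2 μ}
    (hf : ∀ᵐ x ∂μ, 0 ≤ f x) {V : X → ℝ} (hV : Continuous V) (hV0 : ∀ x, 0 ≤ V x)
    (hI : Integrable (fun x => V x ^ p * expP p (-(V x ^ p))) μ)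
    (hVf : Integrable (fun x => V x ^ p * f x) μ) {z : ℝ} (hz : 0 < z)
    (hzf : z * ∫ x, expP p (-(V x ^ p)) ∂μ ≤ ∫ x, f x ∂μ) :
    0 ≤ entropy p f + (entropyConst p μ V + z⁻¹ * max (1 / (2 - p)) 1 * ∫ x, f x ∂μ) +
      (3 - p) * ∫ x, V x ^ p * f x ∂μ := by
  have hp1 : 1 < p := by linarith
  have hVp : ∀ x, 0 ≤ V x ^ p := fun x => Real.rpow_nonneg (hV0 x) _
  have hB : ∀ x, 1 ≤ 1 + (2 - p) * -(V x ^ p) := fun x => by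
    nlinarith [mul_nonneg (sub_nonneg.2 hp2.le) (hVp x)]
  have hw0 : ∀ x, 0 ≤ expP p (-(V x ^ p)) := fun x =>
    Real.rpow_nonneg (zero_le_one.trans (hB x)) _
  have hw1 : ∀ x, expP p (-(V x ^ p)) ≤ 1 := fun x =>
    Real.rpow_le_one_of_one_le_of_nonpos (hB x)
      (div_nonpos_of_nonneg_of_nonpos zero_le_one (by linarith))
  have hVm : Measurable fun x => V x ^ p := hV.measurable.pow_const p
  have hwi : Integrable (fun x => expP p (-(V x ^ p))) μ := by
    refine Integrable.mono' (integrable_const 1) ?_ (ae_of_all _ fun x => ?_)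
    · exact (((hVm.neg.const_mul (2 - p)).const_add 1).pow_const _).aestronglyMeasurable
    · rw [Real.norm_of_nonneg (hw0 x)]; exact hw1 x
  have hfi := (Lp.memLp f).integrable (by norm_num)
  obtain ⟨hEi, -⟩ := entropy_eq hp1 hp3 hf
  have h1 : ∫ x, f x ∂μ - ∫ x, expP p (-(V x ^ p)) ∂μ - (3 - p) * ∫ x, V x ^ p * f x ∂μ -
      (p - 2) * ∫ x, V x ^ p * expP p (-(V x ^ p)) ∂μ ≤ entropy p f := by
    have i1 : Integrable (fun x => f x - expP p (-(V x ^ p))) μ := hfi.sub hwi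
    have i2 : Integrable (fun x => f x - expP p (-(V x ^ p)) - (3 - p) * (V x ^ p * f x)) μ :=
      i1.sub (hVf.const_mul _)
    rw [← integral_const_mul, ← integral_const_mul, ← integral_sub hfi hwi,
      ← integral_sub i1 (hVf.const_mul _), ← integral_sub i2 (hI.const_mul _)]
    refine integral_mono_ae (i2.sub (hI.const_mul _)) hEi ?_
    filter_upwards [hf] with x hx using le_entropy_density hp2 hp3 hx (hVp x)
  have hmax : max (1 / (2 - p)) 1 = 1 :=
    max_eq_right ((div_nonpos_of_nonneg_of_nonpos zero_le_one (by linarith)).trans zero_le_one)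
  have hz' : ∫ x, expP p (-(V x ^ p)) ∂μ ≤ z⁻¹ * ∫ x, f x ∂μ := by
    rw [inv_mul_eq_div, le_div_iff₀ hz, mul_comm]; exact hzf
  have hIJ : (p - 2) * ∫ x, V x ^ p * expP p (-(V x ^ p)) ∂μ ≤ entropyConst p μ V := by
    rw [entropyConst, if_neg (by linarith)]
    have hn : 0 ≤ ∫ x, V x ^ p * expP p (-(V x ^ p)) ∂μ :=
      integral_nonneg fun x => mul_nonneg (hVp x) (hw0 x)
    gcongr
    rw [le_div_iff₀ (by linarith)]
    nlinarith
  have hm : 0 ≤ ∫ x, f x ∂μ := integral_nonneg_of_ae hf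
  rw [hmax, mul_one]
  linarith

/-- As `1/q = (p-1)/p`, the claim reduces to `3 - p ≤ p^(q-1)`. Bernoulli's inequality gives
`2^(p-1) ≤ p`; raising to the power `q - 1 = 1/(p-1)` yields `2 ≤ p^(q-1)`. -/
theorem le_growthConst_of_lt_two {p q : ℝ} (hpq : p.HolderConjugate q) (hp2 : p < 2) :
    (p - 1) * (1 ^ q / (3 - p) ^ (q - 1)) ≤ growthConst p q := by
  have hp1 := hpq.lt
  have hq := hpq.symm.lt
  have h3p : 0 < 3 - p := by linarith
  have hkey : 3 - p ≤ p ^ (q - 1) := by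
    have h1 : (2 : ℝ) ^ (p - 1) ≤ p := by
      have := rpow_one_add_le_one_add_mul_self (s := 1) (by norm_num) (p := p - 1)
        (by linarith) (by linarith)
      norm_num at this
      linarith
    have h2 : (2 : ℝ) ≤ p ^ (q - 1) := by
      have h3 : (p - 1) * (q - 1) = 1 := by
        have := hpq.sub_one_mul_conj
        linarith
      calc (2 : ℝ) = (2 ^ (p - 1)) ^ (q - 1) := by
            rw [← Real.rpow_mul (by norm_num), h3, Real.rpow_one]
        _ ≤ p ^ (q - 1) := Real.rpow_le_rpow (by positivity) h1 (by linarith)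
    linarith
  have hpd : 1 / q = (p - 1) / p := by
    have := hpq.sub_one_mul_conj
    rw [div_eq_div_iff (by linarith) (by linarith)]; linarith
  rw [growthConst, if_pos hp2, one_mul, Real.one_rpow, div_eq_mul_one_div (_ ^ q) q, hpd,
    Real.div_rpow (by linarith) h3p.le]
  have e1 : (3 - p) ^ q = (3 - p) ^ (q - 1) * (3 - p) := by
    rw [← Real.rpow_add_one h3p.ne']; ring_nf
  have e2 : p ^ q = p ^ (q - 1) * p := by
    rw [← Real.rpow_add_one (by linarith)]; ring_nf
  rw [e1, e2]
  have hD : 0 < (3 - p) ^ (q - 1) := Real.rpow_pos_of_pos h3p _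
  have e3 : p ^ (q - 1) * p / ((3 - p) ^ (q - 1) * (3 - p)) * ((p - 1) / p) =
      (p - 1) * (1 / (3 - p) ^ (q - 1)) * (p ^ (q - 1) / (3 - p)) := by
    have : p ≠ 0 := by linarith
    field_simp
  rw [e3]
  refine le_mul_of_one_le_right (mul_nonneg (by linarith) (by positivity)) ?_
  rwa [one_le_div h3p]

/-- This is an equality when the maximum in C_p is its second entry, which is where `p (3-p) /
(2p-3)` comes from. -/
theorem le_growthConst_of_two_lt {p q : ℝ} (hpq : p.HolderConjugate q) (hp2 : 2 < p)
    (hp3 : p < 3) : (p - 1) * (p ^ q / (3 - p) ^ (q - 1)) ≤ growthConst p q * (2 * p - 3) := by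
  have hp1 := hpq.lt
  have hq := hpq.symm.lt
  have h3p : 0 < 3 - p := by linarith
  have h23 : 0 < 2 * p - 3 := by linarith
  have hpd : 1 / q = (p - 1) / p := by
    have := hpq.sub_one_mul_conj
    rw [div_eq_div_iff (by linarith) (by linarith)]; linarith
  have e1 : (3 - p) ^ q = (3 - p) ^ (q - 1) * (3 - p) := by
    rw [← Real.rpow_add_one h3p.ne']; ring_nf
  have hD : 0 < (3 - p) ^ (q - 1) := Real.rpow_pos_of_pos h3p _
  have hp0 : p ≠ 0 := by linarith
  rw [growthConst, if_neg (by linarith)]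
  calc (p - 1) * (p ^ q / (3 - p) ^ (q - 1))
      = p * (3 - p) / (2 * p - 3) * ((p / (3 - p)) ^ q / q) * (2 * p - 3) := by
        rw [div_eq_mul_one_div (_ ^ q) q, hpd, Real.div_rpow (by linarith) h3p.le, e1]
        have h32 : p * 2 - 3 ≠ 0 := by linarith
        field_simp
    _ ≤ _ := by
        have : 0 ≤ (p / (3 - p)) ^ q / q := by positivity
        gcongr
        exact le_max_right _ _

theorem growthConst_nonneg {p q : ℝ} (hpq : p.HolderConjugate q) (hp3 : p < 3) :
    0 ≤ growthConst p q := by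
  have h1 := hpq.lt
  have h2 := hpq.symm.lt
  have h3 : 0 < 3 - p := by linarith
  rw [growthConst]
  refine mul_nonneg ?_ (by positivity)
  split_ifs
  · exact zero_le_one
  · exact zero_le_one.trans (le_max_left _ _)

end Estimate

end QHeat

end

/-! ### The theorem: choice of the weight in the two ranges of p. -/

theorem mainTheorem10 {X : Type*} [MetricSpace X] [ProperSpace X] [MeasurableSpace X]
    [BorelSpace X] (μ : Measure X) [IsFiniteMeasure μ]
    (p q : ℝ) (hp1 : 1 < p) (hp3 : p < 3) (hp2 : p ≠ 2) (hpq : p.HolderConjugate q)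
    (V : X → ℝ) (hV : ∃ K : ℝ≥0, LipschitzWith K V)
    (ε : ℝ) (hε : 0 < ε) (hVε : ∀ x, ε ≤ V x)
    (hI : 2 < p → Integrable (fun x => V x ^ p * QHeat.expP p (-(V x ^ p))) μ)
    (hexp : 2 < p → ∫ x, QHeat.expP p (-(V x ^ p)) ∂μ ≤ 1)
    (f : ℝ → Lp ℝ 2 μ) (hf : QHeat.IsHeatFlow q f) (hf0 : 0 ≤ f 0)
    (hVf0 : Integrable (fun x => V x ^ p * f 0 x) μ)
    (z : ℝ) (hz : 0 < z)
    (hz_lt : p < 2 → z ≤ 1)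
    (hz_gt : 2 < p → z * ∫ x, QHeat.expP p (-(V x ^ p)) ∂μ ≤ ∫ x, f 0 x ∂μ) :
    (∀ t : ℝ, 0 ≤ t → Integrable (fun x => V x ^ p * f t x) μ) ∧
    (∀ T : ℝ, 0 ≤ T →
      AbsolutelyContinuousOnInterval (fun t => ∫ x, V x ^ p * f t x ∂μ) 0 T) ∧
    (∀ t : ℝ, 0 ≤ t →
      ∫ x, V x ^ p * f t x ∂μ ≤ QHeat.momentBound p q μ V z (f 0) t) ∧
    (∀ t : ℝ, 0 ≤ t →
      AEMeasurable (fun s => QHeat.fisher p q (f s)) (volume.restrict (Ioc 0 t)) ∧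
      ∫⁻ s in Ioc 0 t, QHeat.fisher p q (f s) ≤
        ENNReal.ofReal (4 / (3 - p) * QHeat.momentBound p q μ V z (f 0) t)) := by
  have hq := hpq.symm.lt
  have h3p : 0 < 3 - p := by linarith
  have hV0 : ∀ x, 0 ≤ V x := fun x => hε.le.trans (hVε x)
  have hVL := QHeat.lipschitzWith_lipConst hV
  have hnn := fun t ht => hf.nonneg hq hf0 (t := t) ht
  obtain ⟨hint, hmom⟩ := hf.moment hp3 hp2 hpq hf0 hVL hV0 hVf0
  set a : ℝ := QHeat.entropyConst p μ V + z⁻¹ * max (1 / (2 - p)) 1 * ∫ x, f 0 x ∂μ with ha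
  set M : ℝ → ℝ := fun t => ∫ x, V x ^ p * f t x ∂μ with hM
  have hM0 : ∀ t, 0 ≤ t → 0 ≤ M t := fun t ht => integral_nonneg_of_ae (by
    filter_upwards [hnn t ht] with x hx
    exact mul_nonneg (Real.rpow_nonneg (hV0 x) _) hx)
  have hbound : ∀ t, QHeat.momentBound p q μ V z (f 0) t =
      (QHeat.entropy p (f 0) + a + p * M 0) *
        Real.exp (QHeat.growthConst p q * QHeat.lipConst V ^ q * t) := by
    intro t
    obtain ⟨hEi, -⟩ := QHeat.entropy_eq hp1 hp3 (hnn 0 le_rfl)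
    have hfi := (Lp.memLp (f 0)).integrable (by norm_num)
    have e : ∀ x, (p * V x ^ p + z⁻¹ * max (1 / (2 - p)) 1) * f 0 x =
        p * (V x ^ p * f 0 x) + z⁻¹ * max (1 / (2 - p)) 1 * f 0 x := fun x => by ring
    have i2 : Integrable (fun x => p * (V x ^ p * f 0 x) + z⁻¹ * max (1 / (2 - p)) 1 * f 0 x) μ :=
      (hVf0.const_mul p).add (hfi.const_mul _)
    rw [QHeat.momentBound]
    simp_rw [e]
    rw [integral_add hEi i2, integral_add (hVf0.const_mul p) (hfi.const_mul _),
      integral_const_mul, integral_const_mul, integral_const_mul]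
    simp only [ha, hM, QHeat.entropy, integral_const_mul]
    ring
  set c : ℝ := QHeat.growthConst p q * QHeat.lipConst V ^ q with hc
  have hL0 : 0 ≤ QHeat.lipConst V := NNReal.coe_nonneg _
  have hLq : 0 ≤ QHeat.lipConst V ^ q := Real.rpow_nonneg hL0 q
  have hc0 : 0 ≤ c := mul_nonneg (QHeat.growthConst_nonneg hpq hp3) hLq
  have main : ∀ t, 0 ≤ t → M t ≤ QHeat.momentBound p q μ V z (f 0) t ∧
      (3 - p) / 4 * ((QHeat.entropy p (f 0) - QHeat.entropy p (f t)) / (3 - p)) ≤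
        QHeat.momentBound p q μ V z (f 0) t := by
    intro t ht
    -- S_t carries the weight `p`; a smaller weight gives a stronger bound since the initial moment
    -- is non-negative.
    suffices h : ∃ k, 0 < k ∧ k ≤ p ∧ M t ≤ (QHeat.entropy p (f 0) + a + k * M 0) *
        Real.exp (c * t) ∧
        (3 - p) / 4 * ((QHeat.entropy p (f 0) - QHeat.entropy p (f t)) / (3 - p)) ≤
          (QHeat.entropy p (f 0) + a + k * M 0) * Real.exp (c * t) by
      obtain ⟨k, hk0, hkp, h1, h2⟩ := h
      have hle : (QHeat.entropy p (f 0) + a + k * M 0) * Real.exp (c * t) ≤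
          QHeat.momentBound p q μ V z (f 0) t := by
        rw [hbound]
        have := hM0 0 le_rfl
        gcongr
      exact ⟨h1.trans hle, h2.trans hle⟩
    rcases lt_or_gt_of_ne hp2 with hlt | hgt
    · have hG : ∀ t, 0 ≤ t → 0 ≤ QHeat.entropy p (f t) + a := fun t ht => by
        have h1 := QHeat.entropy_add_nonneg_of_lt_two hp1 hlt (hnn t ht) hz (hz_lt hlt)
        rw [hf.integral_eq hq ht] at h1
        rw [ha, QHeat.entropyConst, if_pos hlt, zero_add]
        exact h1
      -- For `p < 2`, entropy plus `a` is already non-negative, so `k = κ = 1`.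
      refine ⟨1, one_pos, hp1.le, hf.momentum_entropy hp3 hp2 hpq hf0 hVL hV0 hVf0 one_pos
        (le_refl 1) hc0 ?_ (fun t ht => ?_) (fun t ht => ?_) ht⟩
      · have h1 := mul_le_mul_of_nonneg_right (QHeat.le_growthConst_of_lt_two hpq hlt) hLq
        rw [mul_one]
        refine le_trans (le_of_eq ?_) h1
        rw [QHeat.lipConst]; ring
      · linarith [hG t ht]
      · have h1 := hM0 t ht
        have h2 := hG t ht
        change 0 ≤ QHeat.entropy p (f t) + a + 3 / 4 * (1 * M t)
        linarith
    · have hG : ∀ t, 0 ≤ t → 0 ≤ QHeat.entropy p (f t) + a + (3 - p) * M t := fun t ht => by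
        have h1 := QHeat.entropy_add_nonneg_of_two_lt hgt hp3 (hnn t ht) hVL.continuous hV0
          (hI hgt) (hint t ht) hz (by rw [hf.integral_eq hq ht]; exact hz_gt hgt)
        rw [hf.integral_eq hq ht] at h1
        exact h1
      -- For `p > 2` the entropy costs `(3 - p) M`, so `k = p` leaves `κ = 2 p - 3 ≥ 1`. Also `3 - p
      -- ≤ 3 p / 4`, as the Fisher bound requires.
      refine ⟨p, by linarith, le_rfl, hf.momentum_entropy hp3 hp2 hpq hf0 hVL hV0 hVf0
        (by linarith) (show 1 ≤ 2 * p - 3 by linarith) hc0 ?_ (fun t ht => ?_) (fun t ht => ?_) ht⟩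
      · have h1 := mul_le_mul_of_nonneg_right (QHeat.le_growthConst_of_two_lt hpq hgt hp3) hLq
        refine le_trans (le_of_eq ?_) (h1.trans (le_of_eq ?_))
        · rw [QHeat.lipConst]; ring
        · rw [hc]; ring
      · have h2 := hG t ht
        change (2 * p - 3) * M t ≤ QHeat.entropy p (f t) + a + p * M t
        linarith
      · have h1 := hM0 t ht
        have h2 := hG t ht
        change 0 ≤ QHeat.entropy p (f t) + a + 3 / 4 * (p * M t)
        nlinarith
  refine ⟨hint, fun T hT => ?_, fun t ht => (main t ht).1, fun t ht => ?_⟩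
  · obtain ⟨-, hRi, -⟩ := hf.ae_fisher_ne_top hp1 hp3 hp2 hq hf0 hT
    obtain ⟨hMi, hm⟩ := hmom T hT
    exact QHeat.absolutelyContinuousOnInterval_of_abs_sub_le hT
      ((hRi.const_mul _).add (hMi.const_mul _)) (hm 1 one_pos)
  · obtain ⟨hmeas, hlin⟩ := hf.lintegral_fisher hp1 hp3 hp2 hq hf0
    refine ⟨hmeas.mono_measure (Measure.restrict_mono (fun r hr => hr.1) (le_refl volume)), ?_⟩
    rw [(hlin t ht).2]
    refine ENNReal.ofReal_le_ofReal ?_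
    have h1 := (main t ht).2
    rw [div_mul_eq_mul_div, le_div_iff₀ h3p]
    linarith
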